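/- Let $\Omega\subset\{(u^1,u^2)\in\mathbb R^2: u^1\neq 0\}$ be a connected non-empty open set and let $$R_3^{(2)}=\partial_x\begin{pmatrix}0&\partial_x\frac1{u^1}\\ \frac1{u^1}\partial_x&\frac{u^2}{(u^1)^2}\partial_x+\partial_x\frac{u^2}{(u^1)^2}\end{pmatrix}\partial_x .$$ Consider formally skew-adjoint operators $P_1=g^{ij}(u)\partial_x+\Gamma^{ij}_k(u)u^k_x$ ($i,j,k=1,2$) with smooth coefficients on $\Omega$, and call $P_1$ compatible with $R_3^{(2)}$ if the Schouten bracket $[P_1,R_3^{(2)}]$ vanishes. (a) If $P_1$ is compatible with $R_3^{(2)}$, there are unique constants $c_1,\dots,c_6\in\mathbb R$ such that $$g^{11}=c_1u^1+c_2u^2,\quad g^{12}=g^{21}=c_4u^1+\frac{c_3}{u^1}+\frac{c_2(u^2)^2}{2u^1},\quad g^{22}=2c_4u^2+\frac{c_6}{u^1}-\frac{c_1(u^2)^2}{u^1}+c_5,$$ and all $(c_1,\dots,c_6)\in\mathbb R^6$ occur in this way. (b) For such a $P_1$, the Levi-Civita conditions $g^{is}\Gamma^{jk}_s=g^{js}\Gamma^{ik}_s$,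 $\Gamma^{ij}_k+\Gamma^{ji}_k=\partial_kg^{ij}$ hold on $\Omega$ if and only if $$c_2c_6+2c_1c_3=0,\qquad c_2c_5=0,\qquad c_1c_5=0,\tag{$*$}$$ and $(*)$ implies that $g$ is flat, i.e. the curvature of the Levi-Civita connection of $(g_{ij})=(g^{ij})^{-1}$ vanishes wherever $\det(g^{ij})\ne0$. (c) $(*)$ holds if and only if one of the following holds: (1) $c_1\neq0$, $c_5=0$, $c_3=-\frac{c_2c_6}{2c_1}$; (2) $c_1=0$, $c_2\neq0$, $c_5=c_6=0$; (3) $c_1=c_2=0$. (d) Let $P_1$, $Q_1$ be compatible with $R_3^{(2)}$, with metrics $g$, $h$, connections $\Gamma_g$, $\Gamma_h$ and parameters $c_i$, $d_i$, where $c$ is in case $(k)$ and $d$ is in case $(l)$, and let $g_{\lambda,kl}=g-\lambda h$. Call $g_{\lambda,kl}$ a flat pencil if for every $\lambda\in\mathbb R$ the coefficients $\Gamma_g-\lambda\Gamma_h$ satisfy the Levi-Civita conditions for $g-\lambda h$, and $g-\lambda h$ is flat. Then: - $g_{\lambda,11}$ is a flat pencil if and only if $d_6=\frac{d_1c_6}{c_1}$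 or $d_2=\frac{d_1c_2}{c_1}$; - $g_{\lambda,12}$ is a flat pencil if and only if $d_3=-\frac{d_2c_6}{2c_1}$; - $g_{\lambda,13}$ is a flat pencil if and only if $d_3=-\frac{d_6c_2}{2c_1}$ and $d_5=0$; - $g_{\lambda,22}$ is always a flat pencil; - $g_{\lambda,23}$ is a flat pencil if and only if $d_5=d_6=0$; - $g_{\lambda,33}$ is always a flat pencil. Moreover, if $c$ and $d$ satisfy $(*)$ and $g$, $h$ are non-degenerate on $\Omega$, then $g-\lambda h$ is a flat pencil in the above sense if and only if, for every $\lambda\in\mathbb R$, at all points of $\Omega$ where $g-\lambda h$ is non-degenerate its curvature vanishes and its contravariant Christoffel symbols are those of $g$ minus $\lambda$ times those of $h$; here the contravariant Christoffel symbols of a metric are $\Gamma^{ij}_k=-g^{il}\Gamma^j_{lk}$, with $\Gamma^j_{lk}$ the Christoffel symbols of its Levi-Civita connection. -/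

import Mathlib

open scoped ContDiff

noncomputable section

namespace CompatibleTrio

/-- A point `(u¹, u²)`; the index `0` stands for the component `u¹`, the index `1` for `u²`. -/
abbrev Pt := Fin 2 → ℝ

/-- An operator on covector fields `ψ` along curves `x ↦ u(x)`, with coefficients depending on `u`:
`A u ψ x i` is the `i`-th component of `(A_u ψ)(x)`. -/
abbrev DiffOp := (ℝ → Pt) → (ℝ → Pt) → ℝ → Pt

/-- Coefficients `g^{ij}(u)` and `Γ^{ij}_k(u)` (`Γ i j k`) of a first-order homogeneous operator. -/
structure HydroOp where
  g : Fin 2 → Fin 2 → Pt → ℝ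
  Γ : Fin 2 → Fin 2 → Fin 2 → Pt → ℝ

/-- The operator `g^{ij}(u) ∂ₓ + Γ^{ij}_k(u) u^k_x`. -/
def HydroOp.toOp (P : HydroOp) : DiffOp := fun u ψ x i =>
  ∑ j, (P.g i j (u x) * deriv (fun y => ψ y j) x
    + (∑ k, P.Γ i j k (u x) * deriv (fun y => u y k) x) * ψ x j)

/-- The operator with coefficients `g - t h` and `Γ_g - t Γ_h`. -/
def HydroOp.pencil (P Q : HydroOp) (t : ℝ) : HydroOp where
  g := fun i j u => P.g i j u - t * Q.g i j u
  Γ := fun i j k u => P.Γ i j k u - t * Q.Γ i j k u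

def HydroOp.SmoothOn (P : HydroOp) (Ω : Set Pt) : Prop :=
  (∀ i j, ContDiffOn ℝ ∞ (P.g i j) Ω) ∧ ∀ i j k, ContDiffOn ℝ ∞ (P.Γ i j k) Ω

/-- The third-order operator
`∂ₓ ∘ [ 0 , ∂ₓ ∘ (1/u¹) ; (1/u¹) ∂ₓ , (u²/(u¹)²) ∂ₓ + ∂ₓ ∘ (u²/(u¹)²) ] ∘ ∂ₓ`. -/
def R3 : DiffOp := fun u ψ x =>
  let φ : Fin 2 → ℝ → ℝ := fun j => deriv (fun z => ψ z j)
  ![deriv (fun y => deriv (fun z => 1 / u z 0 * φ 1 z) y) x,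
    deriv (fun y => 1 / u y 0 * deriv (φ 0) y
      + (u y 1 / (u y 0) ^ 2 * deriv (φ 1) y
        + deriv (fun z => u z 1 / (u z 0) ^ 2 * φ 1 z) y)) x]

/-- Smooth curves in `Ω`, the fields on which the operators are evaluated. -/
def IsField (Ω : Set Pt) (u : ℝ → Pt) : Prop :=
  ContDiff ℝ ∞ u ∧ ∀ x, u x ∈ Ω

/-- Smooth compactly supported covector fields along a curve. -/
def IsTest (ψ : ℝ → Pt) : Prop :=
  ContDiff ℝ ∞ ψ ∧ HasCompactSupport ψ

/-- Formal skew-adjointness of an operator. -/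
def IsSkewAdjoint (Ω : Set Pt) (A : DiffOp) : Prop :=
  ∀ u φ ψ, IsField Ω u → IsTest φ → IsTest ψ →
    ∫ x, ∑ i, φ x i * A u ψ x i = - ∫ x, ∑ i, A u φ x i * ψ x i

/-- The linearization `ℓ_{A,ψ}(v)`: derivative of `A_u ψ` in the direction `v` of the field `u`. -/
def linearization (A : DiffOp) (u ψ v : ℝ → Pt) : ℝ → Pt := fun x i =>
  deriv (fun ε : ℝ => A (fun y => u y + ε • v y) ψ x i) 0

/-- The Schouten bracket of two skew-adjoint operators, evaluated at the field `u` on three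
covectors: the integral of the sum over cyclic permutations `(a, a+1, a+2)` of
`⟨ℓ_{A,ψ_a}(B ψ_{a+1}), ψ_{a+2}⟩ + ⟨ℓ_{B,ψ_a}(A ψ_{a+1}), ψ_{a+2}⟩`. -/
def schouten (A B : DiffOp) (u : ℝ → Pt) (ψ : Fin 3 → ℝ → Pt) : ℝ :=
  ∫ x, ∑ a : Fin 3, ∑ i : Fin 2,
    (linearization A u (ψ a) (B u (ψ (a + 1))) x i
      + linearization B u (ψ a) (A u (ψ (a + 1))) x i) * ψ (a + 2) x i

/-- `[A, B] = 0`. -/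
def SchoutenCommute (Ω : Set Pt) (A B : DiffOp) : Prop :=
  ∀ u, IsField Ω u → ∀ ψ : Fin 3 → ℝ → Pt, (∀ a, IsTest (ψ a)) → schouten A B u ψ = 0

/-- The smooth skew-adjoint first-order operators `P` with `[P, R3] = 0`. -/
def CompatibleWithR3 (Ω : Set Pt) (P : HydroOp) : Prop :=
  P.SmoothOn Ω ∧ IsSkewAdjoint Ω P.toOp ∧ SchoutenCommute Ω P.toOp R3

/-- The partial derivative `∂f/∂u^k`. -/
def pderiv (k : Fin 2) (f : Pt → ℝ) (u : Pt) : ℝ :=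
  fderiv ℝ f u (Pi.single k 1)

/-- The Levi-Civita conditions `g^{is} Γ^{jk}_s = g^{js} Γ^{ik}_s` and
`Γ^{ij}_k + Γ^{ji}_k = ∂_k g^{ij}`. -/
def LeviCivitaConditions (Ω : Set Pt) (P : HydroOp) : Prop :=
  ∀ u ∈ Ω,
    (∀ i j k, ∑ s, P.g i s u * P.Γ j k s u = ∑ s, P.g j s u * P.Γ i k s u) ∧
    ∀ i j k, P.Γ i j k u + P.Γ j i k u = pderiv k (P.g i j) u

/-- The matrix `(g^{ij}(u))`. -/
def contraMatrix (g : Fin 2 → Fin 2 → Pt → ℝ) (u : Pt) : Matrix (Fin 2) (Fin 2) ℝ :=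
  Matrix.of fun i j => g i j u

/-- `g^{ij}` is invertible at every point of `Ω`. -/
def IsNondegenerate (Ω : Set Pt) (g : Fin 2 → Fin 2 → Pt → ℝ) : Prop :=
  ∀ u ∈ Ω, (contraMatrix g u).det ≠ 0

/-- The covariant metric `g_{ij}`, inverse of `g^{ij}`. -/
def covMetric (g : Fin 2 → Fin 2 → Pt → ℝ) (i j : Fin 2) (u : Pt) : ℝ :=
  (contraMatrix g u)⁻¹ i j

/-- The Christoffel symbols `Γ^i_{jk}` of the Levi-Civita connection of `g_{ij}`. -/
def christoffel (g : Fin 2 → Fin 2 → Pt → ℝ) (i j k : Fin 2) (u : Pt) : ℝ :=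
  (1 / 2) * ∑ s, g i s u * (pderiv j (covMetric g s k) u + pderiv k (covMetric g s j) u
    - pderiv s (covMetric g j k) u)

/-- The contravariant Christoffel symbols `Γ^{ij}_k = - g^{il} Γ^j_{lk}`. -/
def contraChristoffel (g : Fin 2 → Fin 2 → Pt → ℝ) (i j k : Fin 2) (u : Pt) : ℝ :=
  - ∑ l, g i l u * christoffel g j l k u

/-- The Riemann curvature tensor `R^i_{jkl}` of the Levi-Civita connection of `g_{ij}`. -/
def riemann (g : Fin 2 → Fin 2 → Pt → ℝ) (i j k l : Fin 2) (u : Pt) : ℝ :=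
  pderiv k (christoffel g i l j) u - pderiv l (christoffel g i k j) u
    + ∑ s, (christoffel g i k s u * christoffel g s l j u
      - christoffel g i l s u * christoffel g s k j u)

/-- Flatness: the curvature vanishes wherever `g^{ij}` is non-degenerate. -/
def IsFlat (Ω : Set Pt) (g : Fin 2 → Fin 2 → Pt → ℝ) : Prop :=
  ∀ u ∈ Ω, (contraMatrix g u).det ≠ 0 → ∀ i j k l, riemann g i j k l u = 0

/-- `g - t h` with connection `Γ_g - t Γ_h` is a flat pencil: for all `t` the connection satisfies
the Levi-Civita conditions for `g - t h`, and `g - t h` is flat.  This makes sense for degenerate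
metrics as well. -/
def IsFlatPencil (Ω : Set Pt) (P Q : HydroOp) : Prop :=
  ∀ t : ℝ, LeviCivitaConditions Ω (P.pencil Q t) ∧ IsFlat Ω (P.pencil Q t).g

/-- Flat pencils of non-degenerate contravariant metrics `g`, `h`: at every point where `g - t h`
is non-degenerate its curvature vanishes and its contravariant Christoffel symbols are those of
`g` minus `t` times those of `h`. -/
def IsFlatPencilOfMetrics (Ω : Set Pt) (g h : Fin 2 → Fin 2 → Pt → ℝ) : Prop :=
  IsNondegenerate Ω g ∧ IsNondegenerate Ω h ∧
  ∀ t : ℝ, IsFlat Ω (fun i j u => g i j u - t * h i j u) ∧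
    ∀ u ∈ Ω, (contraMatrix (fun i j u => g i j u - t * h i j u) u).det ≠ 0 →
      ∀ i j k, contraChristoffel (fun i j u => g i j u - t * h i j u) i j k u
        = contraChristoffel g i j k u - t * contraChristoffel h i j k u

/-- The six constants `c₁, …, c₆`. -/
structure Params where
  p1 : ℝ
  p2 : ℝ
  p3 : ℝ
  p4 : ℝ
  p5 : ℝ
  p6 : ℝ

/-- The six-parameter family of contravariant metrics. -/
def metric (c : Params) (i j : Fin 2) (u : Pt) : ℝ :=
  !![c.p1 * u 0 + c.p2 * u 1,
      c.p4 * u 0 + c.p3 / u 0 + c.p2 * (u 1) ^ 2 / (2 * u 0);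
     c.p4 * u 0 + c.p3 / u 0 + c.p2 * (u 1) ^ 2 / (2 * u 0),
      2 * c.p4 * u 1 + c.p6 / u 0 - c.p1 * (u 1) ^ 2 / u 0 + c.p5] i j

/-- The leading coefficient of `P` is the member `c` of the family on `Ω`. -/
def HasMetric (Ω : Set Pt) (P : HydroOp) (c : Params) : Prop :=
  ∀ u ∈ Ω, ∀ i j, P.g i j u = metric c i j u

/-- The quadratic system on the parameters. -/
def Params.System (c : Params) : Prop :=
  c.p2 * c.p6 + 2 * c.p1 * c.p3 = 0 ∧ c.p2 * c.p5 = 0 ∧ c.p1 * c.p5 = 0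

def Params.Case1 (c : Params) : Prop :=
  c.p1 ≠ 0 ∧ c.p5 = 0 ∧ c.p3 = -(c.p2 * c.p6) / (2 * c.p1)

def Params.Case2 (c : Params) : Prop :=
  c.p1 = 0 ∧ c.p2 ≠ 0 ∧ c.p5 = 0 ∧ c.p6 = 0

def Params.Case3 (c : Params) : Prop :=
  c.p1 = 0 ∧ c.p2 = 0

end CompatibleTrio

end

/-!
Restricted to a curve `x ↦ u(x)`, the operators act on the differential ring `Smooth` of smooth
functions of one variable, and the Schouten bracket of `P` and `R3` is the integral of a trilinear
differential expression in three test covectors. Integration by parts (`exists_bracketDensity_eq`)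
moves all derivatives away from the third covector, so that `[P, R3] = 0` means that a bilinear
differential expression `bracketForm` vanishes along every curve. This expression is local, hence it
then vanishes on all smooth covectors, with compact support or not (`schoutenCommute_iff`). In the
same way skew-adjointness becomes a pointwise identity (`isSkewAdjoint_iff`), equivalent to the
symmetry of `g` together with `Γ^{ij}_k + Γ^{ji}_k = ∂_k g^{ij}`.

Necessity. `bracketForm` is evaluated at one point on covectors with monomial entries. Along
constant curves this expresses `Γ` through `g` and gives two first-order equations on `g`
(`firstOrderRelations`); along curves with velocity a basis vector it gives second-order equations
(`secondOrderRelations`). This overdetermined system is closed up by differentiation: the equality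
of two mixed third derivatives of `g²²` forces `g¹¹` to be homogeneous of degree one, after which
all second derivatives are known (`metricEquations`). The parameters `c₁, …, c₆` are then first
integrals, constant because `Ω` is connected (`exists_hasMetric`).

Sufficiency. For a member of the family all coefficients are polynomials in `u¹`, `u²` and
`a = 1 / u¹`, and the vanishing of `bracketForm` is a polynomial identity in the jets of the curve
and of the covectors (`bracketForm_familyData`).

Metric properties. For a compatible operator the condition on `∂_k g^{ij}` is automatic, and the
defect of the torsion condition `g^{is} Γ^{jk}_s = g^{js} Γ^{ik}_s` has two components, whose
coefficients as functions of `u` are the three quadratic expressions of the system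
(`IsMember.leviCivitaConditions_iff`). The coefficients `Γ^{ij}_k` of the family are gradients in
`k`; for such a connection the derivatives of `Γ` drop out of the curvature (`riemann_eq`), and the
remaining algebraic expression vanishes modulo the system (`IsMember.isFlat`). The family is linear
in its parameters, so a pencil is flat if and only if the polarized system holds for the two
parameter vectors (`isFlatPencil_iff`), and the cases are read off from this. For non-degenerate
metrics the contravariant Christoffel symbols are the coefficients `Γ^{ij}_k`
(`LeviCivitaAt.contraChristoffel_eq`), which connects this notion of flat pencil with the classical
one (`isFlatPencilOfMetrics_iff`).
-/

namespace CompatibleTrio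

/-! ### The bracket in a differential ring -/

/-- The restrictions to a curve of the coefficients of a first-order operator, in a ring `A` of
functions of `x`: `u` is the curve, `a` the function `1 / u¹`, `G i j k` is `Γ^{ij}_k`, `dg i j l`
is `∂_l g^{ij}` and `dG i j k l` is `∂_l Γ^{ij}_k`. The fields are independent: no relation between
them is imposed. -/
structure CurveData (A : Type*) where
  u : Fin 2 → A
  a : A
  g : Fin 2 → Fin 2 → A
  G : Fin 2 → Fin 2 → Fin 2 → A
  dg : Fin 2 → Fin 2 → Fin 2 → A
  dG : Fin 2 → Fin 2 → Fin 2 → Fin 2 → A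

section Expressions

variable {A : Type*} [CommRing A] (D : A → A) (J : CurveData A)

/-- The first-order operator `g ∂ₓ + Γ u_x`. -/
def firstOrder (ψ : Fin 2 → A) (i : Fin 2) : A :=
  ∑ j, (J.g i j * D (ψ j) + (∑ k, J.G i j k * D (J.u k)) * ψ j)

/-- The third-order operator `∂ₓ ∘ [0, ∂ₓ ∘ s; s ∂ₓ, t ∂ₓ + ∂ₓ ∘ t] ∘ ∂ₓ`. -/
def thirdOrder (s t : A) (ψ : Fin 2 → A) : Fin 2 → A :=
  ![D (D (s * D (ψ 1))), D (s * D (D (ψ 0)) + (t * D (D (ψ 1)) + D (t * D (ψ 1))))]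

/-- The operator `R3` along the curve. -/
def opR (ψ : Fin 2 → A) : Fin 2 → A := thirdOrder D J.a (J.u 1 * J.a ^ 2) ψ

/-- The linearization of the first-order operator. -/
def linP (ψ v : Fin 2 → A) (i : Fin 2) : A :=
  ∑ j, ((∑ l, J.dg i j l * v l) * D (ψ j)
    + (∑ k, ((∑ l, J.dG i j k l * v l) * D (J.u k) + J.G i j k * D (v k))) * ψ j)

/-- The linearization of `R3`, which is again of the form `thirdOrder` since the entries of `R3`
are linear in `1 / u¹` and `u² / (u¹)²`. -/
def linR (ψ v : Fin 2 → A) : Fin 2 → A :=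
  thirdOrder D (-(v 0 * J.a ^ 2)) (v 1 * J.a ^ 2 - 2 * J.u 1 * v 0 * J.a ^ 3) ψ

/-- The integrand of the Schouten bracket. -/
def bracketDensity (ψ : Fin 3 → Fin 2 → A) : A :=
  ∑ a : Fin 3, ∑ i : Fin 2,
    (linP D J (ψ a) (opR D J (ψ (a + 1))) i
      + linR D J (ψ a) (firstOrder D J (ψ (a + 1))) i) * ψ (a + 2) i

/-- Variational derivative with respect to the curve of `⟨P φ, χ⟩`, for the first-order operator
`P`. -/
def varP (φ χ : Fin 2 → A) (l : Fin 2) : A :=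
  ∑ i, ∑ j, (J.dg i j l * D (φ j) * χ i + (∑ k, J.dG i j k l * D (J.u k)) * φ j * χ i
    - D (J.G i j l * φ j * χ i))

/-- Variational derivative with respect to the curve of `⟨R3 φ, χ⟩`. -/
def varR (φ χ : Fin 2 → A) : Fin 2 → A :=
  ![-(J.a ^ 2 * (D (D (χ 0)) * D (φ 1) - D (χ 1) * D (D (φ 0))))
      + 2 * J.u 1 * J.a ^ 3 * (D (χ 1) * D (D (φ 1)) - D (D (χ 1)) * D (φ 1)),
    -(J.a ^ 2 * (D (χ 1) * D (D (φ 1)) - D (D (χ 1)) * D (φ 1)))]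

/-- Adjoint of `ψ ↦ linP ψ v`. -/
def adjLinP (v χ : Fin 2 → A) (j : Fin 2) : A :=
  ∑ i, (-D ((∑ l, J.dg i j l * v l) * χ i)
    + (∑ k, ((∑ l, J.dG i j k l * v l) * D (J.u k) + J.G i j k * D (v k))) * χ i)

/-- Adjoint of the first-order operator. -/
def adjP (χ : Fin 2 → A) (j : Fin 2) : A :=
  ∑ l, (-D (J.g l j * χ l) + (∑ k, J.G l j k * D (J.u k)) * χ l)

/-- The bilinear expression obtained from the Schouten bracket by moving all derivatives away from
the third covector. -/
def bracketForm (φ χ : Fin 2 → A) (j : Fin 2) : A :=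
  linP D J φ (opR D J χ) j + linR D J φ (firstOrder D J χ) j
    + adjLinP D J (opR D J φ) χ j - linR D J χ (firstOrder D J φ) j
    - opR D J (varP D J χ φ) j + adjP D J (varR D J χ φ) j

end Expressions

section Integration

variable {A : Type*} [CommRing A] [Algebra ℝ A] (D : Derivation ℝ A A) (J : CurveData A)

/-- A third-order operator of this form is skew-adjoint up to an explicit total derivative. -/
theorem thirdOrder_add_adjoint (s t : A) (ψ χ : Fin 2 → A) :
    ∑ i, (thirdOrder D s t ψ i * χ i + ψ i * thirdOrder D s t χ i) =
      D (D (s * D (ψ 1)) * χ 0 + D (s * D (χ 1)) * ψ 0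
        + (s * D (D (ψ 0)) + (t * D (D (ψ 1)) + D (t * D (ψ 1)))) * χ 1
        + (s * D (D (χ 0)) + (t * D (D (χ 1)) + D (t * D (χ 1)))) * ψ 1
        - s * D (ψ 1) * D (χ 0) - s * D (χ 1) * D (ψ 0) - 2 * t * D (ψ 1) * D (χ 1)) := by
  have h2 : D (2 : A) = 0 := by simpa using D.map_natCast 2
  simp only [Fin.sum_univ_two, thirdOrder, Matrix.cons_val_zero, Matrix.cons_val_one,
    map_add, map_sub, Derivation.leibniz, smul_eq_mul, h2]
  ring

/-- Skew-adjointness modulo total derivatives of elements of a `D`-stable ideal `K`, which stands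
for the compactly supported functions. -/
theorem exists_thirdOrder_adjoint {K : Ideal A} (hD : ∀ f ∈ K, D f ∈ K) (s t : A)
    {ψ : Fin 2 → A} (χ : Fin 2 → A) (hψ : ∀ i, ψ i ∈ K) :
    ∃ F ∈ K, ∑ i, thirdOrder D s t ψ i * χ i = -∑ i, ψ i * thirdOrder D s t χ i + D F := by
  have h := thirdOrder_add_adjoint D s t ψ χ
  rw [Finset.sum_add_distrib] at h
  refine ⟨_, ?_, eq_neg_add_of_add_eq ((add_comm _ _).trans h)⟩
  have h0 := hD _ (hψ 0)
  have h1 := hD _ (hψ 1)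
  have h00 := hD _ h0
  have h11 := hD _ h1
  refine K.sub_mem (K.sub_mem (K.sub_mem (K.add_mem (K.add_mem (K.add_mem ?_ ?_) ?_) ?_) ?_) ?_) ?_
  · exact K.mul_mem_right _ (hD _ (K.mul_mem_left _ h1))
  · exact K.mul_mem_left _ (hψ 0)
  · exact K.mul_mem_right _ (K.add_mem (K.mul_mem_left _ h00)
      (K.add_mem (K.mul_mem_left _ h11) (hD _ (K.mul_mem_left _ h1))))
  · exact K.mul_mem_left _ (hψ 1)
  · exact K.mul_mem_right _ (K.mul_mem_left _ h1)
  · exact K.mul_mem_left _ h0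
  · exact K.mul_mem_right _ (K.mul_mem_left _ h1)

theorem firstOrder_adjoint (ψ χ : Fin 2 → A) :
    ∑ i, firstOrder D J ψ i * χ i
      = ∑ j, ψ j * adjP D J χ j + D (∑ i, ∑ j, J.g i j * ψ j * χ i) := by
  simp only [Fin.sum_univ_two, firstOrder, adjP, map_add, Derivation.leibniz, smul_eq_mul]
  ring

theorem linP_adjoint (ψ v χ : Fin 2 → A) :
    ∑ i, linP D J ψ v i * χ i = ∑ j, ψ j * adjLinP D J v χ j
      + D (∑ i, ∑ j, ∑ l, J.dg i j l * v l * ψ j * χ i) := by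
  simp only [Fin.sum_univ_two, linP, adjLinP, map_add, Derivation.leibniz, smul_eq_mul]
  ring

theorem linP_variation (ψ v χ : Fin 2 → A) :
    ∑ i, linP D J ψ v i * χ i = ∑ l, v l * varP D J ψ χ l
      + D (∑ i, ∑ j, ∑ l, J.G i j l * v l * ψ j * χ i) := by
  simp only [Fin.sum_univ_two, linP, varP, map_add, Derivation.leibniz, smul_eq_mul]
  ring

theorem linR_variation (ψ v χ : Fin 2 → A) :
    ∑ i, linR D J ψ v i * χ i = ∑ l, v l * varR D J ψ χ l
      + D (D (-(v 0 * J.a ^ 2) * D (ψ 1)) * χ 0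
        + (-(v 0 * J.a ^ 2) * D (D (ψ 0))
          + ((v 1 * J.a ^ 2 - 2 * J.u 1 * v 0 * J.a ^ 3) * D (D (ψ 1))
            + D ((v 1 * J.a ^ 2 - 2 * J.u 1 * v 0 * J.a ^ 3) * D (ψ 1)))) * χ 1
        + v 0 * J.a ^ 2 * D (ψ 1) * D (χ 0)
        - (v 1 * J.a ^ 2 - 2 * J.u 1 * v 0 * J.a ^ 3) * D (ψ 1) * D (χ 1)) := by
  generalize hs : v 0 * J.a ^ 2 = s
  generalize ht : v 1 * J.a ^ 2 - 2 * J.u 1 * v 0 * J.a ^ 3 = t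
  have e : ∑ l, v l * varR D J ψ χ l = -s * (D (D (χ 0)) * D (ψ 1) - D (χ 1) * D (D (ψ 0)))
      - t * (D (χ 1) * D (D (ψ 1)) - D (D (χ 1)) * D (ψ 1)) := by
    rw [← hs, ← ht]
    simp only [Fin.sum_univ_two, varR, Matrix.cons_val_zero, Matrix.cons_val_one]
    ring
  rw [e]
  simp only [Fin.sum_univ_two, linR, hs, ht, thirdOrder, Matrix.cons_val_zero,
    Matrix.cons_val_one, map_add, map_sub, map_neg, Derivation.leibniz, smul_eq_mul]
  ring

/-- Integration by parts in the Schouten bracket: modulo total derivatives its integrand is the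
pairing of the third covector with `bracketForm` of the first two. -/
theorem exists_bracketDensity_eq {K : Ideal A} (hD : ∀ f ∈ K, D f ∈ K)
    (ψ : Fin 3 → Fin 2 → A) (hψ : ∀ a i, ψ a i ∈ K) :
    ∃ F ∈ K, bracketDensity D J ψ = ∑ j, ψ 2 j * bracketForm D J (ψ 0) (ψ 1) j + D F := by
  have e1 : (1 : Fin 3) + 1 = 2 := rfl
  have e2 : (1 : Fin 3) + 2 = 0 := rfl
  have e3 : (2 : Fin 3) + 1 = 0 := rfl
  have e4 : (2 : Fin 3) + 2 = 1 := rfl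
  have hsum : ∀ F : Fin 2 → A, (∀ i, F i ∈ K) → ∑ i, F i ∈ K := fun F h => K.sum_mem fun i _ => h i
  obtain ⟨F1, hF1, h1⟩ := exists_thirdOrder_adjoint D hD
    (-(firstOrder D J (ψ 0) 0 * J.a ^ 2)) (firstOrder D J (ψ 0) 1 * J.a ^ 2
      - 2 * J.u 1 * firstOrder D J (ψ 0) 0 * J.a ^ 3) (ψ 1) (hψ 2)
  obtain ⟨F2, hF2, h2⟩ := exists_thirdOrder_adjoint D hD J.a (J.u 1 * J.a ^ 2)
    (varP D J (ψ 1) (ψ 0)) (hψ 2)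
  have h3 := linP_adjoint D J (ψ 2) (opR D J (ψ 0)) (ψ 1)
  have h4 := linP_variation D J (ψ 1) (opR D J (ψ 2)) (ψ 0)
  have h5 := linR_variation D J (ψ 1) (firstOrder D J (ψ 2)) (ψ 0)
  have h6 := firstOrder_adjoint D J (ψ 2) (varR D J (ψ 1) (ψ 0))
  set F3 := ∑ i, ∑ j, ∑ l, J.dg i j l * opR D J (ψ 0) l * ψ 2 j * ψ 1 i with hF3
  set F4 := ∑ i, ∑ j, ∑ l, J.G i j l * opR D J (ψ 2) l * ψ 1 j * ψ 0 i with hF4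
  set F6 := ∑ i, ∑ j, J.g i j * ψ 2 j * varR D J (ψ 1) (ψ 0) i with hF6
  set F5 := D (-(firstOrder D J (ψ 2) 0 * J.a ^ 2) * D (ψ 1 1)) * ψ 0 0
        + (-(firstOrder D J (ψ 2) 0 * J.a ^ 2) * D (D (ψ 1 0))
          + ((firstOrder D J (ψ 2) 1 * J.a ^ 2
              - 2 * J.u 1 * firstOrder D J (ψ 2) 0 * J.a ^ 3) * D (D (ψ 1 1))
            + D ((firstOrder D J (ψ 2) 1 * J.a ^ 2
              - 2 * J.u 1 * firstOrder D J (ψ 2) 0 * J.a ^ 3) * D (ψ 1 1)))) * ψ 0 1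
        + firstOrder D J (ψ 2) 0 * J.a ^ 2 * D (ψ 1 1) * D (ψ 0 0)
        - (firstOrder D J (ψ 2) 1 * J.a ^ 2
          - 2 * J.u 1 * firstOrder D J (ψ 2) 0 * J.a ^ 3) * D (ψ 1 1) * D (ψ 0 1) with hF5
  refine ⟨F1 + F2 + F3 + F4 + F5 + F6, ?_, ?_⟩
  · refine K.add_mem (K.add_mem (K.add_mem (K.add_mem (K.add_mem hF1 hF2) ?_) ?_) ?_) ?_
    · exact hsum _ fun i => hsum _ fun j => hsum _ fun l => K.mul_mem_left _ (hψ 1 i)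
    · exact hsum _ fun i => hsum _ fun j => hsum _ fun l => K.mul_mem_left _ (hψ 0 i)
    · exact K.sub_mem (K.add_mem (K.add_mem (K.mul_mem_left _ (hψ 0 0))
        (K.mul_mem_left _ (hψ 0 1))) (K.mul_mem_left _ (hD _ (hψ 0 0))))
        (K.mul_mem_left _ (hD _ (hψ 0 1)))
    · exact hsum _ fun i => hsum _ fun j => K.mul_mem_right _ (K.mul_mem_left _ (hψ 2 j))
  · simp only [bracketDensity, Fin.sum_univ_three, zero_add, e1, e2, e3, e4, bracketForm,
      map_add] at *
    simp only [Fin.sum_univ_two, linR, opR] at *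
    linear_combination h1 + h2 + h3 + h4 + h5 + h6

end Integration

end CompatibleTrio

namespace CompatibleTrio

/-! ### The differential ring of smooth functions of one variable -/

open MeasureTheory Filter Topology

/-- The algebra of smooth functions `ℝ → ℝ`. -/
def Smooth : Subalgebra ℝ (ℝ → ℝ) where
  carrier := {f | ContDiff ℝ ∞ f}
  mul_mem' {f g} (hf : ContDiff ℝ ∞ f) (hg : ContDiff ℝ ∞ g) := hf.mul hg
  add_mem' {f g} (hf : ContDiff ℝ ∞ f) (hg : ContDiff ℝ ∞ g) := hf.add hg
  algebraMap_mem' c := show ContDiff ℝ ∞ (fun _ : ℝ => c) from contDiff_const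

theorem contDiff_smooth (f : Smooth) : ContDiff ℝ ∞ f.1 := f.2

theorem differentiable_smooth (f : Smooth) : Differentiable ℝ f.1 :=
  (contDiff_smooth f).differentiable (by simp)

theorem continuous_smooth (f : Smooth) : Continuous f.1 := (contDiff_smooth f).continuous

/-- Differentiation of smooth functions. -/
noncomputable def Dx : Derivation ℝ Smooth Smooth :=
  Derivation.mk'
    { toFun := fun f => ⟨deriv f.1, (contDiff_infty_iff_deriv.mp f.2).2⟩
      map_add' := fun f g => Subtype.ext <| funext fun x =>
        deriv_add ((differentiable_smooth f) x) ((differentiable_smooth g) x)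
      map_smul' := fun c f => Subtype.ext <| funext fun x =>
        deriv_const_smul c ((differentiable_smooth f) x) }
    (fun f g => Subtype.ext <| funext fun x => by
      have h := deriv_mul ((differentiable_smooth f) x) ((differentiable_smooth g) x)
      change deriv (f.1 * g.1) x = f.1 x * deriv g.1 x + g.1 x * deriv f.1 x
      rw [h]; ring)

theorem Dx_apply (f : Smooth) (x : ℝ) : (Dx f).1 x = deriv f.1 x := rfl

/-- Evaluation at a point. -/
def evalAt (x : ℝ) : Smooth →+* ℝ :=
  (Pi.evalRingHom (fun _ : ℝ => ℝ) x).comp (Subalgebra.val Smooth).toRingHom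

theorem evalAt_apply (x : ℝ) (f : Smooth) : evalAt x f = f.1 x := rfl

theorem smooth_ext {f g : Smooth} (h : ∀ x, evalAt x f = evalAt x g) : f = g :=
  Subtype.ext (funext h)

theorem hasDerivAt_evalAt (f : Smooth) (x : ℝ) : HasDerivAt f.1 (evalAt x (Dx f)) x :=
  ((differentiable_smooth f) x).hasDerivAt

/-- The ideal of compactly supported smooth functions. -/
def compactlySupported : Ideal Smooth where
  carrier := {f | HasCompactSupport f.1}
  add_mem' hf hg := HasCompactSupport.add hf hg
  zero_mem' := HasCompactSupport.zero
  smul_mem' _ _ hf := HasCompactSupport.mul_left hf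

theorem Dx_mem_compactlySupported (f : Smooth) (hf : f ∈ compactlySupported) :
    Dx f ∈ compactlySupported :=
  HasCompactSupport.deriv hf

theorem integrable_of_mem {f : Smooth} (hf : f ∈ compactlySupported) : Integrable f.1 :=
  (continuous_smooth f).integrable_of_hasCompactSupport hf

theorem integral_Dx_eq_zero {f : Smooth} (hf : f ∈ compactlySupported) :
    ∫ x, (Dx f).1 x = 0 :=
  integral_eq_zero_of_hasDerivAt_of_integrable (fun x => hasDerivAt_evalAt f x)
    (integrable_of_mem (Dx_mem_compactlySupported f hf)) (integrable_of_mem hf)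

theorem integral_add_Dx {f F : Smooth} (hf : f ∈ compactlySupported)
    (hF : F ∈ compactlySupported) : ∫ x, (f + Dx F).1 x = ∫ x, f.1 x := by
  have := integral_add (integrable_of_mem hf)
    (integrable_of_mem (Dx_mem_compactlySupported F hF))
  rw [integral_Dx_eq_zero hF, add_zero] at this
  exact this

theorem eq_zero_of_integral_mul {f : Smooth}
    (h : ∀ g ∈ compactlySupported, ∫ x, (g * f).1 x = 0) : f = 0 := by
  have h0 := ae_eq_zero_of_integral_contDiff_smul_eq_zero (μ := volume)
    (continuous_smooth f).locallyIntegrable (fun g hg hs => h ⟨g, hg⟩ hs)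
  exact Subtype.ext ((Continuous.ae_eq_iff_eq volume (continuous_smooth f) continuous_const).mp h0)

/-- A family of smooth functions vanishes if it is orthogonal to all families of test
functions. -/
theorem eq_zero_of_integral_sum_mul {f : Fin 2 → Smooth}
    (h : ∀ g : Fin 2 → Smooth, (∀ i, g i ∈ compactlySupported) →
      ∫ x, (∑ i, g i * f i).1 x = 0) (i : Fin 2) : f i = 0 := by
  refine eq_zero_of_integral_mul fun g hg => ?_
  have := h (Pi.single i g) (fun j => by
    by_cases hj : j = i
    · subst hj; simpa using hg
    · simp [Pi.single_eq_of_ne hj])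
  have e : ∑ j, (Pi.single i g : Fin 2 → Smooth) j * f j = g * f i := by
    rw [Finset.sum_eq_single i]
    · simp
    · intro j _ hj; simp [Pi.single_eq_of_ne hj]
    · simp
  rwa [e] at this

/-- A compactly supported function equal to `1` near a given point. -/
theorem exists_cutoff (x : ℝ) : ∃ χ ∈ compactlySupported, χ.1 =ᶠ[𝓝 x] 1 := by
  let b : ContDiffBump x := ⟨1, 2, one_pos, one_lt_two⟩
  exact ⟨⟨b, b.contDiff⟩, b.hasCompactSupport, b.eventuallyEq_one⟩

/-- Differentiation of germs. -/
noncomputable def germDeriv (x : ℝ) : Germ (𝓝 x) ℝ → Germ (𝓝 x) ℝ :=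
  Quotient.map' (fun f => deriv f) (fun _ _ h => EventuallyEq.deriv h)

/-- The germ of a smooth function at a point. -/
noncomputable def germAt (x : ℝ) : Smooth →+* Germ (𝓝 x) ℝ :=
  (Germ.coeRingHom (𝓝 x)).comp (Subalgebra.val Smooth).toRingHom

theorem germAt_Dx (x : ℝ) (f : Smooth) : germAt x (Dx f) = germDeriv x (germAt x f) := rfl

theorem evalAt_eq_of_germAt_eq {x : ℝ} {f g : Smooth} (h : germAt x f = germAt x g) :
    evalAt x f = evalAt x g :=
  (Germ.coe_eq.mp h).eq_of_nhds

/-! ### Locality of the bracket -/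

section Naturality

variable {A B : Type*} [CommRing A] [CommRing B]

/-- Transport of curve data along a map, such as evaluation or the passage to germs. -/
def CurveData.map (J : CurveData A) (π : A → B) : CurveData B where
  u := fun i => π (J.u i)
  a := π J.a
  g := fun i j => π (J.g i j)
  G := fun i j k => π (J.G i j k)
  dg := fun i j k => π (J.dg i j k)
  dG := fun i j k l => π (J.dG i j k l)

theorem map_thirdOrder (π : A →+* B) {D : A → A} {D' : B → B} (hD : ∀ f, π (D f) = D' (π f))
    (s t : A) (ψ : Fin 2 → A) (i : Fin 2) :
    π (thirdOrder D s t ψ i) = thirdOrder D' (π s) (π t) (fun i => π (ψ i)) i := by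
  fin_cases i <;> simp [thirdOrder, hD]

theorem map_firstOrder (π : A →+* B) {D : A → A} {D' : B → B} (hD : ∀ f, π (D f) = D' (π f))
    (J : CurveData A) (ψ : Fin 2 → A) (i : Fin 2) :
    π (firstOrder D J ψ i) = firstOrder D' (J.map π) (fun i => π (ψ i)) i := by
  simp [firstOrder, hD, CurveData.map]

theorem map_varR (π : A →+* B) {D : A → A} {D' : B → B} (hD : ∀ f, π (D f) = D' (π f))
    (J : CurveData A) (φ χ : Fin 2 → A) (i : Fin 2) :
    π (varR D J φ χ i) = varR D' (J.map π) (fun i => π (φ i)) (fun i => π (χ i)) i := by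
  have h2 : π 2 = 2 := map_ofNat π 2
  fin_cases i <;> simp [varR, hD, h2, CurveData.map]

theorem map_varP (π : A →+* B) {D : A → A} {D' : B → B} (hD : ∀ f, π (D f) = D' (π f))
    (J : CurveData A) (φ χ : Fin 2 → A) (i : Fin 2) :
    π (varP D J φ χ i) = varP D' (J.map π) (fun i => π (φ i)) (fun i => π (χ i)) i := by
  simp [varP, hD, CurveData.map]

theorem map_bracketForm (π : A →+* B) {D : A → A} {D' : B → B} (hD : ∀ f, π (D f) = D' (π f))
    (J : CurveData A) (φ χ : Fin 2 → A) (j : Fin 2) :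
    π (bracketForm D J φ χ j)
      = bracketForm D' (J.map π) (fun i => π (φ i)) (fun i => π (χ i)) j := by
  have h2 : π 2 = 2 := map_ofNat π 2
  simp only [bracketForm, linP, linR, opR, adjLinP, adjP, map_add, map_sub, map_neg, map_mul,
    map_sum, map_pow, h2, hD, map_thirdOrder π hD, map_firstOrder π hD, map_varR π hD,
    map_varP π hD]
  rfl

end Naturality

theorem germAt_cutoff_mul {x : ℝ} {χ : Smooth} (hχ : χ.1 =ᶠ[𝓝 x] 1) (f : Smooth) :
    germAt x (χ * f) = germAt x f := by
  have : germAt x χ = 1 := Germ.coe_eq.mpr hχ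
  rw [map_mul, this, one_mul]

/-- If the bracket vanishes on compactly supported covectors then it vanishes on all smooth ones,
since its value at a point depends only on germs. -/
theorem bracketForm_eq_zero_of_compactlySupported {J : CurveData Smooth}
    (h : ∀ φ χ : Fin 2 → Smooth, (∀ i, φ i ∈ compactlySupported) →
      (∀ i, χ i ∈ compactlySupported) → ∀ j, bracketForm Dx J φ χ j = 0)
    (φ χ : Fin 2 → Smooth) (j : Fin 2) : bracketForm Dx J φ χ j = 0 := by
  refine smooth_ext fun x => ?_
  obtain ⟨b, hb, hb1⟩ := exists_cutoff x
  have hK : ∀ f : Smooth, b * f ∈ compactlySupported := fun f => Ideal.mul_mem_right _ _ hb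
  rw [← h (fun i => b * φ i) (fun i => b * χ i) (fun i => hK _) (fun i => hK _) j]
  apply evalAt_eq_of_germAt_eq
  rw [map_bracketForm _ (germAt_Dx x), map_bracketForm _ (germAt_Dx x)]
  simp only [germAt_cutoff_mul hb1]

end CompatibleTrio

namespace CompatibleTrio

/-! ### The operators as differential expressions -/

open MeasureTheory Filter Topology

/-- The vector-valued function with given smooth components. Curves and covector fields are written
in this form throughout. -/
def vec (U : Fin 2 → Smooth) : ℝ → Pt := fun x i => (U i).1 x

theorem vec_apply (U : Fin 2 → Smooth) (x : ℝ) (i : Fin 2) : vec U x i = evalAt x (U i) := rfl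

theorem contDiff_vec (U : Fin 2 → Smooth) : ContDiff ℝ ∞ (vec U) :=
  contDiff_pi.mpr fun i => contDiff_smooth (U i)

theorem exists_eq_vec {u : ℝ → Pt} (hu : ContDiff ℝ ∞ u) : ∃ U, u = vec U :=
  ⟨fun i => ⟨fun x => u x i, contDiff_pi.mp hu i⟩, rfl⟩

theorem isField_vec {Ω : Set Pt} {U : Fin 2 → Smooth} :
    IsField Ω (vec U) ↔ ∀ x, vec U x ∈ Ω :=
  ⟨fun h => h.2, fun h => ⟨contDiff_vec U, h⟩⟩

theorem isTest_vec {Ψ : Fin 2 → Smooth} :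
    IsTest (vec Ψ) ↔ ∀ i, Ψ i ∈ compactlySupported := by
  refine ⟨fun h i => h.2.comp_left (g := fun p : Pt => p i) rfl,
    fun h => ⟨contDiff_vec Ψ, ?_⟩⟩
  refine HasCompactSupport.of_support_subset_isCompact
    (isCompact_iUnion fun i => (h i : IsCompact (tsupport (Ψ i).1))) fun x hx => ?_
  by_contra hcon
  refine hx (funext fun i => ?_)
  by_contra hi
  exact hcon (Set.mem_iUnion.mpr ⟨i, subset_tsupport _ hi⟩)

open Classical in
/-- A smooth function as an element of `Smooth`; other functions are sent to `0`. -/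
noncomputable def ofFun (f : ℝ → ℝ) : Smooth :=
  if h : ContDiff ℝ ∞ f then ⟨f, h⟩ else 0

theorem ofFun_val {f : ℝ → ℝ} (h : ContDiff ℝ ∞ f) : (ofFun f).1 = f := by
  simp [ofFun, h]

theorem contDiffOn_pderiv {Ω : Set Pt} (hΩ : IsOpen Ω) {f : Pt → ℝ} (hf : ContDiffOn ℝ ∞ f Ω)
    (k : Fin 2) : ContDiffOn ℝ ∞ (pderiv k f) Ω :=
  (hf.fderiv_of_isOpen hΩ le_rfl).clm_apply contDiffOn_const

theorem sum_pderiv_eq_fderiv (f : Pt → ℝ) (p v : Pt) :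
    ∑ l, pderiv l f p * v l = fderiv ℝ f p v := by
  conv_rhs => rw [← Finset.univ_sum_single v]
  rw [map_sum]
  refine Finset.sum_congr rfl fun l _ => ?_
  have : (Pi.single l (v l) : Pt) = v l • Pi.single l 1 := by
    rw [← Pi.single_smul, smul_eq_mul, mul_one]
  rw [this, map_smul, smul_eq_mul, mul_comm]
  rfl

/-- The coefficients of a first-order operator along a curve. The entries are the intended ones if
the curve stays in an open set on which the operator is smooth and `u¹ ≠ 0`; otherwise `ofFun` may
replace them by `0`. -/
noncomputable def curveData (P : HydroOp) (U : Fin 2 → Smooth) : CurveData Smooth where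
  u := U
  a := ofFun fun x => (vec U x 0)⁻¹
  g := fun i j => ofFun fun x => P.g i j (vec U x)
  G := fun i j k => ofFun fun x => P.Γ i j k (vec U x)
  dg := fun i j l => ofFun fun x => pderiv l (P.g i j) (vec U x)
  dG := fun i j k l => ofFun fun x => pderiv l (P.Γ i j k) (vec U x)

section Curve

variable {Ω : Set Pt} {U : Fin 2 → Smooth}

theorem contDiff_comp_vec (hU : ∀ x, vec U x ∈ Ω) {f : Pt → ℝ} (hf : ContDiffOn ℝ ∞ f Ω) :
    ContDiff ℝ ∞ fun x => f (vec U x) :=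
  hf.comp_contDiff (contDiff_vec U) hU

theorem evalAt_ofFun_comp (hU : ∀ x, vec U x ∈ Ω) {f : Pt → ℝ} (hf : ContDiffOn ℝ ∞ f Ω)
    (x : ℝ) : evalAt x (ofFun fun x => f (vec U x)) = f (vec U x) := by
  rw [evalAt_apply, ofFun_val (contDiff_comp_vec hU hf)]

theorem hasDerivAt_vec (U : Fin 2 → Smooth) (x : ℝ) :
    HasDerivAt (vec U) (vec (fun i => Dx (U i)) x) x :=
  hasDerivAt_pi.mpr fun i => hasDerivAt_evalAt (U i) x

/-- The chain rule along a curve. -/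
theorem Dx_ofFun_comp (hΩ : IsOpen Ω) (hU : ∀ x, vec U x ∈ Ω) {f : Pt → ℝ}
    (hf : ContDiffOn ℝ ∞ f Ω) :
    Dx (ofFun fun x => f (vec U x)) = ∑ l, (ofFun fun x => pderiv l f (vec U x)) * Dx (U l) := by
  refine smooth_ext fun x => ?_
  have hd : DifferentiableAt ℝ f (vec U x) :=
    (hf.differentiableOn (by simp)).differentiableAt (hΩ.mem_nhds (hU x))
  have h := hd.hasFDerivAt.comp_hasDerivAt x (hasDerivAt_vec U x)
  rw [evalAt_apply, Dx_apply, ofFun_val (contDiff_comp_vec hU hf)]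
  refine h.deriv.trans ?_
  simp only [map_sum, map_mul, evalAt_ofFun_comp hU (contDiffOn_pderiv hΩ hf _)]
  exact (sum_pderiv_eq_fderiv f _ _).symm

/-- The first-order operator along a curve is `firstOrder`. -/
theorem toOp_vec {P : HydroOp} (hP : P.SmoothOn Ω) (hU : ∀ x, vec U x ∈ Ω)
    (Ψ : Fin 2 → Smooth) :
    P.toOp (vec U) (vec Ψ) = vec (firstOrder Dx (curveData P U) Ψ) := by
  funext x i
  simp only [vec_apply, firstOrder, curveData, map_sum, map_add, map_mul,
    evalAt_ofFun_comp hU (hP.1 _ _), evalAt_ofFun_comp hU (hP.2 _ _ _)]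
  rfl

theorem R3_vec (a : Smooth) (ha : a * U 0 = 1) (Ψ : Fin 2 → Smooth) :
    R3 (vec U) (vec Ψ) = vec (thirdOrder Dx a (U 1 * a ^ 2) Ψ) := by
  have h1 : ∀ x, 1 / vec U x 0 = a.1 x := fun x => by
    have h : a.1 x * vec U x 0 = 1 := congrArg (evalAt x) ha
    exact (eq_one_div_of_mul_eq_one_left h).symm
  have h2 : ∀ x, vec U x 1 / (vec U x 0) ^ 2 = (U 1 * a ^ 2).1 x := fun x => by
    rw [div_eq_mul_one_div, ← one_div_pow, h1]; rfl
  funext x i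
  simp only [R3, h1, h2]
  fin_cases i <;> rfl

theorem exists_inv (hU : ∀ x, vec U x 0 ≠ 0) :
    (ofFun fun x => (vec U x 0)⁻¹) * U 0 = 1 ∧
      ∀ x, evalAt x (ofFun fun x => (vec U x 0)⁻¹) = (vec U x 0)⁻¹ := by
  have h : ∀ x, evalAt x (ofFun fun x => (vec U x 0)⁻¹) = (vec U x 0)⁻¹ := fun x => by
    rw [evalAt_apply, ofFun_val (f := fun x => (vec U x 0)⁻¹) ((contDiff_smooth (U 0)).inv hU)]
  refine ⟨smooth_ext fun x => ?_, h⟩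
  rw [map_mul, h, map_one]
  exact inv_mul_cancel₀ (hU x)

theorem Dx_inv {a f : Smooth} (h : a * f = 1) : Dx a = -(a * a * Dx f) := by
  have h1 : Dx (a * f) = 0 := by rw [h]; simp
  rw [Derivation.leibniz, smul_eq_mul, smul_eq_mul] at h1
  linear_combination a * h1 - Dx a * h

theorem hasDerivAt_line {f : Pt → ℝ} {p : Pt} (hf : DifferentiableAt ℝ f p) (v : Pt) :
    HasDerivAt (fun ε : ℝ => f (p + ε • v)) (∑ l, pderiv l f p * v l) 0 := by
  have h1 : HasDerivAt (fun ε : ℝ => p + ε • v) v 0 := by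
    simpa using ((hasDerivAt_id (0 : ℝ)).smul_const v).const_add p
  have h2 : HasFDerivAt f (fderiv ℝ f p) (p + (0 : ℝ) • v) := by
    simpa using hf.hasFDerivAt
  rw [sum_pderiv_eq_fderiv]
  exact h2.comp_hasDerivAt (0 : ℝ) h1

theorem linearization_toOp_vec {P : HydroOp} (hΩ : IsOpen Ω) (hP : P.SmoothOn Ω)
    (hU : ∀ x, vec U x ∈ Ω) (Ψ V : Fin 2 → Smooth) :
    linearization P.toOp (vec U) (vec Ψ) (vec V) = vec (linP Dx (curveData P U) Ψ V) := by
  funext x i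
  have hd : ∀ {f : Pt → ℝ}, ContDiffOn ℝ ∞ f Ω → DifferentiableAt ℝ f (vec U x) := fun hf =>
    (hf.differentiableOn (by simp)).differentiableAt (hΩ.mem_nhds (hU x))
  have hd1 : ∀ (ε : ℝ) (k : Fin 2), deriv (fun y => (vec U y + ε • vec V y) k) x
      = evalAt x (Dx (U k)) + ε * evalAt x (Dx (V k)) := fun ε k =>
    ((hasDerivAt_evalAt (U k) x).add ((hasDerivAt_evalAt (V k) x).const_mul ε)).deriv
  simp only [vec_apply, linP, curveData, map_sum, map_add, map_mul,
    evalAt_ofFun_comp hU (contDiffOn_pderiv hΩ (hP.1 _ _) _),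
    evalAt_ofFun_comp hU (contDiffOn_pderiv hΩ (hP.2 _ _ _) _),
    evalAt_ofFun_comp hU (hP.2 _ _ _)]
  refine HasDerivAt.deriv ?_
  simp only [HydroOp.toOp, hd1]
  refine HasDerivAt.fun_sum fun j _ => ((hasDerivAt_line (hd (hP.1 i j)) _).mul_const _).add
    (HasDerivAt.mul_const (HasDerivAt.fun_sum fun k _ => ?_) _)
  have h := (hasDerivAt_line (hd (hP.2 i j k)) (vec V x)).fun_mul
    (((hasDerivAt_id (0 : ℝ)).mul_const (evalAt x (Dx (V k)))).const_add (evalAt x (Dx (U k))))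
  simpa [vec_apply] using h

/-- A curve avoiding `u¹ = 0` still avoids it after a small compactly supported perturbation. -/
theorem eventually_ne_zero (hU : ∀ x, vec U x 0 ≠ 0) {v : Smooth} (hv : v ∈ compactlySupported) :
    ∀ᶠ ε : ℝ in 𝓝 0, ∀ x, (U 0 + ε • v).1 x ≠ 0 := by
  have hcont : Continuous fun p : ℝ × ℝ => (U 0).1 p.2 + p.1 * v.1 p.2 :=
    ((continuous_smooth (U 0)).comp continuous_snd).add
      (continuous_fst.mul ((continuous_smooth v).comp continuous_snd))
  have h1 : ∀ x ∈ tsupport v.1, ∀ᶠ p : ℝ × ℝ in 𝓝 0 ×ˢ 𝓝 x, (U 0).1 p.2 + p.1 * v.1 p.2 ≠ 0 := by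
    intro x _
    rw [← nhds_prod_eq]
    refine hcont.continuousAt.eventually_ne ?_
    simpa using (show (U 0).1 x ≠ 0 from hU x)
  have h2 := (IsCompact.eventually_forall_of_forall_eventually (K := tsupport v.1)
    (x₀ := (0 : ℝ)) (P := fun ε x => (U 0).1 x + ε * v.1 x ≠ 0) hv)
  have h3 := h2 fun x hx => by
    rw [nhds_prod_eq]; exact h1 x hx
  filter_upwards [h3] with ε hε x
  by_cases hx : x ∈ tsupport v.1
  · exact hε x hx
  · have h0 : v.1 x = 0 := image_eq_zero_of_notMem_tsupport hx
    change (U 0).1 x + ε * v.1 x ≠ 0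
    rw [h0, mul_zero, add_zero]
    exact hU x

/-- The linearization of `R3`. The direction has compact support, so that the perturbed curve avoids
`u¹ = 0` for all small parameters. -/
theorem linearization_R3_vec (hU : ∀ x, vec U x 0 ≠ 0) (P : HydroOp) (Ψ : Fin 2 → Smooth)
    {V : Fin 2 → Smooth} (hV : ∀ i, V i ∈ compactlySupported) :
    linearization R3 (vec U) (vec Ψ) (vec V) = vec (linR Dx (curveData P U) Ψ V) := by
  funext x i
  obtain ⟨ha, hax⟩ := exists_inv hU
  have hDa := Dx_inv ha
  -- along the perturbed curve `R3` is `thirdOrder` with its own inverse `b` of `u¹`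
  have hev : ∀ᶠ ε : ℝ in 𝓝 0, ∃ b : Smooth, b * (U 0 + ε • V 0) = 1 ∧
      evalAt x b = (evalAt x (U 0) + ε * evalAt x (V 0))⁻¹ ∧
      R3 (fun y => vec U y + ε • vec V y) (vec Ψ) x i
        = evalAt x (thirdOrder Dx b ((U 1 + ε • V 1) * (b * b)) Ψ i) := by
    filter_upwards [eventually_ne_zero hU (hV 0)] with ε hε
    obtain ⟨hb, hbx⟩ := exists_inv (U := fun i => U i + ε • V i) hε
    refine ⟨_, hb, hbx x, ?_⟩
    have := congrFun (congrFun (R3_vec (U := fun i => U i + ε • V i) _ hb Ψ) x) i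
    rw [pow_two] at this
    exact this
  have hne : evalAt x (U 0) ≠ 0 := hU x
  have hα : HasDerivAt (fun ε : ℝ => (evalAt x (U 0) + ε * evalAt x (V 0))⁻¹)
      (-(evalAt x (V 0)) / (evalAt x (U 0)) ^ 2) 0 := by
    have h := (((hasDerivAt_id (0 : ℝ)).mul_const (evalAt x (V 0))).const_add
      (evalAt x (U 0))).fun_inv (by simpa using hne)
    simpa using h
  have hl : ∀ c d : ℝ, HasDerivAt (fun ε : ℝ => c + ε * d) d 0 := fun c d => by
    simpa using ((hasDerivAt_id (0 : ℝ)).mul_const d).const_add c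
  have hs : ∀ (ε : ℝ) (f : Smooth), evalAt x (ε • f) = ε * evalAt x f := fun _ _ => rfl
  have hDs : ∀ (ε : ℝ) (f : Smooth), Dx (ε • f) = ε • Dx f := fun ε f => Dx.map_smul ε f
  have hax' : evalAt x (ofFun fun x => (vec U x 0)⁻¹) = (evalAt x (U 0))⁻¹ := hax x
  have h2 : evalAt x 2 = 2 := map_ofNat _ 2
  have hD2 : Dx (2 : Smooth) = 0 := by simpa using Dx.map_natCast 2
  rw [vec_apply]
  simp only [linR, show (curveData P U).a = ofFun fun x => (vec U x 0)⁻¹ from rfl,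
    show (curveData P U).u = U from rfl]
  generalize hA : (ofFun fun x => (vec U x 0)⁻¹) = a at *
  -- both components, expanded by the Leibniz rule, depend on `ε` only through affine functions and
  -- powers of the inverse of `u¹`
  fin_cases i
  · have hev' : (fun ε : ℝ => R3 (fun y => vec U y + ε • vec V y) (vec Ψ) x 0) =ᶠ[𝓝 0]
        fun ε => (2 * (evalAt x (U 0) + ε * evalAt x (V 0))⁻¹ ^ 3
            * (evalAt x (Dx (U 0)) + ε * evalAt x (Dx (V 0))) ^ 2
          - (evalAt x (U 0) + ε * evalAt x (V 0))⁻¹ ^ 2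
            * (evalAt x (Dx (Dx (U 0))) + ε * evalAt x (Dx (Dx (V 0)))))
            * evalAt x (Dx (Ψ 1))
          - 2 * (evalAt x (U 0) + ε * evalAt x (V 0))⁻¹ ^ 2
            * (evalAt x (Dx (U 0)) + ε * evalAt x (Dx (V 0))) * evalAt x (Dx (Dx (Ψ 1)))
          + (evalAt x (U 0) + ε * evalAt x (V 0))⁻¹ * evalAt x (Dx (Dx (Dx (Ψ 1)))) := by
      filter_upwards [hev] with ε ⟨b, hb, hbx, hR⟩
      refine hR.trans ?_
      simp only [thirdOrder, Fin.zero_eta, Matrix.cons_val_zero, Derivation.leibniz, smul_eq_mul,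
        map_add, map_neg, map_mul, hDs, Dx_inv hb, hs, hbx]
      ring
    have hd := ((((((hα.fun_pow 3).const_mul 2).fun_mul
      ((hl (evalAt x (Dx (U 0))) (evalAt x (Dx (V 0)))).fun_pow 2)).fun_sub
      ((hα.fun_pow 2).fun_mul (hl (evalAt x (Dx (Dx (U 0)))) (evalAt x (Dx (Dx (V 0))))))).mul_const
      (evalAt x (Dx (Ψ 1)))).fun_sub ((((hα.fun_pow 2).const_mul 2).fun_mul
      (hl (evalAt x (Dx (U 0))) (evalAt x (Dx (V 0))))).mul_const
        (evalAt x (Dx (Dx (Ψ 1)))))).fun_add (hα.mul_const (evalAt x (Dx (Dx (Dx (Ψ 1))))))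
    refine (hev'.deriv_eq.trans hd.deriv).trans ?_
    simp only [thirdOrder, Fin.zero_eta, Matrix.cons_val_zero, Derivation.leibniz, smul_eq_mul,
        map_add, map_sub, map_neg, map_mul, pow_two, hDa, hax', hD2, map_zero]
    simp only [zero_mul, add_zero, Nat.add_one_sub_one, Nat.cast_ofNat, pow_one]
    field_simp
    ring
  · have hev' : (fun ε : ℝ => R3 (fun y => vec U y + ε • vec V y) (vec Ψ) x 1) =ᶠ[𝓝 0]
        fun ε =>
          -((evalAt x (U 0) + ε * evalAt x (V 0))⁻¹ ^ 2
            * (evalAt x (Dx (U 0)) + ε * evalAt x (Dx (V 0)))) * evalAt x (Dx (Dx (Ψ 0)))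
          + (evalAt x (U 0) + ε * evalAt x (V 0))⁻¹ * evalAt x (Dx (Dx (Dx (Ψ 0))))
          + 3 * ((evalAt x (Dx (U 1)) + ε * evalAt x (Dx (V 1)))
              * (evalAt x (U 0) + ε * evalAt x (V 0))⁻¹ ^ 2
            - 2 * (evalAt x (U 1) + ε * evalAt x (V 1))
              * (evalAt x (U 0) + ε * evalAt x (V 0))⁻¹ ^ 3
              * (evalAt x (Dx (U 0)) + ε * evalAt x (Dx (V 0)))) * evalAt x (Dx (Dx (Ψ 1)))
          + 2 * ((evalAt x (U 1) + ε * evalAt x (V 1))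
              * (evalAt x (U 0) + ε * evalAt x (V 0))⁻¹ ^ 2) * evalAt x (Dx (Dx (Dx (Ψ 1))))
          + ((evalAt x (Dx (Dx (U 1))) + ε * evalAt x (Dx (Dx (V 1))))
              * (evalAt x (U 0) + ε * evalAt x (V 0))⁻¹ ^ 2
            - 4 * (evalAt x (Dx (U 1)) + ε * evalAt x (Dx (V 1)))
              * (evalAt x (U 0) + ε * evalAt x (V 0))⁻¹ ^ 3
              * (evalAt x (Dx (U 0)) + ε * evalAt x (Dx (V 0)))
            + 6 * (evalAt x (U 1) + ε * evalAt x (V 1))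
              * (evalAt x (U 0) + ε * evalAt x (V 0))⁻¹ ^ 4
              * (evalAt x (Dx (U 0)) + ε * evalAt x (Dx (V 0))) ^ 2
            - 2 * (evalAt x (U 1) + ε * evalAt x (V 1))
              * (evalAt x (U 0) + ε * evalAt x (V 0))⁻¹ ^ 3
              * (evalAt x (Dx (Dx (U 0))) + ε * evalAt x (Dx (Dx (V 0)))))
            * evalAt x (Dx (Ψ 1)) := by
      filter_upwards [hev] with ε ⟨b, hb, hbx, hR⟩
      refine hR.trans ?_
      simp only [thirdOrder, Fin.mk_one, Matrix.cons_val_one, Matrix.cons_val_fin_one,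
        Derivation.leibniz, smul_eq_mul, map_add, map_neg, map_mul, hDs, Dx_inv hb, hs, hbx]
      ring
    have hu0' := hl (evalAt x (Dx (U 0))) (evalAt x (Dx (V 0)))
    have hu0'' := hl (evalAt x (Dx (Dx (U 0)))) (evalAt x (Dx (Dx (V 0))))
    have hu1 := hl (evalAt x (U 1)) (evalAt x (V 1))
    have hu1' := hl (evalAt x (Dx (U 1))) (evalAt x (Dx (V 1)))
    have hu1'' := hl (evalAt x (Dx (Dx (U 1)))) (evalAt x (Dx (Dx (V 1))))
    have hd := ((((((hα.fun_pow 2).fun_mul hu0').fun_neg.mul_const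
        (evalAt x (Dx (Dx (Ψ 0))))).fun_add (hα.mul_const
        (evalAt x (Dx (Dx (Dx (Ψ 0))))))).fun_add ((((hu1'.fun_mul (hα.fun_pow 2)).fun_sub
        (((hu1.const_mul 2).fun_mul (hα.fun_pow 3)).fun_mul hu0')).const_mul 3).mul_const
        (evalAt x (Dx (Dx (Ψ 1)))))).fun_add (((hu1.fun_mul (hα.fun_pow 2)).const_mul 2).mul_const
        (evalAt x (Dx (Dx (Dx (Ψ 1))))))).fun_add
        ((((((hu1''.fun_mul (hα.fun_pow 2)).fun_sub
          (((hu1'.const_mul 4).fun_mul (hα.fun_pow 3)).fun_mul hu0')).fun_add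
          (((hu1.const_mul 6).fun_mul (hα.fun_pow 4)).fun_mul (hu0'.fun_pow 2))).fun_sub
          (((hu1.const_mul 2).fun_mul (hα.fun_pow 3)).fun_mul hu0''))).mul_const
          (evalAt x (Dx (Ψ 1))))
    refine (hev'.deriv_eq.trans hd.deriv).trans ?_
    simp only [thirdOrder, Fin.mk_one, Matrix.cons_val_one, Matrix.cons_val_fin_one,
      Derivation.leibniz, smul_eq_mul, map_add, map_sub, map_neg, map_mul, pow_succ, pow_zero,
      one_mul, hDa, hax', hD2, h2, map_zero]
    simp only [zero_mul, add_zero, Nat.cast_ofNat]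
    field_simp
    ring

end Curve

end CompatibleTrio

namespace CompatibleTrio

/-! ### Commutation and skew-adjointness without integrals -/

open MeasureTheory Filter Topology

section Curve

variable {Ω : Set Pt} {U : Fin 2 → Smooth}

theorem curveData_a_mul (hU : ∀ x, vec U x 0 ≠ 0) (P : HydroOp) :
    (curveData P U).a * (curveData P U).u 0 = 1 := (exists_inv hU).1

theorem opR_vec (hU : ∀ x, vec U x 0 ≠ 0) (P : HydroOp) (Ψ : Fin 2 → Smooth) :
    R3 (vec U) (vec Ψ) = vec (opR Dx (curveData P U) Ψ) :=
  R3_vec _ (exists_inv hU).1 Ψ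

theorem firstOrder_mem {K : Ideal Smooth} (hK : ∀ f ∈ K, Dx f ∈ K) (J : CurveData Smooth)
    {Ψ : Fin 2 → Smooth} (hΨ : ∀ i, Ψ i ∈ K) (i : Fin 2) : firstOrder Dx J Ψ i ∈ K :=
  K.sum_mem fun j _ => K.add_mem (K.mul_mem_left _ (hK _ (hΨ j))) (K.mul_mem_left _ (hΨ j))

theorem schouten_vec (hΩ : IsOpen Ω) (hne : ∀ u ∈ Ω, u 0 ≠ 0) {P : HydroOp}
    (hP : P.SmoothOn Ω) (hU : ∀ x, vec U x ∈ Ω) {Ψ : Fin 3 → Fin 2 → Smooth}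
    (hΨ : ∀ a i, Ψ a i ∈ compactlySupported) :
    schouten P.toOp R3 (vec U) (fun a => vec (Ψ a))
      = ∫ x, (bracketDensity Dx (curveData P U) Ψ).1 x := by
  have hU0 : ∀ x, vec U x 0 ≠ 0 := fun x => hne _ (hU x)
  unfold schouten
  congr 1
  funext x
  rw [← evalAt_apply]
  simp only [bracketDensity, map_sum, map_mul, map_add, opR_vec hU0 P, toOp_vec hP hU,
    linearization_toOp_vec hΩ hP hU]
  refine Finset.sum_congr rfl fun a _ => Finset.sum_congr rfl fun i _ => ?_
  rw [linearization_R3_vec hU0 P (Ψ a)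
    (firstOrder_mem Dx_mem_compactlySupported _ (hΨ (a + 1)))]
  rfl

theorem sum_mul_mem {K : Ideal Smooth} {Ψ : Fin 2 → Smooth} (hΨ : ∀ i, Ψ i ∈ K)
    (f : Fin 2 → Smooth) : ∑ i, Ψ i * f i ∈ K :=
  K.sum_mem fun i _ => K.mul_mem_right _ (hΨ i)

theorem integral_bracketDensity (J : CurveData Smooth) {Ψ : Fin 3 → Fin 2 → Smooth}
    (hΨ : ∀ a i, Ψ a i ∈ compactlySupported) :
    ∫ x, (bracketDensity Dx J Ψ).1 x
      = ∫ x, (∑ j, Ψ 2 j * bracketForm Dx J (Ψ 0) (Ψ 1) j).1 x := by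
  obtain ⟨F, hF, h⟩ := exists_bracketDensity_eq Dx J Dx_mem_compactlySupported Ψ hΨ
  rw [h, integral_add_Dx (sum_mul_mem (hΨ 2) _) hF]

/-- An operator commutes with `R3` if and only if the bilinear expression `bracketForm` vanishes
along all curves, on all smooth covectors, with compact support or not. -/
theorem schoutenCommute_iff (hΩ : IsOpen Ω) (hne : ∀ u ∈ Ω, u 0 ≠ 0) {P : HydroOp}
    (hP : P.SmoothOn Ω) :
    SchoutenCommute Ω P.toOp R3 ↔ ∀ U, (∀ x, vec U x ∈ Ω) → ∀ φ χ j,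
      bracketForm Dx (curveData P U) φ χ j = 0 := by
  constructor
  · intro h U hU
    refine bracketForm_eq_zero_of_compactlySupported fun φ χ hφ hχ =>
      eq_zero_of_integral_sum_mul fun ψ hψ => ?_
    have hΨ : ∀ a i, (![φ, χ, ψ] : Fin 3 → Fin 2 → Smooth) a i ∈ compactlySupported := by
      intro a
      fin_cases a
      exacts [hφ, hχ, hψ]
    have h1 := h (vec U) (isField_vec.mpr hU) (fun a => vec (![φ, χ, ψ] a))
      fun a => isTest_vec.mpr (hΨ a)
    rwa [schouten_vec hΩ hne hP hU hΨ, integral_bracketDensity _ hΨ] at h1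
  · intro h u hu ψ hψ
    obtain ⟨U, rfl⟩ := exists_eq_vec hu.1
    have hU := isField_vec.mp hu
    choose Ψ hΨ using fun a => exists_eq_vec (hψ a).1
    obtain rfl : ψ = fun a => vec (Ψ a) := funext hΨ
    have hK : ∀ a i, Ψ a i ∈ compactlySupported := fun a => isTest_vec.mp (hψ a)
    rw [schouten_vec hΩ hne hP hU hK, integral_bracketDensity _ hK]
    simp [h U hU]

theorem integral_firstOrder (J : CurveData Smooth) {Φ : Fin 2 → Smooth}
    (hΦ : ∀ i, Φ i ∈ compactlySupported) (Ψ : Fin 2 → Smooth) :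
    ∫ x, (∑ i, firstOrder Dx J Φ i * Ψ i).1 x = ∫ x, (∑ j, Φ j * adjP Dx J Ψ j).1 x := by
  rw [firstOrder_adjoint, integral_add_Dx (sum_mul_mem hΦ _)]
  exact Ideal.sum_mem _ fun i _ => Ideal.sum_mem _ fun j _ =>
    Ideal.mul_mem_right _ _ (Ideal.mul_mem_left _ _ (hΦ j))

theorem map_adjP {A B : Type*} [CommRing A] [CommRing B] (π : A →+* B) {D : A → A} {D' : B → B}
    (hD : ∀ f, π (D f) = D' (π f)) (J : CurveData A) (χ : Fin 2 → A) (i : Fin 2) :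
    π (adjP D J χ i) = adjP D' (J.map π) (fun i => π (χ i)) i := by
  simp [adjP, hD, CurveData.map]

/-- Skew-adjointness as a pointwise identity between the operator and its formal adjoint. -/
theorem isSkewAdjoint_iff {P : HydroOp} (hP : P.SmoothOn Ω) :
    IsSkewAdjoint Ω P.toOp ↔ ∀ U, (∀ x, vec U x ∈ Ω) → ∀ ψ j,
      firstOrder Dx (curveData P U) ψ j + adjP Dx (curveData P U) ψ j = 0 := by
  have key : ∀ U, (∀ x, vec U x ∈ Ω) → ∀ Φ Ψ : Fin 2 → Smooth,
      (∀ i, Φ i ∈ compactlySupported) →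
      ((∫ x, ∑ i, vec Φ x i * P.toOp (vec U) (vec Ψ) x i
        = - ∫ x, ∑ i, P.toOp (vec U) (vec Φ) x i * vec Ψ x i) ↔
      ∫ x, (∑ i, Φ i * (firstOrder Dx (curveData P U) Ψ i
        + adjP Dx (curveData P U) Ψ i)).1 x = 0) := by
    intro U hU Φ Ψ hΦ
    have e1 : ∫ x, ∑ i, vec Φ x i * P.toOp (vec U) (vec Ψ) x i
        = ∫ x, (∑ i, Φ i * firstOrder Dx (curveData P U) Ψ i).1 x := by
      congr 1; funext x
      rw [← evalAt_apply, map_sum, toOp_vec hP hU]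
      rfl
    have e2 : ∫ x, ∑ i, P.toOp (vec U) (vec Φ) x i * vec Ψ x i
        = ∫ x, (∑ i, firstOrder Dx (curveData P U) Φ i * Ψ i).1 x := by
      congr 1; funext x
      rw [← evalAt_apply, map_sum, toOp_vec hP hU]
      rfl
    have e3 : ∫ x, (∑ i, Φ i * (firstOrder Dx (curveData P U) Ψ i
          + adjP Dx (curveData P U) Ψ i)).1 x
        = (∫ x, (∑ i, Φ i * firstOrder Dx (curveData P U) Ψ i).1 x)
          + ∫ x, (∑ i, Φ i * adjP Dx (curveData P U) Ψ i).1 x := by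
      simp only [mul_add, Finset.sum_add_distrib]
      exact integral_add (integrable_of_mem (sum_mul_mem hΦ _))
        (integrable_of_mem (sum_mul_mem hΦ _))
    rw [e1, e2, e3, integral_firstOrder _ hΦ]
    exact eq_neg_iff_add_eq_zero
  constructor
  · intro h U hU ψ j
    refine smooth_ext fun x => ?_
    obtain ⟨b, hb, hb1⟩ := exists_cutoff x
    have hK : ∀ i, b * ψ i ∈ compactlySupported := fun i => Ideal.mul_mem_right _ _ hb
    rw [← eq_zero_of_integral_sum_mul (fun φ hφ => (key U hU φ (fun i => b * ψ i) hφ).mp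
      (h _ _ _ (isField_vec.mpr hU) (isTest_vec.mpr hφ) (isTest_vec.mpr hK))) j]
    apply evalAt_eq_of_germAt_eq
    rw [map_add, map_add, map_firstOrder _ (germAt_Dx x), map_firstOrder _ (germAt_Dx x),
      map_adjP _ (germAt_Dx x), map_adjP _ (germAt_Dx x)]
    simp only [germAt_cutoff_mul hb1]
  · intro h u φ ψ hu hφ hψ
    obtain ⟨U, rfl⟩ := exists_eq_vec hu.1
    obtain ⟨Φ, rfl⟩ := exists_eq_vec hφ.1
    obtain ⟨Ψ, rfl⟩ := exists_eq_vec hψ.1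
    have hU := isField_vec.mp hu
    rw [key U hU Φ Ψ (isTest_vec.mp hφ)]
    simp [h U hU]

end Curve

end CompatibleTrio

namespace CompatibleTrio

/-! ### The six-parameter family commutes with `R3` -/

section Linearity

variable {A : Type*} [CommRing A]

/-- Sum of two operators along the same curve. -/
def CurveData.add (J J' : CurveData A) : CurveData A where
  u := J.u
  a := J.a
  g := fun i j => J.g i j + J'.g i j
  G := fun i j k => J.G i j k + J'.G i j k
  dg := fun i j l => J.dg i j l + J'.dg i j l
  dG := fun i j k l => J.dG i j k l + J'.dG i j k l

variable [Algebra ℝ A] (D : Derivation ℝ A A)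

theorem firstOrder_add (J J' : CurveData A) (hu : J'.u = J.u) (ψ : Fin 2 → A) :
    firstOrder D (J.add J') ψ = fun i => firstOrder D J ψ i + firstOrder D J' ψ i := by
  funext i
  simp only [firstOrder, CurveData.add, hu, Fin.sum_univ_two]
  ring

theorem thirdOrder_add (s s' t t' : A) (ψ : Fin 2 → A) (i : Fin 2) :
    thirdOrder D (s + s') (t + t') ψ i = thirdOrder D s t ψ i + thirdOrder D s' t' ψ i := by
  fin_cases i
  · simp only [thirdOrder, Fin.zero_eta, Matrix.cons_val_zero, add_mul, map_add]
  · simp only [thirdOrder, Fin.mk_one, Matrix.cons_val_one, Matrix.cons_val_fin_one, add_mul, map_add]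
    ring

theorem thirdOrder_add_right (s t : A) (ψ χ : Fin 2 → A) (i : Fin 2) :
    thirdOrder D s t (fun i => ψ i + χ i) i = thirdOrder D s t ψ i + thirdOrder D s t χ i := by
  fin_cases i
  · simp only [thirdOrder, Fin.zero_eta, Matrix.cons_val_zero, mul_add, map_add]
  · simp only [thirdOrder, Fin.mk_one, Matrix.cons_val_one, Matrix.cons_val_fin_one, mul_add, map_add]
    ring

theorem linR_add (J J' : CurveData A) (ψ v w : Fin 2 → A) (i : Fin 2) :
    linR D (J.add J') ψ (fun i => v i + w i) i = linR D J ψ v i + linR D J ψ w i := by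
  rw [linR, linR, linR, ← thirdOrder_add]
  simp only [CurveData.add]
  congr 1 <;> ring

theorem varP_add (J J' : CurveData A) (hu : J'.u = J.u) (φ χ : Fin 2 → A) :
    varP D (J.add J') φ χ = fun l => varP D J φ χ l + varP D J' φ χ l := by
  funext l
  simp only [varP, CurveData.add, hu, Fin.sum_univ_two, add_mul, map_add]
  ring

/-- The bracket with `R3` is additive in the first-order operator. -/
theorem bracketForm_add (J J' : CurveData A) (hu : J'.u = J.u) (ha : J'.a = J.a)
    (φ χ : Fin 2 → A) (j : Fin 2) :
    bracketForm D (J.add J') φ χ j = bracketForm D J φ χ j + bracketForm D J' φ χ j := by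
  have h1 : ∀ ψ, opR D (J.add J') ψ = opR D J ψ := fun _ => rfl
  have h2 : ∀ ψ, opR D J' ψ = opR D J ψ := fun ψ => by rw [opR, opR, hu, ha]
  have h3 : ∀ φ χ, varR D (J.add J') φ χ = varR D J φ χ := fun _ _ => rfl
  have h4 : ∀ φ χ, varR D J' φ χ = varR D J φ χ := fun φ χ => by rw [varR, varR, hu, ha]
  have h5 : ∀ φ v i, linR D J' φ v i = linR D J φ v i := fun φ v i => by rw [linR, linR, hu, ha]
  simp only [bracketForm, h1, h2, h3, h4, h5, firstOrder_add D J J' hu, linR_add,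
    varP_add D J J' hu]
  rw [show opR D J (fun l => varP D J χ φ l + varP D J' χ φ l) j
    = opR D J (varP D J χ φ) j + opR D J (varP D J' χ φ) j from thirdOrder_add_right D _ _ _ _ _]
  simp only [linP, adjLinP, adjP, CurveData.add, hu, Fin.sum_univ_two, add_mul, map_add]
  ring

end Linearity

/-- The member `c` of the family along a curve `u`, with `a = 1 / u¹`. The connection is
`Γ^{ij}_k = ∂_k f^{ij}` for the potential `f` with entries `f¹¹ = (c₁ u¹ + c₂ u²) / 2`,
`f¹² = c₄ u¹ - c₁ u² / 2`, `f²¹ = c₃ / u¹ + c₂ (u²)² / (2 u¹) + c₁ u² / 2`,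
`f²² = c₆ / (2 u¹) - c₁ (u²)² / (2 u¹) + c₄ u²`, and `g` is `f + fᵀ` up to the constant `c₅`. -/
noncomputable def familyData {A : Type*} [CommRing A] [Algebra ℝ A] (c : Params) (u : Fin 2 → A)
    (a : A) : CurveData A :=
  let k := algebraMap ℝ A
  let v := u 1
  { u := u
    a := a
    g := ![![k c.p1 * u 0 + k c.p2 * v, k c.p4 * u 0 + k c.p3 * a + k (c.p2 / 2) * (a * (v * v))],
      ![k c.p4 * u 0 + k c.p3 * a + k (c.p2 / 2) * (a * (v * v)),
        k (2 * c.p4) * v + k c.p6 * a - k c.p1 * (a * (v * v)) + k c.p5]]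
    G := ![![![k (c.p1 / 2), k (c.p2 / 2)], ![k c.p4, -k (c.p1 / 2)]],
      ![![-(k c.p3 * (a * a)) - k (c.p2 / 2) * (a * a * (v * v)), k c.p2 * (a * v) + k (c.p1 / 2)],
        ![-(k (c.p6 / 2) * (a * a)) + k (c.p1 / 2) * (a * a * (v * v)),
          k c.p4 - k c.p1 * (a * v)]]]
    dg := ![![![k c.p1, k c.p2],
        ![k c.p4 - k c.p3 * (a * a) - k (c.p2 / 2) * (a * a * (v * v)), k c.p2 * (a * v)]],
      ![![k c.p4 - k c.p3 * (a * a) - k (c.p2 / 2) * (a * a * (v * v)), k c.p2 * (a * v)],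
        ![-(k c.p6 * (a * a)) + k c.p1 * (a * a * (v * v)), k (2 * c.p4) - k (2 * c.p1) * (a * v)]]]
    dG := ![![![![0, 0], ![0, 0]], ![![0, 0], ![0, 0]]],
      ![![![k (2 * c.p3) * (a * a * a) + k c.p2 * (a * a * a * (v * v)), -(k c.p2 * (a * a * v))],
          ![-(k c.p2 * (a * a * v)), k c.p2 * a]],
        ![![k c.p6 * (a * a * a) - k c.p1 * (a * a * a * (v * v)), k c.p1 * (a * a * v)],
          ![k c.p1 * (a * a * v), -(k c.p1 * a)]]]] }

/-- The family is linear in the parameters. The summands are kept apart because the bracket vanishes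
for different reasons: for the second and the third it suffices that `Dx a = -a² Dx u¹`, for the
first and the last `a u¹ = 1` is needed. -/
theorem familyData_eq_add {A : Type*} [CommRing A] [Algebra ℝ A] (c : Params) (u : Fin 2 → A)
    (a : A) :
    familyData c u a = (((familyData ⟨c.p1, 0, 0, 0, 0, 0⟩ u a).add
      (familyData ⟨0, c.p2, 0, 0, 0, 0⟩ u a)).add
      (familyData ⟨0, 0, c.p3, 0, c.p5, c.p6⟩ u a)).add
      (familyData ⟨0, 0, 0, c.p4, 0, 0⟩ u a) := by
  simp only [CurveData.add, familyData, CurveData.mk.injEq, true_and]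
  refine ⟨?_, ?_, ?_, ?_⟩
  · funext i j
    fin_cases i <;> fin_cases j <;> simp <;> ring
  · funext i j k
    fin_cases i <;> fin_cases j <;> fin_cases k <;> simp <;> ring
  · funext i j k
    fin_cases i <;> fin_cases j <;> fin_cases k <;> simp <;> ring
  · funext i j k l
    fin_cases i <;> fin_cases j <;> fin_cases k <;> fin_cases l <;> simp <;> ring

/-- A constant metric with vanishing connection. -/
noncomputable def constantData {A : Type*} [CommRing A] [Algebra ℝ A]
    (g : Matrix (Fin 2) (Fin 2) ℝ) (u : Fin 2 → A) (a : A) : CurveData A where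
  u := u
  a := a
  g := fun i j => algebraMap ℝ A (g i j)
  G := fun _ _ _ => 0
  dg := fun _ _ _ => 0
  dG := fun _ _ _ _ => 0

section Verification

set_option linter.unusedSimpArgs false

variable {u : Fin 2 → Smooth} {a : Smooth} {x : ℝ}

set_option maxHeartbeats 4000000 in
/-- For the parameter `c₁` the bracket vanishes only up to a multiple of `a u¹ - 1`. The cofactor is
the bracket of a constant metric: `u¹ - 1 / a` has derivative zero, so replacing `u¹` by `1 / a` in
`g¹¹ = c₁ u¹` changes the operator by a constant metric, and after the replacement the bracket
vanishes. -/
theorem evalAt_bracketForm_p1 (hD : Dx a = -(a * a * Dx (u 0))) (c : ℝ)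
    (φ χ : Fin 2 → Smooth) (j : Fin 2) :
    evalAt x a * evalAt x (bracketForm Dx (familyData ⟨c, 0, 0, 0, 0, 0⟩ u a) φ χ j)
      = (evalAt x a * evalAt x (u 0) - 1)
        * evalAt x (bracketForm Dx (constantData !![c, 0; 0, 0] u a) φ χ j) := by
  have hD2 : Dx (2 : Smooth) = 0 := by simpa using Dx.map_natCast 2
  have hc : ∀ c, evalAt x (algebraMap ℝ Smooth c) = c := fun _ => rfl
  have h2 : evalAt x 2 = 2 := map_ofNat _ 2
  fin_cases j
  all_goals
    simp only [bracketForm, linP, linR, opR, thirdOrder, varP, varR, firstOrder, adjLinP, adjP,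
      Fin.sum_univ_two, familyData, constantData, Matrix.of_apply, Matrix.cons_val_zero,
      Matrix.cons_val_one, Matrix.cons_val_fin_one, Fin.zero_eta, Fin.mk_one, mul_zero, zero_mul,
      add_zero, zero_add, sub_zero, neg_zero, map_zero, zero_sub, zero_div]
    simp only [Derivation.leibniz, smul_eq_mul, map_add, map_sub, map_neg, map_zero,
      Derivation.map_algebraMap, hD, hD2, pow_succ, pow_zero, one_mul, mul_zero, zero_mul,
      add_zero, zero_add, sub_zero, neg_zero, zero_sub]
    simp only [map_add, map_sub, map_neg, map_mul, map_zero, hc, h2]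
    ring

set_option maxHeartbeats 4000000 in
theorem evalAt_bracketForm_p2 (hD : Dx a = -(a * a * Dx (u 0))) (c : ℝ)
    (φ χ : Fin 2 → Smooth) (j : Fin 2) :
    evalAt x (bracketForm Dx (familyData ⟨0, c, 0, 0, 0, 0⟩ u a) φ χ j) = 0 := by
  have hD2 : Dx (2 : Smooth) = 0 := by simpa using Dx.map_natCast 2
  have hc : ∀ c, evalAt x (algebraMap ℝ Smooth c) = c := fun _ => rfl
  have h2 : evalAt x 2 = 2 := map_ofNat _ 2
  fin_cases j
  all_goals
    simp only [bracketForm, linP, linR, opR, thirdOrder, varP, varR, firstOrder, adjLinP, adjP,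
      Fin.sum_univ_two, familyData, Matrix.cons_val_zero, Matrix.cons_val_one,
      Matrix.cons_val_fin_one, Fin.zero_eta, Fin.mk_one, mul_zero, zero_mul, add_zero, zero_add,
      sub_zero, neg_zero, map_zero, zero_sub, zero_div]
    simp only [Derivation.leibniz, smul_eq_mul, map_add, map_sub, map_neg, map_zero,
      Derivation.map_algebraMap, hD, hD2, pow_succ, pow_zero, one_mul, mul_zero, zero_mul,
      add_zero, zero_add, sub_zero, neg_zero, zero_sub]
    simp only [map_add, map_sub, map_neg, map_mul, map_zero, hc, h2]
    ring

set_option maxHeartbeats 4000000 in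
theorem evalAt_bracketForm_p3_p5_p6 (hD : Dx a = -(a * a * Dx (u 0))) (c d e : ℝ)
    (φ χ : Fin 2 → Smooth) (j : Fin 2) :
    evalAt x (bracketForm Dx (familyData ⟨0, 0, c, 0, d, e⟩ u a) φ χ j) = 0 := by
  have hD2 : Dx (2 : Smooth) = 0 := by simpa using Dx.map_natCast 2
  have hc : ∀ c, evalAt x (algebraMap ℝ Smooth c) = c := fun _ => rfl
  have h2 : evalAt x 2 = 2 := map_ofNat _ 2
  fin_cases j
  all_goals
    simp only [bracketForm, linP, linR, opR, thirdOrder, varP, varR, firstOrder, adjLinP, adjP,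
      Fin.sum_univ_two, familyData, Matrix.cons_val_zero, Matrix.cons_val_one,
      Matrix.cons_val_fin_one, Fin.zero_eta, Fin.mk_one, mul_zero, zero_mul, add_zero, zero_add,
      sub_zero, neg_zero, map_zero, zero_sub, zero_div]
    simp only [Derivation.leibniz, smul_eq_mul, map_add, map_sub, map_neg, map_zero,
      Derivation.map_algebraMap, hD, hD2, pow_succ, pow_zero, one_mul, mul_zero, zero_mul,
      add_zero, zero_add, sub_zero, neg_zero, zero_sub]
    simp only [map_add, map_sub, map_neg, map_mul, map_zero, hc, h2]
    ring

set_option maxHeartbeats 4000000 in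
/-- For the parameter `c₄`, where `u¹` enters through `g¹² = c₄ u¹`, the bracket is again a multiple
of `a u¹ - 1`, for the same reason as in `evalAt_bracketForm_p1`. -/
theorem evalAt_bracketForm_p4 (hD : Dx a = -(a * a * Dx (u 0))) (c : ℝ)
    (φ χ : Fin 2 → Smooth) (j : Fin 2) :
    evalAt x a * evalAt x (bracketForm Dx (familyData ⟨0, 0, 0, c, 0, 0⟩ u a) φ χ j)
      = (evalAt x a * evalAt x (u 0) - 1)
        * evalAt x (bracketForm Dx (constantData !![0, c; c, 0] u a) φ χ j) := by
  have hD2 : Dx (2 : Smooth) = 0 := by simpa using Dx.map_natCast 2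
  have hc : ∀ c, evalAt x (algebraMap ℝ Smooth c) = c := fun _ => rfl
  have h2 : evalAt x 2 = 2 := map_ofNat _ 2
  fin_cases j
  all_goals
    simp only [bracketForm, linP, linR, opR, thirdOrder, varP, varR, firstOrder, adjLinP, adjP,
      Fin.sum_univ_two, familyData, constantData, Matrix.of_apply, Matrix.cons_val_zero,
      Matrix.cons_val_one, Matrix.cons_val_fin_one, Fin.zero_eta, Fin.mk_one, mul_zero, zero_mul,
      add_zero, zero_add, sub_zero, neg_zero, map_zero, zero_sub, zero_div]
    simp only [Derivation.leibniz, smul_eq_mul, map_add, map_sub, map_neg, map_zero,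
      Derivation.map_algebraMap, hD, hD2, pow_succ, pow_zero, one_mul, mul_zero, zero_mul,
      add_zero, zero_add, sub_zero, neg_zero, zero_sub]
    simp only [map_add, map_sub, map_neg, map_mul, map_zero, hc, h2]
    ring

end Verification

/-- The members of the family commute with `R3`. -/
theorem bracketForm_familyData (c : Params) {u : Fin 2 → Smooth} {a : Smooth} (ha : a * u 0 = 1)
    (φ χ : Fin 2 → Smooth) (j : Fin 2) : bracketForm Dx (familyData c u a) φ χ j = 0 := by
  refine smooth_ext fun x => ?_
  have h : evalAt x a * evalAt x (u 0) - 1 = 0 := by rw [← map_mul, ha, map_one, sub_self]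
  have h0 : evalAt x a ≠ 0 := left_ne_zero_of_mul_eq_one (sub_eq_zero.mp h)
  have h1 := evalAt_bracketForm_p1 (x := x) (Dx_inv ha) c.p1 φ χ j
  have h4 := evalAt_bracketForm_p4 (x := x) (Dx_inv ha) c.p4 φ χ j
  rw [h, zero_mul] at h1 h4
  rw [familyData_eq_add, bracketForm_add, bracketForm_add, bracketForm_add]
  · simp only [map_add, map_zero, (mul_eq_zero.mp h1).resolve_left h0,
      (mul_eq_zero.mp h4).resolve_left h0, evalAt_bracketForm_p2 (Dx_inv ha),
      evalAt_bracketForm_p3_p5_p6 (Dx_inv ha), add_zero]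
  all_goals rfl

end CompatibleTrio

namespace CompatibleTrio

/-! ### Test curves and test covectors -/

open Filter Topology

/-- The coordinate function of the line; its powers serve as components of test covectors. -/
def coord : Smooth := ⟨fun x => x, show ContDiff ℝ ∞ fun x : ℝ => x from contDiff_id⟩

theorem evalAt_zero_coord : evalAt 0 coord = 0 := rfl

theorem Dx_coord : Dx coord = 1 := smooth_ext fun x => by
  rw [evalAt_apply, Dx_apply, map_one]
  exact deriv_id x

/-- Through every point of an open set there is a smooth curve, defined for all times and staying in
the set, with prescribed velocity: the straight line, stopped by a cutoff. -/
theorem exists_curve {Ω : Set Pt} (hΩ : IsOpen Ω) {p : Pt} (hp : p ∈ Ω) (w : Pt) :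
    ∃ U : Fin 2 → Smooth, (∀ x, vec U x ∈ Ω) ∧ (∀ k, evalAt 0 (U k) = p k) ∧
      ∀ k, evalAt 0 (Dx (U k)) = w k := by
  obtain ⟨r, hr, hball⟩ := Metric.isOpen_iff.mp hΩ p hp
  obtain ⟨δ, hδ, hδr⟩ : ∃ δ > 0, δ * ‖w‖ < r :=
    ⟨r / (‖w‖ + 1), by positivity, by
      rw [div_mul_eq_mul_div, div_lt_iff₀ (by positivity)]
      nlinarith [norm_nonneg w]⟩
  let b : ContDiffBump (0 : ℝ) := ⟨δ / 2, δ, by positivity, by linarith⟩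
  let B : Smooth := ⟨b, b.contDiff⟩
  have hB : B.1 =ᶠ[𝓝 0] 1 := b.eventuallyEq_one
  have hg : ∀ k, germAt 0 (algebraMap ℝ Smooth (p k) + B * (algebraMap ℝ Smooth (w k) * coord))
      = germAt 0 (algebraMap ℝ Smooth (p k) + algebraMap ℝ Smooth (w k) * coord) := fun k => by
    rw [map_add, germAt_cutoff_mul hB, map_add]
  have hc : ∀ c, evalAt 0 (algebraMap ℝ Smooth c) = c := fun _ => rfl
  refine ⟨fun k => algebraMap ℝ Smooth (p k) + B * (algebraMap ℝ Smooth (w k) * coord),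
    fun x => hball ?_, fun k => ?_, fun k => ?_⟩
  · have hx : vec (fun k => algebraMap ℝ Smooth (p k) + B * (algebraMap ℝ Smooth (w k) * coord)) x
        = p + (b x * x) • w := by
      funext k
      change p k + b x * (w k * x) = p k + b x * x * w k
      ring
    rw [hx, mem_ball_iff_norm, add_sub_cancel_left, norm_smul]
    refine lt_of_le_of_lt (mul_le_mul_of_nonneg_right ?_ (norm_nonneg w)) hδr
    rw [norm_mul, Real.norm_of_nonneg b.nonneg]
    by_cases h : |x| < δ
    · exact (mul_le_of_le_one_left (norm_nonneg x) b.le_one).trans h.le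
    · have : b x = 0 := b.zero_of_le_dist (by simpa [Real.dist_eq] using not_lt.mp h)
      rw [this, zero_mul]
      exact hδ.le
  · rw [evalAt_eq_of_germAt_eq (hg k)]
    simp only [map_add, map_mul, hc, evalAt_zero_coord, mul_zero, add_zero]
  · rw [evalAt_eq_of_germAt_eq
      (g := Dx (algebraMap ℝ Smooth (p k) + algebraMap ℝ Smooth (w k) * coord))
      (congrArg (germDeriv 0) (hg k))]
    simp only [map_add, Derivation.leibniz, Derivation.map_algebraMap, Dx_coord, smul_eq_mul,
      mul_zero, add_zero, zero_add, mul_one, hc]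

/-! ### The bracket on special covectors -/

section Jets

set_option linter.unusedSimpArgs false

variable (J : CurveData Smooth)

local notation "e" => evalAt 0

/-- Values of the bracket along a constant curve. All coefficients are constant in `x`, so at
`x = 0` only those terms survive that differentiate the monomials completely. -/
theorem evalAt_bracketForm_of_Dx_eq_zero (hg : ∀ i j, Dx (J.g i j) = 0)
    (hG : ∀ i j k, Dx (J.G i j k) = 0) (hdg : ∀ i j k, Dx (J.dg i j k) = 0)
    (hu : ∀ i, Dx (J.u i) = 0) (ha : Dx J.a = 0) :
    (e (bracketForm Dx J ![coord * coord, 0] ![0, coord * coord] 0) =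
        -(12 * e J.a * e (J.dg 0 1 1)) + 24 * e J.a * e (J.G 0 1 1)
        + 12 * e J.a ^ 2 * e (J.g 0 0)) ∧
    (e (bracketForm Dx J ![coord * coord, 0] ![0, coord * coord] 1) =
        -(12 * e J.a * e (J.dg 0 1 0)) + 24 * e J.a * e (J.G 0 1 0) - 12 * e J.a ^ 2 * e (J.g 1 0)
        - 24 * e J.a ^ 2 * e (J.u 1) * e (J.dg 0 1 1) + 48 * e J.a ^ 2 * e (J.u 1) * e (J.G 0 1 1)
        + 24 * e J.a ^ 3 * e (J.u 1) * e (J.g 0 0)) ∧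
    (e (bracketForm Dx J ![1, 0] ![0, coord * coord * (coord * coord)] 0) =
        24 * e J.a * e (J.G 0 0 0) - 24 * e J.a * e (J.dg 0 1 1) + 24 * e J.a * e (J.G 0 1 1)
        + 48 * e J.a ^ 2 * e (J.G 0 0 1) * e (J.u 1)) ∧
    (e (bracketForm Dx J ![0, 1] ![0, coord * coord * (coord * coord)] 0) =
        24 * e J.a * e (J.G 0 1 0) - 24 * e J.a * e (J.dg 1 1 1) + 24 * e J.a * e (J.G 1 1 1)
        + 48 * e J.a ^ 2 * e (J.G 0 1 1) * e (J.u 1)) := by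
  have hD2 : Dx (2 : Smooth) = 0 := by simpa using Dx.map_natCast 2
  have h2 : evalAt 0 2 = 2 := map_ofNat _ 2
  have h1 : Dx (1 : Smooth) = 0 := Dx.map_one_eq_zero
  refine ⟨?_, ?_, ?_, ?_⟩
  all_goals
    simp only [bracketForm, linP, linR, opR, thirdOrder, varP, varR, firstOrder, adjLinP, adjP,
      Fin.sum_univ_two, Matrix.cons_val_zero, Matrix.cons_val_one, Matrix.cons_val_fin_one,
      mul_zero, zero_mul, add_zero, zero_add, sub_zero, neg_zero, map_zero, zero_sub, map_one,
      one_mul, mul_one, Derivation.leibniz, smul_eq_mul, map_add, map_sub, map_neg, h1, Dx_coord,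
      hD2, pow_two, pow_succ, pow_zero, hg, hG, hdg, hu, ha]
    simp only [map_add, map_sub, map_neg, map_mul, map_zero, map_one, evalAt_zero_coord, h2,
      mul_zero, zero_mul, add_zero, zero_add, sub_zero, neg_zero, zero_sub, one_mul, mul_one]
    ring

/-- Values of the bracket at a point where the curve has velocity `(0, 1)`. -/
theorem evalAt_bracketForm_of_velocity_one (hu : e (Dx (J.u 1)) = 1)
    (hu' : e (Dx (J.u 0)) = 0) (ha : e (Dx J.a) = 0) :
    (e (bracketForm Dx J ![1, 0] ![coord * coord * coord, 0] 0) =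
        -(18 * e J.a * e (Dx (J.dg 0 0 1))) + 24 * e J.a * e (Dx (J.G 0 0 1))) ∧
    (e (bracketForm Dx J ![1, 0] ![0, coord * coord * coord] 0) = 6 * e J.a * e (J.dG 0 0 1 0)
        - 18 * e J.a * e (Dx (J.dg 0 1 1)) - 6 * e J.a * e (J.dG 0 1 1 1)
        + 24 * e J.a * e (Dx (J.G 0 1 1)) + 12 * e J.a ^ 2 * e (J.dG 0 0 1 1) * e (J.u 1)
        + 36 * e J.a ^ 2 * e (J.G 0 0 1)) ∧
    (e (bracketForm Dx J ![1, 0] ![0, coord * coord * coord] 1) = 6 * e J.a * e (J.dG 1 0 1 0)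
        - 18 * e J.a * e (Dx (J.dg 0 1 0)) - 6 * e J.a * e (J.dG 0 1 1 0)
        + 24 * e J.a * e (Dx (J.G 0 1 0)) + 12 * e J.a ^ 2 * e (J.dG 1 0 1 1) * e (J.u 1)
        - 36 * e J.a ^ 2 * e (J.u 1) * e (Dx (J.dg 0 1 1))
        - 12 * e J.a ^ 2 * e (J.u 1) * e (J.dG 0 1 1 1)
        + 48 * e J.a ^ 2 * e (J.u 1) * e (Dx (J.G 0 1 1)) + 18 * e J.a ^ 2 * e (J.G 1 0 1)
        - 18 * e J.a ^ 2 * e (J.dg 0 1 1) + 18 * e J.a ^ 2 * e (J.G 0 1 1)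
        + 24 * e J.a ^ 3 * e (J.u 1) * e (J.G 0 0 1)) ∧
    (e (bracketForm Dx J ![0, 1] ![0, coord * coord * coord] 1) =
        -(18 * e J.a * e (Dx (J.dg 1 1 0))) + 24 * e J.a * e (Dx (J.G 1 1 0))
        - 36 * e J.a ^ 2 * e (J.u 1) * e (Dx (J.dg 1 1 1))
        + 48 * e J.a ^ 2 * e (J.u 1) * e (Dx (J.G 1 1 1)) + 36 * e J.a ^ 2 * e (J.G 1 1 1)
        - 18 * e J.a ^ 2 * e (J.dg 1 1 1) + 24 * e J.a ^ 3 * e (J.u 1) * e (J.G 0 1 1)) := by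
  have hD2 : Dx (2 : Smooth) = 0 := by simpa using Dx.map_natCast 2
  have h2 : evalAt 0 2 = 2 := map_ofNat _ 2
  have h1 : Dx (1 : Smooth) = 0 := Dx.map_one_eq_zero
  refine ⟨?_, ?_, ?_, ?_⟩
  all_goals
    simp only [bracketForm, linP, linR, opR, thirdOrder, varP, varR, firstOrder, adjLinP, adjP,
      Fin.sum_univ_two, Matrix.cons_val_zero, Matrix.cons_val_one, Matrix.cons_val_fin_one,
      mul_zero, zero_mul, add_zero, zero_add, sub_zero, neg_zero, map_zero, zero_sub, map_one,
      one_mul, mul_one, Derivation.leibniz, smul_eq_mul, map_add, map_sub, map_neg, h1, Dx_coord,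
      hD2, pow_two, pow_succ, pow_zero]
    simp only [map_add, map_sub, map_neg, map_mul, map_zero, map_one, evalAt_zero_coord, h2,
      mul_zero, zero_mul, add_zero, zero_add, sub_zero, neg_zero, zero_sub, one_mul, mul_one,
      hu, hu', ha]
    ring

/-- A value of the bracket at a point where the curve has velocity `(1, 0)`. -/
theorem evalAt_bracketForm_of_velocity_zero (hu : e (Dx (J.u 0)) = 1)
    (hu' : e (Dx (J.u 1)) = 0) (ha : e (Dx J.a) = -e J.a ^ 2) :
    e (bracketForm Dx J ![0, 1] ![0, coord * coord * coord] 1) =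
        -(18 * e J.a * e (Dx (J.dg 1 1 0))) + 24 * e J.a * e (Dx (J.G 1 1 0))
        - 36 * e J.a ^ 2 * e (J.u 1) * e (Dx (J.dg 1 1 1))
        + 48 * e J.a ^ 2 * e (J.u 1) * e (Dx (J.G 1 1 1)) - 36 * e J.a ^ 2 * e (J.G 1 1 0)
        + 6 * e J.a ^ 2 * e (J.dg 1 1 0) - 96 * e J.a ^ 3 * e (J.u 1) * e (J.G 1 1 1)
        + 24 * e J.a ^ 3 * e (J.u 1) * e (J.G 0 1 0)
        + 36 * e J.a ^ 3 * e (J.u 1) * e (J.dg 1 1 1) := by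
  have hD2 : Dx (2 : Smooth) = 0 := by simpa using Dx.map_natCast 2
  have h2 : evalAt 0 2 = 2 := map_ofNat _ 2
  have h1 : Dx (1 : Smooth) = 0 := Dx.map_one_eq_zero
  simp only [bracketForm, linP, linR, opR, thirdOrder, varP, varR, firstOrder, adjLinP, adjP,
    Fin.sum_univ_two, Matrix.cons_val_zero, Matrix.cons_val_one, Matrix.cons_val_fin_one,
    mul_zero, zero_mul, add_zero, zero_add, sub_zero, neg_zero, map_zero, zero_sub, map_one,
    one_mul, mul_one, Derivation.leibniz, smul_eq_mul, map_add, map_sub, map_neg, h1, Dx_coord,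
    hD2, pow_two, pow_succ, pow_zero]
  simp only [map_add, map_sub, map_neg, map_mul, map_zero, map_one, evalAt_zero_coord, h2,
    mul_zero, zero_mul, add_zero, zero_add, sub_zero, neg_zero, zero_sub, one_mul, mul_one,
    hu, hu', ha]
  ring

end Jets

end CompatibleTrio

namespace CompatibleTrio

/-! ### Partial derivatives -/

open Filter Topology

/-- The linear form on the plane with coefficients `d 0` and `d 1`. -/
noncomputable def linForm (d : Fin 2 → ℝ) : Pt →L[ℝ] ℝ :=
  d 0 • ContinuousLinearMap.proj 0 + d 1 • ContinuousLinearMap.proj 1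

theorem linForm_apply (d : Fin 2 → ℝ) (v : Pt) : linForm d v = d 0 * v 0 + d 1 * v 1 := rfl

/-- The function `f` is differentiable at `p` with partial derivatives `d 0` and `d 1`. -/
def HasPartials (f : Pt → ℝ) (d : Fin 2 → ℝ) (p : Pt) : Prop :=
  HasFDerivAt f (linForm d) p

namespace HasPartials

variable {f g : Pt → ℝ} {d e : Fin 2 → ℝ} {p : Pt}

theorem of_hasFDerivAt {L : Pt →L[ℝ] ℝ} (h : HasFDerivAt f L p)
    (hd : ∀ v : Pt, L v = d 0 * v 0 + d 1 * v 1) : HasPartials f d p :=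
  h.congr_fderiv (ContinuousLinearMap.ext hd)

theorem pderiv_eq (h : HasPartials f d p) (k : Fin 2) : pderiv k f p = d k := by
  rw [pderiv, HasFDerivAt.fderiv h, linForm_apply]
  fin_cases k <;> simp

theorem congr_partials (h : HasPartials f d p) (h0 : d 0 = e 0) (h1 : d 1 = e 1) :
    HasPartials f e p :=
  of_hasFDerivAt h fun v => by rw [linForm_apply, h0, h1]

theorem congr (h : HasPartials f d p) {Ω : Set Pt} (hΩ : IsOpen Ω) (hp : p ∈ Ω)
    (hfg : ∀ q ∈ Ω, g q = f q) : HasPartials g d p :=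
  HasFDerivAt.congr_of_eventuallyEq h (eventually_of_mem (hΩ.mem_nhds hp) hfg)

theorem const (c : ℝ) (p : Pt) : HasPartials (fun _ => c) (fun _ => 0) p :=
  of_hasFDerivAt (hasFDerivAt_const c p) fun v => by simp

theorem coord (k : Fin 2) (p : Pt) : HasPartials (fun q => q k) (Pi.single k 1) p :=
  of_hasFDerivAt (hasFDerivAt_apply k p) fun v => by fin_cases k <;> simp

theorem add (hf : HasPartials f d p) (hg : HasPartials g e p) :
    HasPartials (fun q => f q + g q) (fun k => d k + e k) p :=
  of_hasFDerivAt (HasFDerivAt.fun_add hf hg) fun v => by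
    simp only [add_apply, linForm_apply]; ring

theorem mul (hf : HasPartials f d p) (hg : HasPartials g e p) :
    HasPartials (fun q => f q * g q) (fun k => f p * e k + g p * d k) p :=
  of_hasFDerivAt (HasFDerivAt.fun_mul hf hg) fun v => by
    simp only [add_apply, smul_apply, smul_eq_mul, linForm_apply]
    ring

theorem const_mul (c : ℝ) (hf : HasPartials f d p) :
    HasPartials (fun q => c * f q) (fun k => c * d k) p :=
  ((const c p).mul hf).congr_partials (by ring) (by ring)

theorem neg (hf : HasPartials f d p) : HasPartials (fun q => -f q) (fun k => -d k) p := by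
  simpa only [neg_one_mul] using hf.const_mul (-1)

theorem sub (hf : HasPartials f d p) (hg : HasPartials g e p) :
    HasPartials (fun q => f q - g q) (fun k => d k - e k) p := by
  simpa only [sub_eq_add_neg] using hf.add hg.neg

theorem inv (hf : HasPartials f d p) (h0 : f p ≠ 0) :
    HasPartials (fun q => (f q)⁻¹) (fun k => -((f p)⁻¹ ^ 2 * d k)) p :=
  of_hasFDerivAt ((hasDerivAt_inv h0).comp_hasFDerivAt p hf) fun v => by
    simp only [smul_apply, smul_eq_mul, linForm_apply, inv_pow]
    ring

end HasPartials

section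

variable {Ω : Set Pt} {f : Pt → ℝ}

theorem hasPartials_of_contDiffOn (hΩ : IsOpen Ω) (hf : ContDiffOn ℝ ∞ f Ω) {p : Pt}
    (hp : p ∈ Ω) : HasPartials f (fun k => pderiv k f p) p := by
  have hd : DifferentiableAt ℝ f p :=
    (hf.differentiableOn (by simp)).differentiableAt (hΩ.mem_nhds hp)
  exact HasPartials.of_hasFDerivAt hd.hasFDerivAt fun v => by
    rw [← sum_pderiv_eq_fderiv, Fin.sum_univ_two]

theorem pderiv_comm (hΩ : IsOpen Ω) (hf : ContDiffOn ℝ ∞ f Ω) {p : Pt} (hp : p ∈ Ω) :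
    pderiv 0 (pderiv 1 f) p = pderiv 1 (pderiv 0 f) p := by
  have h2 : ContDiffAt ℝ ∞ f p := hf.contDiffAt (hΩ.mem_nhds hp)
  have hd : DifferentiableAt ℝ (fderiv ℝ f) p :=
    (h2.fderiv_right (m := 1) (by norm_cast)).differentiableAt (by simp)
  have key : ∀ k l, pderiv k (pderiv l f) p
      = fderiv ℝ (fderiv ℝ f) p (Pi.single k 1) (Pi.single l 1) := fun k l => by
    change fderiv ℝ (fun q => fderiv ℝ f q (Pi.single l 1)) p (Pi.single k 1) = _
    rw [fderiv_clm_apply hd (differentiableAt_const _)]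
    simp
  rw [key, key]
  exact (h2.isSymmSndFDerivAt (by simp; norm_cast)) _ _

/-- A function with vanishing gradient on a connected open set is constant. -/
theorem exists_eq_const (hΩ : IsOpen Ω) (hconn : IsConnected Ω)
    (h : ∀ p ∈ Ω, HasPartials f (fun _ => 0) p) : ∃ c, ∀ p ∈ Ω, f p = c := by
  have h' : ∀ p ∈ Ω, HasFDerivAt f (0 : Pt →L[ℝ] ℝ) p := fun p hp =>
    HasFDerivAt.congr_fderiv (h p hp) (ContinuousLinearMap.ext fun v => by simp [linForm_apply])
  exact hΩ.exists_is_const_of_fderiv_eq_zero hconn.isPreconnected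
    (fun p hp => (h' p hp).differentiableAt.differentiableWithinAt) fun p hp => (h' p hp).fderiv

end

/-! ### First-order equations on the metric -/

section

variable {Ω : Set Pt} {P : HydroOp} {U : Fin 2 → Smooth}

theorem vec_zero_eq {p : Pt} (h : ∀ k, evalAt 0 (U k) = p k) : vec U 0 = p := funext h

theorem evalAt_Dx_ofFun_comp (hΩ : IsOpen Ω) (hU : ∀ x, vec U x ∈ Ω) {f : Pt → ℝ}
    (hf : ContDiffOn ℝ ∞ f Ω) {p w : Pt} (hp : ∀ k, evalAt 0 (U k) = p k)
    (hw : ∀ k, evalAt 0 (Dx (U k)) = w k) :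
    evalAt 0 (Dx (ofFun fun x => f (vec U x))) = pderiv 0 f p * w 0 + pderiv 1 f p * w 1 := by
  rw [Dx_ofFun_comp hΩ hU hf, map_sum, Fin.sum_univ_two, map_mul, map_mul, hw, hw,
    evalAt_ofFun_comp hU (contDiffOn_pderiv hΩ hf _), evalAt_ofFun_comp hU
      (contDiffOn_pderiv hΩ hf _), vec_zero_eq hp]

/-- The curve staying at `p`. -/
noncomputable def constCurve (p : Pt) : Fin 2 → Smooth := fun k => algebraMap ℝ Smooth (p k)

theorem Dx_constCurve (p : Pt) (k : Fin 2) : Dx (constCurve p k) = 0 := Dx.map_algebraMap _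

theorem Dx_ofFun_constCurve (hΩ : IsOpen Ω) {p : Pt} (hp : p ∈ Ω) {f : Pt → ℝ}
    (hf : ContDiffOn ℝ ∞ f Ω) : Dx (ofFun fun x => f (vec (constCurve p) x)) = 0 := by
  rw [Dx_ofFun_comp hΩ (U := constCurve p) (fun _ => hp) hf]
  simp [Dx_constCurve]

/-- The leading coefficient of a skew-adjoint operator is symmetric: apply skew-adjointness to the
covector `x e_j` along a constant curve. -/
theorem metric_symm (hΩ : IsOpen Ω) (hP : P.SmoothOn Ω) (hS : IsSkewAdjoint Ω P.toOp) {p : Pt}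
    (hp : p ∈ Ω) (i j : Fin 2) : P.g i j p = P.g j i p := by
  have hU : ∀ x, vec (constCurve p) x ∈ Ω := fun _ => hp
  have h := congrArg (evalAt 0) ((isSkewAdjoint_iff hP).mp hS (constCurve p) hU
    (Pi.single j coord) i)
  have h1 : ∀ k l, evalAt 0 ((curveData P (constCurve p)).g k l) = P.g k l p :=
    fun k l => evalAt_ofFun_comp hU (hP.1 k l) 0
  have h3 : ∀ k l, Dx ((curveData P (constCurve p)).g k l) = 0 := fun k l =>
    Dx_ofFun_constCurve hΩ hp (hP.1 k l)
  have h2 : ∀ k, Dx ((curveData P (constCurve p)).u k) = 0 := Dx_constCurve p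
  simp only [firstOrder, adjP, Pi.single_apply, map_add, map_sum, map_mul, Derivation.leibniz,
    smul_eq_mul, h1, h2, h3, map_neg, map_zero, mul_zero, Finset.sum_const_zero, apply_ite Dx,
    apply_ite (evalAt 0), Dx_coord, map_one] at h
  simp only [mul_ite, mul_one, mul_zero, zero_mul, Finset.sum_add_distrib, Finset.sum_neg_distrib,
    Finset.sum_ite_eq', Finset.mem_univ, if_true, add_zero] at h
  linarith

theorem pderiv_metric_symm (hΩ : IsOpen Ω) (hP : P.SmoothOn Ω) (hS : IsSkewAdjoint Ω P.toOp)
    {p : Pt} (hp : p ∈ Ω) (i j k : Fin 2) : pderiv k (P.g i j) p = pderiv k (P.g j i) p :=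
  ((hasPartials_of_contDiffOn hΩ (hP.1 j i) hp).congr hΩ hp
    fun _ hq => metric_symm hΩ hP hS hq i j).pderiv_eq k

/-- Skew-adjointness applied to the covector `e_j` along a curve with velocity `e_l`. -/
theorem connection_add_connection (hΩ : IsOpen Ω) (hP : P.SmoothOn Ω)
    (hS : IsSkewAdjoint Ω P.toOp) {p : Pt} (hp : p ∈ Ω) (i j l : Fin 2) :
    P.Γ i j l p + P.Γ j i l p = pderiv l (P.g i j) p := by
  obtain ⟨U, hU, hU0, hU1⟩ := exists_curve hΩ hp (Pi.single l 1)
  have h := congrArg (evalAt 0) ((isSkewAdjoint_iff hP).mp hS U hU (Pi.single j 1) i)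
  have h1 : ∀ m k, evalAt 0 (Dx ((curveData P U).g m k)) = pderiv l (P.g m k) p :=
    fun m k => by
      refine (evalAt_Dx_ofFun_comp hΩ hU (hP.1 m k) hU0 hU1).trans ?_
      fin_cases l <;> simp
  have h2 : ∀ i j k, evalAt 0 ((curveData P U).G i j k) = P.Γ i j k p :=
    fun i j k => (evalAt_ofFun_comp hU (hP.2 i j k) 0).trans (by rw [vec_zero_eq hU0])
  have h3 : ∀ k, evalAt 0 (Dx ((curveData P U).u k)) = (Pi.single l 1 : Pt) k := hU1
  have h5 : pderiv l (P.g j i) p = pderiv l (P.g i j) p := pderiv_metric_symm hΩ hP hS hp j i l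
  simp only [firstOrder, adjP, Pi.single_apply, map_add, map_sum, map_mul, Derivation.leibniz,
    smul_eq_mul, h1, h2, h3, map_neg, map_zero, apply_ite Dx,
    apply_ite (evalAt 0), map_one] at h
  simp at h
  fin_cases j <;> simp at h h5 ⊢ <;> linarith

/-- The consequences of compatibility along constant curves: the metric determines the connection,
and its entries satisfy two first-order equations. All connection coefficients are written in the
form `(∂ g + s g / u¹) / 2`, with `s ∈ {-1, 0, 1}`, so that `pderiv_half_add` differentiates them
uniformly. -/
structure FirstOrderRelations (P : HydroOp) (p : Pt) : Prop where
  Γ00 : ∀ k, P.Γ 0 0 k p = 1 / 2 * (pderiv k (P.g 0 0) p + 0 * ((p 0)⁻¹ * P.g 0 0 p))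
  Γ11 : ∀ k, P.Γ 1 1 k p = 1 / 2 * (pderiv k (P.g 1 1) p + 0 * ((p 0)⁻¹ * P.g 0 0 p))
  Γ010 : P.Γ 0 1 0 p = 1 / 2 * (pderiv 0 (P.g 0 1) p + 1 * ((p 0)⁻¹ * P.g 0 1 p))
  Γ100 : P.Γ 1 0 0 p = 1 / 2 * (pderiv 0 (P.g 0 1) p + -1 * ((p 0)⁻¹ * P.g 0 1 p))
  Γ011 : P.Γ 0 1 1 p = 1 / 2 * (pderiv 1 (P.g 0 1) p + -1 * ((p 0)⁻¹ * P.g 0 0 p))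
  Γ101 : P.Γ 1 0 1 p = 1 / 2 * (pderiv 1 (P.g 0 1) p + 1 * ((p 0)⁻¹ * P.g 0 0 p))
  g01 : pderiv 1 (P.g 0 1) p = pderiv 0 (P.g 0 0) p
    + 2 * ((p 0)⁻¹ * (p 1 * pderiv 1 (P.g 0 0) p)) - (p 0)⁻¹ * P.g 0 0 p
  g11 : pderiv 1 (P.g 1 1) p = pderiv 0 (P.g 0 1) p + (p 0)⁻¹ * P.g 0 1 p
    + 2 * ((p 0)⁻¹ * (p 1 * pderiv 1 (P.g 0 1) p))
    - 2 * ((p 0)⁻¹ * ((p 0)⁻¹ * (p 1 * P.g 0 0 p)))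

theorem evalAt_curveData_a (hne : ∀ u ∈ Ω, u 0 ≠ 0) (hU : ∀ x, vec U x ∈ Ω) {p : Pt}
    (hp : ∀ k, evalAt 0 (U k) = p k) : evalAt 0 (curveData P U).a = (p 0)⁻¹ :=
  ((exists_inv fun x => hne _ (hU x)).2 0).trans (by rw [vec_zero_eq hp])

/-- The bracket along the constant curve at `p`, on the pairs of covectors `((x², 0), (0, x²))`,
`((1, 0), (0, x⁴))` and `((0, 1), (0, x⁴))`. -/
theorem firstOrderRelations (hΩ : IsOpen Ω) (hne : ∀ u ∈ Ω, u 0 ≠ 0)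
    (hP : CompatibleWithR3 Ω P) {p : Pt} (hp : p ∈ Ω) : FirstOrderRelations P p := by
  obtain ⟨hs, hS, hC⟩ := hP
  have hU : ∀ x, vec (constCurve p) x ∈ Ω := fun _ => hp
  have hB := (schoutenCommute_iff hΩ hne hs).mp hC (constCurve p) hU
  set J := curveData P (constCurve p) with hJ
  have hg : ∀ i j, Dx (J.g i j) = 0 := fun i j => Dx_ofFun_constCurve hΩ hp (hs.1 i j)
  have hG : ∀ i j k, Dx (J.G i j k) = 0 := fun i j k => Dx_ofFun_constCurve hΩ hp (hs.2 i j k)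
  have hdg : ∀ i j k, Dx (J.dg i j k) = 0 := fun i j k =>
    Dx_ofFun_constCurve hΩ hp (contDiffOn_pderiv hΩ (hs.1 i j) k)
  have hu : ∀ i, Dx (J.u i) = 0 := Dx_constCurve p
  have ha : Dx J.a = 0 := by
    rw [Dx_inv (curveData_a_mul (fun x => hne _ (hU x)) P), hu]; simp
  have ea : evalAt 0 J.a = (p 0)⁻¹ := evalAt_curveData_a hne hU fun _ => rfl
  have eu : ∀ i, evalAt 0 (J.u i) = p i := fun _ => rfl
  have eg : ∀ i j, evalAt 0 (J.g i j) = P.g i j p := fun i j => evalAt_ofFun_comp hU (hs.1 i j) 0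
  have eG : ∀ i j k, evalAt 0 (J.G i j k) = P.Γ i j k p :=
    fun i j k => evalAt_ofFun_comp hU (hs.2 i j k) 0
  have edg : ∀ i j k, evalAt 0 (J.dg i j k) = pderiv k (P.g i j) p :=
    fun i j k => evalAt_ofFun_comp hU (contDiffOn_pderiv hΩ (hs.1 i j) k) 0
  obtain ⟨h1, h2, h3, h4⟩ := evalAt_bracketForm_of_Dx_eq_zero J hg hG hdg hu ha
  rw [hB, map_zero] at h1 h2 h3 h4
  simp only [ea, eu, eg, eG, edg, metric_symm hΩ hs hS hp 1 0] at h1 h2 h3 h4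
  have hsk := connection_add_connection hΩ hs hS hp
  have a0 : (p 0)⁻¹ ≠ 0 := inv_ne_zero (hne p hp)
  have Γ00 : ∀ k, P.Γ 0 0 k p = 1 / 2 * pderiv k (P.g 0 0) p := fun k => by linarith [hsk 0 0 k]
  have Γ11 : ∀ k, P.Γ 1 1 k p = 1 / 2 * pderiv k (P.g 1 1) p := fun k => by linarith [hsk 1 1 k]
  have Γ011 : P.Γ 0 1 1 p = 1 / 2 * (pderiv 1 (P.g 0 1) p - (p 0)⁻¹ * P.g 0 0 p) :=
    mul_left_cancel₀ a0 (by linear_combination (-1 / 24) * h1)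
  have Γ010 : P.Γ 0 1 0 p = 1 / 2 * (pderiv 0 (P.g 0 1) p + (p 0)⁻¹ * P.g 0 1 p) :=
    mul_left_cancel₀ a0 (by rw [Γ011] at h2; linear_combination (-1 / 24) * h2)
  rw [Γ00, Γ00, Γ011] at h3
  rw [Γ010, Γ11, Γ011] at h4
  refine ⟨fun k => by rw [Γ00]; ring, fun k => by rw [Γ11]; ring, by rw [Γ010]; ring, ?_,
    by rw [Γ011]; ring, ?_, ?_, ?_⟩
  · linarith [hsk 0 1 0]
  · linarith [hsk 0 1 1]
  · exact mul_left_cancel₀ a0 (by linear_combination (1 / 12) * h3)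
  · exact mul_left_cancel₀ a0 (by linear_combination (1 / 12) * h4)

end

end CompatibleTrio

namespace CompatibleTrio

/-! ### Second-order equations on the metric -/

section

variable {Ω : Set Pt} {P : HydroOp}

theorem hasPartials_inv {p : Pt} (h : p 0 ≠ 0) :
    HasPartials (fun q => (q 0)⁻¹) (fun k => -((p 0)⁻¹ ^ 2 * (Pi.single 0 1 : Fin 2 → ℝ) k)) p :=
  (HasPartials.coord 0 p).inv h

theorem pderiv_half_add (hΩ : IsOpen Ω) (hne : ∀ u ∈ Ω, u 0 ≠ 0) {E f g : Pt → ℝ}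
    (hf : ContDiffOn ℝ ∞ f Ω) (hg : ContDiffOn ℝ ∞ g Ω) {s : ℝ} {l : Fin 2}
    (h : ∀ q ∈ Ω, E q = 1 / 2 * (pderiv l f q + s * ((q 0)⁻¹ * g q))) {p : Pt} (hp : p ∈ Ω)
    (k : Fin 2) : pderiv k E p = 1 / 2 * (pderiv k (pderiv l f) p + s * ((p 0)⁻¹ * pderiv k g p
      - (p 0)⁻¹ ^ 2 * (Pi.single 0 1 : Fin 2 → ℝ) k * g p)) := by
  have H := (((hasPartials_of_contDiffOn hΩ (contDiffOn_pderiv hΩ hf l) hp).add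
    (((hasPartials_inv (hne p hp)).mul
      (hasPartials_of_contDiffOn hΩ hg hp)).const_mul s)).const_mul (1 / 2)).congr hΩ hp h
  rw [H.pderiv_eq]
  ring

/-- The consequences of compatibility along curves with non-zero velocity: second-order equations on
the metric. The suffixes `u` and `v` in the names stand for `∂₀` and `∂₁`. -/
structure SecondOrderRelations (P : HydroOp) (p : Pt) : Prop where
  g00_vv : pderiv 1 (pderiv 1 (P.g 0 0)) p = 0
  g00_uv : pderiv 1 (pderiv 0 (P.g 0 0)) p
    = 3 * (pderiv 1 (pderiv 1 (P.g 0 1)) p - (p 0)⁻¹ * pderiv 1 (P.g 0 0) p)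
  g01_uv : pderiv 1 (pderiv 0 (P.g 0 1)) p = -((p 0)⁻¹ ^ 2 * P.g 0 0 p)
    + (p 0)⁻¹ * pderiv 0 (P.g 0 0) p + 2 * ((p 0)⁻¹ * pderiv 1 (P.g 0 1) p)
    - 2 * ((p 0)⁻¹ * p 1 * pderiv 1 (pderiv 1 (P.g 0 1)) p)
  g11_uv : pderiv 1 (pderiv 0 (P.g 1 1)) p
    = -(2 * ((p 0)⁻¹ * (p 1 * pderiv 1 (pderiv 1 (P.g 1 1)) p)))
    + 2 * ((p 0)⁻¹ * ((p 0)⁻¹ * (p 1 * (pderiv 1 (P.g 0 1) p - (p 0)⁻¹ * P.g 0 0 p))))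
  g11_uu : pderiv 0 (pderiv 0 (P.g 1 1)) p
    = -(2 * ((p 0)⁻¹ * p 1 * pderiv 1 (pderiv 0 (P.g 1 1)) p))
    - 2 * ((p 0)⁻¹ * pderiv 0 (P.g 1 1) p) - 2 * ((p 0)⁻¹ ^ 2 * p 1 * pderiv 1 (P.g 1 1) p)
    + 2 * ((p 0)⁻¹ ^ 2 * p 1 * (pderiv 0 (P.g 0 1) p + (p 0)⁻¹ * P.g 0 1 p))

/-- The restrictions of the coefficients to a curve through `p` with velocity `w`. -/
theorem evalAt_curveData (hΩ : IsOpen Ω) (hne : ∀ u ∈ Ω, u 0 ≠ 0) (hs : P.SmoothOn Ω)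
    {U : Fin 2 → Smooth} (hU : ∀ x, vec U x ∈ Ω) {p w : Pt} (hU0 : ∀ k, evalAt 0 (U k) = p k)
    (hU1 : ∀ k, evalAt 0 (Dx (U k)) = w k) :
    (∀ i, evalAt 0 ((curveData P U).u i) = p i) ∧
    (∀ i, evalAt 0 (Dx ((curveData P U).u i)) = w i) ∧
    evalAt 0 (curveData P U).a = (p 0)⁻¹ ∧
    evalAt 0 (Dx (curveData P U).a) = -((p 0)⁻¹ * (p 0)⁻¹ * w 0) ∧
    (∀ i j, evalAt 0 ((curveData P U).g i j) = P.g i j p) ∧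
    (∀ i j k, evalAt 0 ((curveData P U).G i j k) = P.Γ i j k p) ∧
    (∀ i j k, evalAt 0 ((curveData P U).dg i j k) = pderiv k (P.g i j) p) ∧
    (∀ i j k l, evalAt 0 ((curveData P U).dG i j k l) = pderiv l (P.Γ i j k) p) ∧
    (∀ i j k, evalAt 0 (Dx ((curveData P U).G i j k))
      = pderiv 0 (P.Γ i j k) p * w 0 + pderiv 1 (P.Γ i j k) p * w 1) ∧
    (∀ i j k, evalAt 0 (Dx ((curveData P U).dg i j k))
      = pderiv 0 (pderiv k (P.g i j)) p * w 0 + pderiv 1 (pderiv k (P.g i j)) p * w 1) := by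
  have hc : ∀ {f : Pt → ℝ}, ContDiffOn ℝ ∞ f Ω → evalAt 0 (ofFun fun x => f (vec U x)) = f p :=
    fun hf => (evalAt_ofFun_comp hU hf 0).trans (by rw [vec_zero_eq hU0])
  have hd : ∀ {f : Pt → ℝ}, ContDiffOn ℝ ∞ f Ω → evalAt 0 (Dx (ofFun fun x => f (vec U x)))
      = pderiv 0 f p * w 0 + pderiv 1 f p * w 1 :=
    fun hf => evalAt_Dx_ofFun_comp hΩ hU hf hU0 hU1
  have ea := evalAt_curveData_a (P := P) hne hU hU0
  refine ⟨hU0, hU1, ea, ?_, fun i j => hc (hs.1 i j), fun i j k => hc (hs.2 i j k),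
    fun i j k => hc (contDiffOn_pderiv hΩ (hs.1 i j) k),
    fun i j k l => hc (contDiffOn_pderiv hΩ (hs.2 i j k) l), fun i j k => hd (hs.2 i j k),
    fun i j k => hd (contDiffOn_pderiv hΩ (hs.1 i j) k)⟩
  rw [Dx_inv (curveData_a_mul (fun x => hne _ (hU x)) P), map_neg, map_mul, map_mul, ea]
  exact congrArg (fun y => -((p 0)⁻¹ * (p 0)⁻¹ * y)) (hU1 0)

/-- The bracket at `p` along a curve with velocity `(0, 1)`, on covectors with the entries `1` and
`x³`, and, for the last equation, along a curve with velocity `(1, 0)`. The connection is eliminated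
by means of `firstOrderRelations`. -/
theorem secondOrderRelations (hΩ : IsOpen Ω) (hne : ∀ u ∈ Ω, u 0 ≠ 0)
    (hP : CompatibleWithR3 Ω P) {p : Pt} (hp : p ∈ Ω) : SecondOrderRelations P p := by
  have hR := fun {q : Pt} (hq : q ∈ Ω) => firstOrderRelations hΩ hne hP hq
  obtain ⟨hs, hS, hC⟩ := hP
  have a0 : (p 0)⁻¹ ≠ 0 := inv_ne_zero (hne p hp)
  have dΓ00 : ∀ l k, _ := fun l k => pderiv_half_add hΩ hne (hs.1 0 0) (hs.1 0 0) (l := l)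
    (fun q hq => (hR hq).Γ00 l) hp k
  have dΓ11 : ∀ l k, _ := fun l k => pderiv_half_add hΩ hne (hs.1 1 1) (hs.1 0 0) (l := l)
    (fun q hq => (hR hq).Γ11 l) hp k
  have dΓ010 := pderiv_half_add hΩ hne (hs.1 0 1) (hs.1 0 1) (fun q hq => (hR hq).Γ010) hp
  have dΓ011 := pderiv_half_add hΩ hne (hs.1 0 1) (hs.1 0 0) (fun q hq => (hR hq).Γ011) hp
  have dΓ101 := pderiv_half_add hΩ hne (hs.1 0 1) (hs.1 0 0) (fun q hq => (hR hq).Γ101) hp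
  have hB := (schoutenCommute_iff hΩ hne hs).mp hC
  have c00 := pderiv_comm hΩ (hs.1 0 0) hp
  have c01 := pderiv_comm hΩ (hs.1 0 1) hp
  have c11 := pderiv_comm hΩ (hs.1 1 1) hp
  have r := hR hp
  obtain ⟨h1, h2, h3, h4⟩ : _ ∧ _ ∧ _ ∧ _ := by
    obtain ⟨U, hU, hU0, hU1⟩ := exists_curve hΩ hp (Pi.single 1 1)
    obtain ⟨eu, edu, ea, eda, eg, eG, edg, edG, eDG, eDdg⟩ :=
      evalAt_curveData (P := P) hΩ hne hs hU hU0 hU1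
    have v0 : (Pi.single 1 1 : Pt) 0 = 0 := rfl
    have v1 : (Pi.single 1 1 : Pt) 1 = 1 := rfl
    rw [v0, mul_zero, neg_zero] at eda
    obtain ⟨h1, h2, h3, h4⟩ := evalAt_bracketForm_of_velocity_one _ ((edu 1).trans v1)
      ((edu 0).trans v0) eda
    simp only [hB U hU, map_zero, ea, eu, eG, edg, edG, eDG, eDdg, v0, v1, mul_zero, mul_one,
      zero_add] at h1 h2 h3 h4
    exact ⟨h1, h2, h3, h4⟩
  obtain ⟨U, hU, hU0, hU1⟩ := exists_curve hΩ hp (Pi.single 0 1)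
  obtain ⟨eu, edu, ea, eda, eg, eG, edg, edG, eDG, eDdg⟩ :=
    evalAt_curveData (P := P) hΩ hne hs hU hU0 hU1
  have s0 : (Pi.single 0 1 : Fin 2 → ℝ) 0 = 1 := rfl
  have s1 : (Pi.single 0 1 : Fin 2 → ℝ) 1 = 0 := rfl
  rw [s0, mul_one, ← sq, ← ea] at eda
  have h5 := evalAt_bracketForm_of_velocity_zero _ ((edu 0).trans s0) ((edu 1).trans s1) eda
  simp only [hB U hU, map_zero, ea, eu, eG, edg, eDG, eDdg, s0, s1, mul_zero, mul_one,
    add_zero] at h5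
  simp only [dΓ00, dΓ11, dΓ010, dΓ011, dΓ101, r.Γ00, r.Γ11, r.Γ010, r.Γ011, r.Γ101, s0, s1,
    c00, c01, c11] at h1 h2 h3 h4 h5
  have g00_vv : pderiv 1 (pderiv 1 (P.g 0 0)) p = 0 :=
    mul_left_cancel₀ a0 (by linear_combination (1 / 6) * h1)
  rw [g00_vv] at h2
  refine ⟨g00_vv, ?_, ?_, ?_, ?_⟩
  · exact mul_left_cancel₀ a0 (by linear_combination (-1 / 3) * h2)
  · exact mul_left_cancel₀ a0 (by linear_combination (1 / 6) * h3)
  · exact mul_left_cancel₀ a0 (by linear_combination (1 / 6) * h4)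
  · exact mul_left_cancel₀ a0 (by linear_combination (1 / 6) * h5)

end

end CompatibleTrio

namespace CompatibleTrio

/-! ### Solving the equations on the metric -/

section

variable {Ω : Set Pt} {P : HydroOp}

/-- The full set of equations on the metric of a compatible operator, solved for the highest
derivatives. As indices of `P.g` start at `0`, the fields `g00`, `g01` and `g11` concern `g¹¹`,
`g¹²` and `g²²`. -/
structure MetricEquations (P : HydroOp) (p : Pt) : Prop where
  g00 : P.g 0 0 p = p 0 * pderiv 0 (P.g 0 0) p + p 1 * pderiv 1 (P.g 0 0) p
  g00_uu : pderiv 0 (pderiv 0 (P.g 0 0)) p = 0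
  g00_uv : pderiv 1 (pderiv 0 (P.g 0 0)) p = 0
  g00_vv : pderiv 1 (pderiv 1 (P.g 0 0)) p = 0
  g01_v : pderiv 1 (P.g 0 1) p = (p 0)⁻¹ * p 1 * pderiv 1 (P.g 0 0) p
  g01_uu : pderiv 0 (pderiv 0 (P.g 0 1)) p
    = (p 0)⁻¹ ^ 2 * P.g 0 1 p - (p 0)⁻¹ * pderiv 0 (P.g 0 1) p
  g01_uv : pderiv 1 (pderiv 0 (P.g 0 1)) p = -((p 0)⁻¹ ^ 2 * p 1 * pderiv 1 (P.g 0 0) p)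
  g11_v : pderiv 1 (P.g 1 1) p = pderiv 0 (P.g 0 1) p + (p 0)⁻¹ * P.g 0 1 p
    - 2 * ((p 0)⁻¹ * p 1 * pderiv 0 (P.g 0 0) p)
  g11_uu : pderiv 0 (pderiv 0 (P.g 1 1)) p = -(2 * ((p 0)⁻¹ * pderiv 0 (P.g 1 1) p))
  g11_uv : pderiv 1 (pderiv 0 (P.g 1 1)) p = 2 * ((p 0)⁻¹ ^ 2 * p 1 * pderiv 0 (P.g 0 0) p)

/-- Second derivatives of `g¹¹` and `g²²`, from `secondOrderRelations` and the derivatives of the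
equations of `firstOrderRelations`. Two of them involve the Euler defect of `g¹¹`, that is, the
factor `u¹ ∂₀ g¹¹ + u² ∂₁ g¹¹ - g¹¹`, which vanishes only by a condition of third order. -/
theorem second_derivatives (hΩ : IsOpen Ω) (hne : ∀ u ∈ Ω, u 0 ≠ 0)
    (hP : CompatibleWithR3 Ω P) {p : Pt} (hp : p ∈ Ω) :
    pderiv 1 (pderiv 0 (P.g 0 0)) p = 0 ∧
    pderiv 0 (pderiv 0 (P.g 0 0)) p = 4 * ((p 0)⁻¹ * ((p 0)⁻¹ *
      (p 0 * pderiv 0 (P.g 0 0) p + p 1 * pderiv 1 (P.g 0 0) p - P.g 0 0 p))) ∧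
    pderiv 1 (pderiv 1 (P.g 1 1)) p = 8 * ((p 0)⁻¹ * ((p 0)⁻¹ *
      (p 0 * pderiv 0 (P.g 0 0) p + p 1 * pderiv 1 (P.g 0 0) p - P.g 0 0 p)))
      - 2 * ((p 0)⁻¹ * pderiv 0 (P.g 0 0) p) ∧
    pderiv 0 (pderiv 1 (P.g 1 1)) p = pderiv 0 (pderiv 0 (P.g 0 1)) p
      - (p 0)⁻¹ ^ 2 * P.g 0 1 p + (p 0)⁻¹ * pderiv 0 (P.g 0 1) p
      - 2 * ((p 0)⁻¹ ^ 2 * p 1 * pderiv 1 (P.g 0 1) p)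
      + 2 * ((p 0)⁻¹ * p 1 * pderiv 1 (pderiv 0 (P.g 0 1)) p)
      + 4 * ((p 0)⁻¹ ^ 3 * p 1 * P.g 0 0 p)
      - 2 * ((p 0)⁻¹ ^ 2 * p 1 * pderiv 0 (P.g 0 0) p) := by
  have hs := hP.1
  have r := firstOrderRelations hΩ hne hP hp
  have r2 := secondOrderRelations hΩ hne hP hp
  have D := fun {f : Pt → ℝ} (hf : ContDiffOn ℝ ∞ f Ω) => hasPartials_of_contDiffOn hΩ hf hp
  have Dp := fun (k : Fin 2) {f : Pt → ℝ} (hf : ContDiffOn ℝ ∞ f Ω) =>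
    hasPartials_of_contDiffOn hΩ (contDiffOn_pderiv hΩ hf k) hp
  have Di := hasPartials_inv (hne p hp)
  have Dv := HasPartials.coord 1 p
  have A := ((((Dp 0 (hs.1 0 0)).add ((Di.mul (Dv.mul (Dp 1 (hs.1 0 0)))).const_mul 2)).sub
    (Di.mul (D (hs.1 0 0)))).congr hΩ hp
      fun q hq => (firstOrderRelations hΩ hne hP hq).g01).pderiv_eq
  have B := (((((Dp 0 (hs.1 0 1)).add (Di.mul (D (hs.1 0 1)))).add
    ((Di.mul (Dv.mul (Dp 1 (hs.1 0 1)))).const_mul 2)).sub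
    ((Di.mul (Di.mul (Dv.mul (D (hs.1 0 0))))).const_mul 2)).congr hΩ hp
      fun q hq => (firstOrderRelations hΩ hne hP hq).g11).pderiv_eq
  have A0 := A 0
  have A1 := A 1
  have B0 := B 0
  have B1 := B 1
  have s0 : (Pi.single 0 1 : Fin 2 → ℝ) 0 = 1 := rfl
  have s1 : (Pi.single 0 1 : Fin 2 → ℝ) 1 = 0 := rfl
  have t0 : (Pi.single 1 1 : Fin 2 → ℝ) 0 = 0 := rfl
  have t1 : (Pi.single 1 1 : Fin 2 → ℝ) 1 = 1 := rfl
  have hu : (p 0)⁻¹ * p 0 = 1 := inv_mul_cancel₀ (hne p hp)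
  simp only [s0, s1, t0, t1, pderiv_comm hΩ (hs.1 0 0) hp, pderiv_comm hΩ (hs.1 0 1) hp,
    r2.g00_vv] at A0 A1 B0 B1
  have f_uv : pderiv 1 (pderiv 0 (P.g 0 0)) p = 0 := by
    linear_combination (-1 / 2) * r2.g00_uv - (3 / 2) * A1
  rw [f_uv] at A0 A1
  have f_uu : pderiv 0 (pderiv 0 (P.g 0 0)) p = 4 * ((p 0)⁻¹ * ((p 0)⁻¹ *
      (p 0 * pderiv 0 (P.g 0 0) p + p 1 * pderiv 1 (P.g 0 0) p - P.g 0 0 p))) := by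
    linear_combination r2.g01_uv - A0 + 2 * (p 0)⁻¹ * r.g01 - 2 * (p 0)⁻¹ * p 1 * A1
      - 4 * (p 0)⁻¹ * pderiv 0 (P.g 0 0) p * hu
  refine ⟨f_uv, f_uu, ?_, ?_⟩
  · linear_combination B1 + A0 + 3 * (p 0)⁻¹ * r.g01 + 2 * (p 0)⁻¹ * p 1 * A1 + f_uu
      - 4 * (p 0)⁻¹ * pderiv 0 (P.g 0 0) p * hu
  · linear_combination B0

/-- All equations on the metric. The new ingredient is that the Euler defect of `g¹¹` vanishes, that
is, `g¹¹` is homogeneous of degree one. -/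
theorem metricEquations (hΩ : IsOpen Ω) (hne : ∀ u ∈ Ω, u 0 ≠ 0)
    (hP : CompatibleWithR3 Ω P) {p : Pt} (hp : p ∈ Ω) : MetricEquations P p := by
  have hs := hP.1
  have hC := fun {f : Pt → ℝ} (hf : ContDiffOn ℝ ∞ f Ω) (k : Fin 2) => contDiffOn_pderiv hΩ hf k
  have r := firstOrderRelations hΩ hne hP hp
  have r2 := secondOrderRelations hΩ hne hP hp
  obtain ⟨f_uv, f_uu, m_vv, m_uv⟩ := second_derivatives hΩ hne hP hp
  have D := fun {f : Pt → ℝ} (hf : ContDiffOn ℝ ∞ f Ω) => hasPartials_of_contDiffOn hΩ hf hp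
  have Di := hasPartials_inv (hne p hp)
  have Du := HasPartials.coord 0 p
  have Dv := HasPartials.coord 1 p
  have f := hs.1 0 0
  have m := hs.1 1 1
  have defect := ((Du.mul (D (hC f 0))).add (Dv.mul (D (hC f 1)))).sub (D f)
  have M := (((Di.mul (Di.mul defect)).const_mul 8).sub
    ((Di.mul (D (hC f 0))).const_mul 2)).congr hΩ hp fun q hq =>
      (second_derivatives hΩ hne hP hq).2.2.1
  have N := ((((Di.mul (Dv.mul (D (hC (hC m 1) 1)))).const_mul 2).neg).add
    ((Di.mul (Di.mul (Dv.mul ((D (hC (hs.1 0 1) 1)).sub (Di.mul (D f)))))).const_mul 2)).congr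
      hΩ hp (fun q hq => (secondOrderRelations hΩ hne hP hq).g11_uv)
  have h1 := M.pderiv_eq 0
  have h2 := M.pderiv_eq 1
  have h3 := N.pderiv_eq 1
  -- equality of these mixed third derivatives of `P.g 1 1`, which are known from `M` and `N`, is
  -- the additional condition that makes the Euler defect of `P.g 0 0` vanish
  have h4 : pderiv 0 (pderiv 1 (pderiv 1 (P.g 1 1))) p
      = pderiv 1 (pderiv 1 (pderiv 0 (P.g 1 1))) p :=
    (pderiv_comm hΩ (hC m 1) hp).trans (((D (hC (hC m 0) 1)).congr hΩ hp
      fun q hq => pderiv_comm hΩ m hq).pderiv_eq 1)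
  have s0 : (Pi.single 0 1 : Fin 2 → ℝ) 0 = 1 := rfl
  have s1 : (Pi.single 0 1 : Fin 2 → ℝ) 1 = 0 := rfl
  have t0 : (Pi.single 1 1 : Fin 2 → ℝ) 0 = 0 := rfl
  have t1 : (Pi.single 1 1 : Fin 2 → ℝ) 1 = 1 := rfl
  simp only [s0, s1, t0, t1, pderiv_comm hΩ f hp, f_uv, r2.g00_vv] at h1 h2 h3
  have hu : (p 0)⁻¹ * p 0 = 1 := inv_mul_cancel₀ (hne p hp)
  have a0 : (p 0)⁻¹ ≠ 0 := inv_ne_zero (hne p hp)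
  have h_vv : pderiv 1 (pderiv 1 (P.g 0 1)) p = (p 0)⁻¹ * pderiv 1 (P.g 0 0) p := by
    linear_combination (1 / 3) * f_uv - (1 / 3) * r2.g00_uv
  -- in lower-order terms `h4` says that `20 / (u¹)³` times the Euler defect is zero
  have g00 : P.g 0 0 p = p 0 * pderiv 0 (P.g 0 0) p + p 1 * pderiv 1 (P.g 0 0) p := by
    refine (sub_eq_zero.mp (mul_left_cancel₀ (pow_ne_zero 3 a0) ?_)).symm
    linear_combination (1 / 20) * (-h1 + h4 + h3 - (8 * (p 0)⁻¹ ^ 2 * p 0 - 2 * (p 0)⁻¹) * f_uu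
      - 2 * (p 0)⁻¹ * m_vv - 2 * (p 0)⁻¹ * p 1 * h2 + 2 * (p 0)⁻¹ ^ 2 * r.g01
      + 2 * (p 0)⁻¹ ^ 2 * p 1 * h_vv
      - (32 * (p 0)⁻¹ ^ 3 * (p 0 * pderiv 0 (P.g 0 0) p + p 1 * pderiv 1 (P.g 0 0) p - P.g 0 0 p)
        + 4 * (p 0)⁻¹ ^ 2 * pderiv 0 (P.g 0 0) p) * hu)
  have g01_v : pderiv 1 (P.g 0 1) p = (p 0)⁻¹ * p 1 * pderiv 1 (P.g 0 0) p := by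
    linear_combination r.g01 - (p 0)⁻¹ * g00 - pderiv 0 (P.g 0 0) p * hu
  have g01_uv : pderiv 1 (pderiv 0 (P.g 0 1)) p
      = -((p 0)⁻¹ ^ 2 * p 1 * pderiv 1 (P.g 0 0) p) := by
    linear_combination r2.g01_uv + 2 * (p 0)⁻¹ * g01_v - 2 * (p 0)⁻¹ * p 1 * h_vv
      - (p 0)⁻¹ ^ 2 * g00 - (p 0)⁻¹ * pderiv 0 (P.g 0 0) p * hu
  have g11_v : pderiv 1 (P.g 1 1) p = pderiv 0 (P.g 0 1) p + (p 0)⁻¹ * P.g 0 1 p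
      - 2 * ((p 0)⁻¹ * p 1 * pderiv 0 (P.g 0 0) p) := by
    linear_combination r.g11 + 2 * (p 0)⁻¹ * p 1 * g01_v - 2 * (p 0)⁻¹ ^ 2 * p 1 * g00
      - 2 * (p 0)⁻¹ * p 1 * pderiv 0 (P.g 0 0) p * hu
  have g11_uv : pderiv 1 (pderiv 0 (P.g 1 1)) p
      = 2 * ((p 0)⁻¹ ^ 2 * p 1 * pderiv 0 (P.g 0 0) p) := by
    linear_combination r2.g11_uv - 2 * (p 0)⁻¹ * p 1 * m_vv + 2 * (p 0)⁻¹ ^ 2 * p 1 * g01_v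
      + 14 * (p 0)⁻¹ ^ 3 * p 1 * g00 - 2 * (p 0)⁻¹ ^ 2 * p 1 * pderiv 0 (P.g 0 0) p * hu
  refine ⟨g00, ?_, f_uv, r2.g00_vv, g01_v, ?_, g01_uv, g11_v, ?_, g11_uv⟩
  · linear_combination f_uu - 4 * (p 0)⁻¹ ^ 2 * g00
  · linear_combination -m_uv + pderiv_comm hΩ m hp + g11_uv + 2 * (p 0)⁻¹ ^ 2 * p 1 * g01_v
      - 2 * (p 0)⁻¹ * p 1 * g01_uv - 4 * (p 0)⁻¹ ^ 3 * p 1 * g00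
      - 4 * (p 0)⁻¹ ^ 2 * p 1 * pderiv 0 (P.g 0 0) p * hu
  · linear_combination r2.g11_uu - 2 * (p 0)⁻¹ * p 1 * g11_uv - 2 * (p 0)⁻¹ ^ 2 * p 1 * g11_v

/-- The metric of a compatible operator belongs to the family: the six parameters are
combinations of the entries of the metric and their derivatives with vanishing gradient. -/
theorem exists_hasMetric (hΩ : IsOpen Ω) (hconn : IsConnected Ω) (hne : ∀ u ∈ Ω, u 0 ≠ 0)
    (hP : CompatibleWithR3 Ω P) : ∃ c : Params, HasMetric Ω P c := by
  have hs := hP.1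
  have E := fun {p : Pt} (hp : p ∈ Ω) => metricEquations hΩ hne hP hp
  have D := fun {f : Pt → ℝ} (hf : ContDiffOn ℝ ∞ f Ω) {p : Pt} (hp : p ∈ Ω) =>
    hasPartials_of_contDiffOn hΩ hf hp
  have hC := fun {f : Pt → ℝ} (hf : ContDiffOn ℝ ∞ f Ω) (k : Fin 2) => contDiffOn_pderiv hΩ hf k
  have Di := fun {p : Pt} (hp : p ∈ Ω) => hasPartials_inv (hne p hp)
  have Du := HasPartials.coord 0
  have Dv := HasPartials.coord 1
  have hu := fun {p : Pt} (hp : p ∈ Ω) => inv_mul_cancel₀ (hne p hp)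
  have s0 : (Pi.single 0 1 : Fin 2 → ℝ) 0 = 1 := rfl
  have s1 : (Pi.single 0 1 : Fin 2 → ℝ) 1 = 0 := rfl
  have t0 : (Pi.single 1 1 : Fin 2 → ℝ) 0 = 0 := rfl
  have t1 : (Pi.single 1 1 : Fin 2 → ℝ) 1 = 1 := rfl
  obtain ⟨c1, h1⟩ := exists_eq_const (f := pderiv 0 (P.g 0 0)) hΩ hconn fun p hp =>
    (D (hC (hs.1 0 0) 0) hp).congr_partials (E hp).g00_uu (E hp).g00_uv
  obtain ⟨c2, h2⟩ := exists_eq_const (f := pderiv 1 (P.g 0 0)) hΩ hconn fun p hp =>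
    (D (hC (hs.1 0 0) 1) hp).congr_partials
      ((pderiv_comm hΩ (hs.1 0 0) hp).trans (E hp).g00_uv) (E hp).g00_vv
  obtain ⟨c4, h4⟩ := exists_eq_const
    (f := fun p => 1 / 2 * (pderiv 0 (P.g 0 1) p + (p 0)⁻¹ * P.g 0 1 p)) hΩ hconn fun p hp =>
    (((D (hC (hs.1 0 1) 0) hp).add ((Di hp).mul (D (hs.1 0 1) hp))).const_mul _).congr_partials
      (by simp only [s0]; linear_combination (1 / 2) * (E hp).g01_uu)
      (by simp only [s1]; linear_combination (1 / 2) * (E hp).g01_uv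
            + (1 / 2) * (p 0)⁻¹ * (E hp).g01_v)
  obtain ⟨c3, h3⟩ := exists_eq_const
    (f := fun p => p 0 * P.g 0 1 p - c4 * (p 0 * p 0) - c2 / 2 * (p 1 * p 1)) hΩ hconn fun p hp =>
    ((((Du p).mul (D (hs.1 0 1) hp)).sub (((Du p).mul (Du p)).const_mul _)).sub
      (((Dv p).mul (Dv p)).const_mul _)).congr_partials
      (by simp only [s0, t0]; linear_combination 2 * p 0 * h4 p hp - P.g 0 1 p * hu hp)
      (by simp only [s1, t1]; linear_combination p 0 * (E hp).g01_v + p 1 * h2 p hp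
            + p 1 * pderiv 1 (P.g 0 0) p * hu hp)
  obtain ⟨c6, h6⟩ := exists_eq_const
    (f := fun p => c1 * (p 1 * p 1) - p 0 * p 0 * pderiv 0 (P.g 1 1) p) hΩ hconn fun p hp =>
    ((((Dv p).mul (Dv p)).const_mul _).sub
      (((Du p).mul (Du p)).mul (D (hC (hs.1 1 1) 0) hp))).congr_partials
      (by simp only [s0, t0]; linear_combination -(p 0 ^ 2) * (E hp).g11_uu
            + 2 * p 0 * pderiv 0 (P.g 1 1) p * hu hp)
      (by simp only [s1, t1]; linear_combination -(p 0 ^ 2) * (E hp).g11_uv - 2 * p 1 * h1 p hp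
            - 2 * p 1 * pderiv 0 (P.g 0 0) p * ((p 0)⁻¹ * p 0 + 1) * hu hp)
  obtain ⟨c5, h5⟩ := exists_eq_const
    (f := fun p => P.g 1 1 p - 2 * c4 * p 1 - c6 * (p 0)⁻¹ + c1 * ((p 0)⁻¹ * (p 1 * p 1)))
      hΩ hconn fun p hp =>
    ((((D (hs.1 1 1) hp).sub ((Dv p).const_mul _)).sub ((Di hp).const_mul _)).add
      (((Di hp).mul ((Dv p).mul (Dv p))).const_mul _)).congr_partials
      (by simp only [s0, t0]; linear_combination -((p 0)⁻¹ ^ 2) * h6 p hp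
            - pderiv 0 (P.g 1 1) p * ((p 0)⁻¹ * p 0 + 1) * hu hp)
      (by simp only [s1, t1]; linear_combination (E hp).g11_v + 2 * h4 p hp
            - 2 * (p 0)⁻¹ * p 1 * h1 p hp)
  refine ⟨⟨c1, c2, c3, c4, c5, c6⟩, fun p hp => ?_⟩
  have e00 : P.g 0 0 p = metric ⟨c1, c2, c3, c4, c5, c6⟩ 0 0 p := by
    change _ = c1 * p 0 + c2 * p 1
    linear_combination (E hp).g00 + p 0 * h1 p hp + p 1 * h2 p hp
  have e01 : P.g 0 1 p = metric ⟨c1, c2, c3, c4, c5, c6⟩ 0 1 p := by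
    change _ = c4 * p 0 + c3 / p 0 + c2 * (p 1) ^ 2 / (2 * p 0)
    have := hne p hp
    field_simp
    linear_combination 2 * h3 p hp
  have e11 : P.g 1 1 p = metric ⟨c1, c2, c3, c4, c5, c6⟩ 1 1 p := by
    change _ = 2 * c4 * p 1 + c6 / p 0 - c1 * (p 1) ^ 2 / p 0 + c5
    linear_combination h5 p hp
  intro i j
  fin_cases i <;> fin_cases j
  exacts [e00, e01, (metric_symm hΩ hs hP.2.1 hp 1 0).trans e01, e11]

end

end CompatibleTrio

namespace CompatibleTrio

/-! ### The operators of the family -/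

/-- The member of the family of operators with metric `metric c`; its connection is that of
`familyData`. -/
noncomputable def familyOp (c : Params) : HydroOp where
  g := metric c
  Γ := fun i j k p => (familyData c p (p 0)⁻¹).G i j k

theorem metric_eq_familyData (c : Params) (i j : Fin 2) (p : Pt) :
    metric c i j p = (familyData c p (p 0)⁻¹).g i j := by
  fin_cases i <;> fin_cases j <;> simp [metric, familyData] <;> ring

theorem hasPartials_metric (c : Params) (i j : Fin 2) {p : Pt} (hp : p 0 ≠ 0) :
    HasPartials (metric c i j) (fun k => (familyData c p (p 0)⁻¹).dg i j k) p := by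
  have Di := hasPartials_inv hp
  have Du := HasPartials.coord 0 p
  have Dv := HasPartials.coord 1 p
  rw [show metric c i j = fun q => (familyData c q (q 0)⁻¹).g i j from
    funext (metric_eq_familyData c i j)]
  have h01 : HasPartials
      (fun q => c.p4 * q 0 + c.p3 * (q 0)⁻¹ + c.p2 / 2 * ((q 0)⁻¹ * (q 1 * q 1)))
      (fun k => (familyData c p (p 0)⁻¹).dg 0 1 k) p :=
    (((Du.const_mul _).add (Di.const_mul _)).add
      ((Di.mul (Dv.mul Dv)).const_mul _)).congr_partials
      (by simp [familyData]; ring) (by simp [familyData]; ring)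
  fin_cases i <;> fin_cases j
  · exact ((Du.const_mul _).add (Dv.const_mul _)).congr_partials
      (by simp [familyData]) (by simp [familyData])
  · exact h01
  · exact h01
  · exact ((((Dv.const_mul _).add (Di.const_mul _)).sub
      ((Di.mul (Dv.mul Dv)).const_mul _)).add (HasPartials.const _ _)).congr_partials
      (by simp [familyData]; ring) (by simp [familyData]; ring)

theorem hasPartials_connection (c : Params) (i j k : Fin 2) {p : Pt} (hp : p 0 ≠ 0) :
    HasPartials ((familyOp c).Γ i j k) (fun l => (familyData c p (p 0)⁻¹).dG i j k l) p := by
  have Di := hasPartials_inv hp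
  have Dv := HasPartials.coord 1 p
  fin_cases i
  · have h : ∀ r : ℝ, HasPartials (fun _ => r) (fun l => (familyData c p (p 0)⁻¹).dG 0 j k l) p :=
      fun r => (HasPartials.const r p).congr_partials
        (by fin_cases j <;> fin_cases k <;> simp [familyData])
        (by fin_cases j <;> fin_cases k <;> simp [familyData])
    fin_cases j <;> fin_cases k <;> exact h _
  · fin_cases j <;> fin_cases k
    · exact ((((Di.mul Di).const_mul c.p3).neg).sub
        (((Di.mul Di).mul (Dv.mul Dv)).const_mul (c.p2 / 2))).congr_partials
        (by simp [familyData]; ring) (by simp [familyData]; ring)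
    · exact (((Di.mul Dv).const_mul c.p2).add (HasPartials.const (c.p1 / 2) p)).congr_partials
        (by simp [familyData]; left; ring) (by simp [familyData])
    · exact ((((Di.mul Di).const_mul (c.p6 / 2)).neg).add
        (((Di.mul Di).mul (Dv.mul Dv)).const_mul (c.p1 / 2))).congr_partials
        (by simp [familyData]; ring) (by simp [familyData]; ring)
    · exact ((HasPartials.const c.p4 p).sub ((Di.mul Dv).const_mul c.p1)).congr_partials
        (by simp [familyData]; left; ring) (by simp [familyData])

theorem familyData_metric_symm (c : Params) (u : Fin 2 → ℝ) (a : ℝ) (i j : Fin 2) :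
    (familyData c u a).g i j = (familyData c u a).g j i := by
  fin_cases i <;> fin_cases j <;> rfl

theorem familyData_connection_add (c : Params) (u : Fin 2 → ℝ) (a : ℝ) (i j k : Fin 2) :
    (familyData c u a).G i j k + (familyData c u a).G j i k = (familyData c u a).dg i j k := by
  fin_cases i <;> fin_cases j <;> fin_cases k <;> simp [familyData] <;> ring

section

variable {Ω : Set Pt} {P : HydroOp}

theorem HasMetric.hasPartials {c : Params} (h : HasMetric Ω P c) (hΩ : IsOpen Ω)
    (hne : ∀ u ∈ Ω, u 0 ≠ 0) {p : Pt} (hp : p ∈ Ω) (i j : Fin 2) :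
    HasPartials (P.g i j) (fun k => (familyData c p (p 0)⁻¹).dg i j k) p :=
  (hasPartials_metric c i j (hne p hp)).congr hΩ hp fun q hq => h q hq i j

/-- The six parameters are determined by the metric and its first derivatives at one point. -/
theorem HasMetric.unique (hΩ : IsOpen Ω) (hconn : IsConnected Ω) (hne : ∀ u ∈ Ω, u 0 ≠ 0)
    {c d : Params} (hc : HasMetric Ω P c) (hd : HasMetric Ω P d) : c = d := by
  obtain ⟨p, hp⟩ := hconn.nonempty
  have h0 := hne p hp
  have a0 : (p 0)⁻¹ ≠ 0 := inv_ne_zero h0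
  have h := fun i j k => ((hc.hasPartials hΩ hne hp i j).pderiv_eq k).symm.trans
    ((hd.hasPartials hΩ hne hp i j).pderiv_eq k)
  have e := fun i j => ((hc p hp i j).symm.trans (hd p hp i j))
  simp only [metric_eq_familyData] at e
  have h1 : c.p1 = d.p1 := h 0 0 0
  have h2 : c.p2 = d.p2 := h 0 0 1
  have h4 : 2 * c.p4 - 2 * c.p1 * ((p 0)⁻¹ * p 1)
      = 2 * d.p4 - 2 * d.p1 * ((p 0)⁻¹ * p 1) := h 1 1 1
  have h6 : -(c.p6 * ((p 0)⁻¹ * (p 0)⁻¹)) + c.p1 * ((p 0)⁻¹ * (p 0)⁻¹ * (p 1 * p 1))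
      = -(d.p6 * ((p 0)⁻¹ * (p 0)⁻¹)) + d.p1 * ((p 0)⁻¹ * (p 0)⁻¹ * (p 1 * p 1)) := h 1 1 0
  have h3 : c.p4 * p 0 + c.p3 * (p 0)⁻¹ + c.p2 / 2 * ((p 0)⁻¹ * (p 1 * p 1))
      = d.p4 * p 0 + d.p3 * (p 0)⁻¹ + d.p2 / 2 * ((p 0)⁻¹ * (p 1 * p 1)) := e 0 1
  have h5 : 2 * c.p4 * p 1 + c.p6 * (p 0)⁻¹ - c.p1 * ((p 0)⁻¹ * (p 1 * p 1)) + c.p5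
      = 2 * d.p4 * p 1 + d.p6 * (p 0)⁻¹ - d.p1 * ((p 0)⁻¹ * (p 1 * p 1)) + d.p5 := e 1 1
  rw [h1] at h4 h5 h6
  rw [h2] at h3
  have k4 : c.p4 = d.p4 := by linarith
  have k6 : c.p6 = d.p6 := mul_right_cancel₀ (mul_ne_zero a0 a0) (by linarith)
  rw [k4] at h3 h5
  rw [k6] at h5
  have k3 : c.p3 = d.p3 := mul_right_cancel₀ a0 (by linarith)
  have k5 : c.p5 = d.p5 := by linarith
  cases c
  cases d
  simp_all

/-- A compatible operator with metric in the family has the connection of that member of the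
family. -/
theorem HasMetric.connection_eq (hΩ : IsOpen Ω) (hne : ∀ u ∈ Ω, u 0 ≠ 0)
    (hP : CompatibleWithR3 Ω P) {c : Params} (hc : HasMetric Ω P c) {p : Pt} (hp : p ∈ Ω)
    (i j k : Fin 2) : P.Γ i j k p = (familyData c p (p 0)⁻¹).G i j k := by
  have r := firstOrderRelations hΩ hne hP hp
  have hd := fun i j k => (hc.hasPartials hΩ hne hp i j).pderiv_eq k
  have hu : (p 0)⁻¹ * p 0 = 1 := inv_mul_cancel₀ (hne p hp)
  have e00 : P.g 0 0 p = c.p1 * p 0 + c.p2 * p 1 := hc p hp 0 0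
  have e01 : P.g 0 1 p = c.p4 * p 0 + c.p3 * (p 0)⁻¹ + c.p2 / 2 * ((p 0)⁻¹ * (p 1 * p 1)) :=
    (hc p hp 0 1).trans (metric_eq_familyData c 0 1 p)
  fin_cases i <;> fin_cases j <;> fin_cases k
  · refine (r.Γ00 0).trans ?_
    rw [hd]; simp [familyData]; ring
  · refine (r.Γ00 1).trans ?_
    rw [hd]; simp [familyData]; ring
  · refine r.Γ010.trans ?_
    rw [hd, e01]; simp [familyData]; linear_combination c.p4 / 2 * hu
  · refine r.Γ011.trans ?_
    rw [hd, e00]; simp [familyData]; linear_combination -(c.p1 / 2) * hu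
  · refine r.Γ100.trans ?_
    rw [hd, e01]; simp [familyData]; linear_combination -(c.p4 / 2) * hu
  · refine r.Γ101.trans ?_
    rw [hd, e00]; simp [familyData]; linear_combination c.p1 / 2 * hu
  · refine (r.Γ11 0).trans ?_
    rw [hd]; simp [familyData]; ring
  · refine (r.Γ11 1).trans ?_
    rw [hd]; simp [familyData]; ring

/-- An operator is skew-adjoint if `g` is symmetric and `Γ^{ij}_k + Γ^{ji}_k = ∂_k g^{ij}`. -/
theorem isSkewAdjoint_of_symm (hΩ : IsOpen Ω) (hP : P.SmoothOn Ω)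
    (h1 : ∀ p ∈ Ω, ∀ i j, P.g i j p = P.g j i p)
    (h2 : ∀ p ∈ Ω, ∀ i j k, P.Γ i j k p + P.Γ j i k p = pderiv k (P.g i j) p) :
    IsSkewAdjoint Ω P.toOp := by
  refine (isSkewAdjoint_iff hP).mpr fun U hU ψ j => ?_
  have e1 : ∀ i j, (curveData P U).g i j = (curveData P U).g j i := fun i j =>
    congrArg ofFun (funext fun x => h1 _ (hU x) i j)
  have e2 : ∀ i j k, (curveData P U).G i j k + (curveData P U).G j i k
      = (curveData P U).dg i j k := fun i j k => smooth_ext fun x => by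
    have h := h2 _ (hU x) i j k
    rw [map_add]
    exact (congrArg₂ (· + ·) (evalAt_ofFun_comp hU (hP.2 i j k) x)
      (evalAt_ofFun_comp hU (hP.2 j i k) x)).trans
      (h.trans (evalAt_ofFun_comp hU (contDiffOn_pderiv hΩ (hP.1 i j) k) x).symm)
  have e3 : ∀ i j, Dx ((curveData P U).g i j)
      = ∑ l, (curveData P U).dg i j l * Dx ((curveData P U).u l) := fun i j =>
    Dx_ofFun_comp hΩ hU (hP.1 i j)
  rw [firstOrder, adjP, ← Finset.sum_add_distrib]
  refine Finset.sum_eq_zero fun l _ => ?_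
  rw [Derivation.leibniz, e3, smul_eq_mul, smul_eq_mul, e1 l j]
  simp only [Fin.sum_univ_two]
  linear_combination ψ l * Dx ((curveData P U).u 0) * e2 j l 0
    + ψ l * Dx ((curveData P U).u 1) * e2 j l 1
    - ψ l * Dx ((curveData P U).u 0) * (e2 j l 0 - e2 l j 0)
    - ψ l * Dx ((curveData P U).u 1) * (e2 j l 1 - e2 l j 1)

theorem familyOp_smoothOn (hne : ∀ u ∈ Ω, u 0 ≠ 0) (c : Params) : (familyOp c).SmoothOn Ω := by
  have hi : ContDiffOn ℝ ∞ (fun p : Pt => (p 0)⁻¹) Ω := ContDiffOn.inv (by fun_prop) hne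
  have hv : ContDiffOn ℝ ∞ (fun p : Pt => p 1) Ω := by fun_prop
  have hu : ContDiffOn ℝ ∞ (fun p : Pt => p 0) Ω := by fun_prop
  have hc : ∀ r : ℝ, ContDiffOn ℝ ∞ (fun _ : Pt => r) Ω := fun _ => contDiffOn_const
  have h01 := (((hc c.p4).mul hu).add ((hc c.p3).mul hi)).add
    ((hc (c.p2 / 2)).mul (hi.mul (hv.mul hv)))
  constructor
  · intro i j
    rw [show (familyOp c).g i j = fun q => (familyData c q (q 0)⁻¹).g i j from
      funext (metric_eq_familyData c i j)]
    fin_cases i <;> fin_cases j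
    · exact ((hc c.p1).mul hu).add ((hc c.p2).mul hv)
    · exact h01
    · exact h01
    · exact ((((hc (2 * c.p4)).mul hv).add ((hc c.p6).mul hi)).sub
        ((hc c.p1).mul (hi.mul (hv.mul hv)))).add (hc c.p5)
  · intro i j k
    fin_cases i <;> fin_cases j <;> fin_cases k
    · exact hc _
    · exact hc _
    · exact hc _
    · exact hc _
    · exact (((hc c.p3).mul (hi.mul hi)).neg).sub
        ((hc (c.p2 / 2)).mul ((hi.mul hi).mul (hv.mul hv)))
    · exact ((hc c.p2).mul (hi.mul hv)).add (hc (c.p1 / 2))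
    · exact (((hc (c.p6 / 2)).mul (hi.mul hi)).neg).add
        ((hc (c.p1 / 2)).mul ((hi.mul hi).mul (hv.mul hv)))
    · exact (hc c.p4).sub ((hc c.p1).mul (hi.mul hv))

theorem curveData_familyOp (hΩ : IsOpen Ω) (hne : ∀ u ∈ Ω, u 0 ≠ 0) (c : Params)
    {U : Fin 2 → Smooth} (hU : ∀ x, vec U x ∈ Ω) :
    curveData (familyOp c) U = familyData c U (curveData (familyOp c) U).a := by
  have hs := familyOp_smoothOn hne c
  have hu := fun x => hne _ (hU x)
  have ha : ∀ x, evalAt x (curveData (familyOp c) U).a = (vec U x 0)⁻¹ := (exists_inv hu).2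
  -- evaluation at `x` turns the member along the curve into the member at the point
  have hm : ∀ x, (familyData c U (curveData (familyOp c) U).a).map (evalAt x)
      = familyData c (vec U x) (vec U x 0)⁻¹ := fun x => by
    rw [← ha x]
    generalize (curveData (familyOp c) U).a = a
    have hc : ∀ r, evalAt x (algebraMap ℝ Smooth r) = algebraMap ℝ ℝ r := fun _ => rfl
    simp only [CurveData.map, familyData, CurveData.mk.injEq]
    refine ⟨rfl, trivial, ?_, ?_, ?_, ?_⟩
    · funext i j
      fin_cases i <;> fin_cases j <;> rfl
    · funext i j k
      fin_cases i <;> fin_cases j <;> fin_cases k <;> rfl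
    · funext i j k
      fin_cases i <;> fin_cases j <;> fin_cases k <;> rfl
    · funext i j k l
      fin_cases i <;> fin_cases j <;> fin_cases k <;> fin_cases l <;> rfl
  have hJ : ∀ {J K : CurveData Smooth}, J.u = K.u → J.a = K.a → J.g = K.g → J.G = K.G →
      J.dg = K.dg → J.dG = K.dG → J = K := by
    rintro ⟨⟩ ⟨⟩ rfl rfl rfl rfl rfl rfl
    rfl
  refine hJ rfl rfl ?_ ?_ ?_ ?_
  · funext i j
    exact smooth_ext fun x => (evalAt_ofFun_comp hU (hs.1 i j) x).trans
      ((metric_eq_familyData c i j _).trans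
        (congrArg (fun J : CurveData ℝ => J.g i j) (hm x).symm))
  · funext i j k
    exact smooth_ext fun x => (evalAt_ofFun_comp hU (hs.2 i j k) x).trans
      (congrArg (fun J : CurveData ℝ => J.G i j k) (hm x).symm)
  · funext i j k
    exact smooth_ext fun x =>
      (evalAt_ofFun_comp hU (contDiffOn_pderiv hΩ (hs.1 i j) k) x).trans
      (((hasPartials_metric c i j (hu x)).pderiv_eq k).trans
        (congrArg (fun J : CurveData ℝ => J.dg i j k) (hm x).symm))
  · funext i j k l
    exact smooth_ext fun x =>
      (evalAt_ofFun_comp hU (contDiffOn_pderiv hΩ (hs.2 i j k) l) x).trans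
      (((hasPartials_connection c i j k (hu x)).pderiv_eq l).trans
        (congrArg (fun J : CurveData ℝ => J.dG i j k l) (hm x).symm))

/-- Every member of the family occurs as a compatible operator. -/
theorem compatibleWithR3_familyOp (hΩ : IsOpen Ω) (hne : ∀ u ∈ Ω, u 0 ≠ 0) (c : Params) :
    CompatibleWithR3 Ω (familyOp c) := by
  have hs := familyOp_smoothOn hne c
  refine ⟨hs, isSkewAdjoint_of_symm hΩ hs ?_ ?_, (schoutenCommute_iff hΩ hne hs).mpr ?_⟩
  · intro p _ i j
    exact (metric_eq_familyData c i j p).trans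
      ((familyData_metric_symm c p _ i j).trans (metric_eq_familyData c j i p).symm)
  · intro p hp i j k
    exact (familyData_connection_add c p _ i j k).trans
      ((hasPartials_metric c i j (hne p hp)).pderiv_eq k).symm
  · intro U hU φ χ j
    rw [curveData_familyOp hΩ hne c hU]
    exact bracketForm_familyData c (curveData_a_mul (fun x => hne _ (hU x)) _) φ χ j

end

end CompatibleTrio

namespace CompatibleTrio

/-! ### Contravariant connections and curvature -/

section

variable {g : Fin 2 → Fin 2 → Pt → ℝ} {p : Pt}

theorem covMetric_eq (g : Fin 2 → Fin 2 → Pt → ℝ) (i j : Fin 2) (p : Pt) :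
    covMetric g i j p = (g 0 0 p * g 1 1 p - g 0 1 p * g 1 0 p)⁻¹
      * !![g 1 1 p, -g 0 1 p; -g 1 0 p, g 0 0 p] i j := by
  rw [covMetric, Matrix.inv_def, Matrix.adjugate_fin_two, Matrix.det_fin_two, Ring.inverse_eq_inv']
  simp [contraMatrix]

theorem det_contraMatrix (g : Fin 2 → Fin 2 → Pt → ℝ) (p : Pt) :
    (contraMatrix g p).det = g 0 0 p * g 1 1 p - g 0 1 p * g 1 0 p := by
  rw [Matrix.det_fin_two]
  rfl

theorem covMetric_symm (hg : g 0 1 p = g 1 0 p) (i j : Fin 2) :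
    covMetric g i j p = covMetric g j i p := by
  fin_cases i <;> fin_cases j <;> simp [covMetric_eq, hg]

theorem sum_mul_covMetric (hdet : (contraMatrix g p).det ≠ 0) (i j : Fin 2) :
    ∑ s, g i s p * covMetric g s j p = if i = j then 1 else 0 := by
  have h := congrFun (congrFun (Matrix.mul_nonsing_inv (contraMatrix g p)
    (isUnit_iff_ne_zero.mpr hdet)) i) j
  rwa [Matrix.mul_apply, Matrix.one_apply] at h

/-- The derivative of the inverse matrix. -/
theorem hasPartials_covMetric {dg : Fin 2 → Fin 2 → Fin 2 → ℝ}
    (hd : ∀ i j, HasPartials (g i j) (dg i j) p) (hdet : (contraMatrix g p).det ≠ 0)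
    (i j : Fin 2) :
    HasPartials (covMetric g i j)
      (fun k => -∑ a, ∑ b, covMetric g i a p * dg a b k * covMetric g b j p) p := by
  rw [det_contraMatrix] at hdet
  have hi := (((hd 0 0).mul (hd 1 1)).sub ((hd 0 1).mul (hd 1 0))).inv hdet
  have hδ := inv_mul_cancel₀ hdet
  rw [show covMetric g i j = _ from funext (covMetric_eq g i j)]
  simp only [covMetric_eq, Fin.sum_univ_two]
  obtain ⟨δ, hδe⟩ : ∃ δ, δ = (g 0 0 p * g 1 1 p - g 0 1 p * g 1 0 p)⁻¹ := ⟨_, rfl⟩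
  rw [← hδe] at hδ
  simp only [← hδe] at hi ⊢
  fin_cases i <;> fin_cases j
  · refine (hi.mul (hd 1 1)).congr_partials ?_ ?_ <;> simp [← hδe]
    · linear_combination -(δ * dg 1 1 0) * hδ
    · linear_combination -(δ * dg 1 1 1) * hδ
  · refine (hi.mul (hd 0 1).neg).congr_partials ?_ ?_ <;> simp [← hδe]
    · linear_combination (δ * dg 0 1 0) * hδ
    · linear_combination (δ * dg 0 1 1) * hδ
  · refine (hi.mul (hd 1 0).neg).congr_partials ?_ ?_ <;> simp [← hδe]
    · linear_combination (δ * dg 1 0 0) * hδ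
    · linear_combination (δ * dg 1 0 1) * hδ
  · refine (hi.mul (hd 0 0)).congr_partials ?_ ?_ <;> simp [← hδe]
    · linear_combination -(δ * dg 0 0 0) * hδ
    · linear_combination -(δ * dg 0 0 1) * hδ

/-- The Levi-Civita conditions at the point `p`, for a symmetric matrix `g` differentiable there;
`partials` contains both the differentiability and `Γ^{ij}_k + Γ^{ji}_k = ∂_k g^{ij}`. -/
structure LeviCivitaAt (g : Fin 2 → Fin 2 → Pt → ℝ) (Γ : Fin 2 → Fin 2 → Fin 2 → ℝ) (p : Pt) :
    Prop where
  symm : g 0 1 p = g 1 0 p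
  partials : ∀ i j, HasPartials (g i j) (fun k => Γ i j k + Γ j i k) p
  torsion : ∀ i j k, ∑ s, g i s p * Γ j k s = ∑ s, g j s p * Γ i k s

/-- The mixed connection symbols `∑ₐ g_{la} Γ^{aj}_k`, which are the negatives of the Christoffel
symbols `Γ^j_{lk}` of the Levi-Civita connection (`LeviCivitaAt.christoffel_eq`). -/
noncomputable def mixed (g : Fin 2 → Fin 2 → Pt → ℝ) (Γ : Fin 2 → Fin 2 → Fin 2 → ℝ) (p : Pt)
    (l j k : Fin 2) : ℝ :=
  ∑ a, covMetric g l a p * Γ a j k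

variable {Γ : Fin 2 → Fin 2 → Fin 2 → ℝ}

namespace LeviCivitaAt

/-- The torsion condition, with the upper indices lowered. -/
theorem mixed_symm (h : LeviCivitaAt g Γ p) (l j k : Fin 2) :
    mixed g Γ p l j k = mixed g Γ p k j l := by
  have key : mixed g Γ p 0 j 1 = mixed g Γ p 1 j 0 := by
    have t := h.torsion 0 1 j
    simp only [mixed, covMetric_eq, Fin.sum_univ_two] at t ⊢
    simp
    linear_combination -(g 0 0 p * g 1 1 p - g 0 1 p * g 1 0 p)⁻¹ * t
  fin_cases l <;> fin_cases k
  exacts [rfl, key, key.symm, rfl]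

theorem pderiv_covMetric (h : LeviCivitaAt g Γ p) (hdet : (contraMatrix g p).det ≠ 0)
    (s k l : Fin 2) : pderiv l (covMetric g s k) p
      = -∑ c, (covMetric g k c p * mixed g Γ p s c l + covMetric g s c p * mixed g Γ p k c l) := by
  rw [(hasPartials_covMetric h.partials hdet s k).pderiv_eq]
  simp only [mixed, Fin.sum_univ_two]
  have e := covMetric_symm h.symm
  rw [e 0 k, e 1 k]
  ring

theorem christoffel_eq (h : LeviCivitaAt g Γ p) (hdet : (contraMatrix g p).det ≠ 0)
    (j l k : Fin 2) : christoffel g j l k p = -mixed g Γ p l j k := by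
  have hS := h.mixed_symm
  have hb : ∀ s, pderiv l (covMetric g s k) p + pderiv k (covMetric g s l) p
      - pderiv s (covMetric g l k) p = -2 * ∑ c, covMetric g s c p * mixed g Γ p l c k := by
    intro s
    simp only [h.pderiv_covMetric hdet, Fin.sum_univ_two]
    rw [hS s 0 l, hS s 1 l, hS s 0 k, hS s 1 k, hS k 0 l, hS k 1 l]
    ring
  have h0 := sum_mul_covMetric hdet j 0
  have h1 := sum_mul_covMetric hdet j 1
  rw [christoffel]
  simp only [hb]
  rw [Fin.sum_univ_two] at h0 h1
  simp only [Fin.sum_univ_two]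
  have hj : mixed g Γ p l j k = (if j = 0 then 1 else 0) * mixed g Γ p l 0 k
      + (if j = 1 then 1 else 0) * mixed g Γ p l 1 k := by
    fin_cases j <;> simp
  rw [hj]
  linear_combination -mixed g Γ p l 0 k * h0 - mixed g Γ p l 1 k * h1

/-- Where the metric is non-degenerate, the Levi-Civita conditions characterise the contravariant
Christoffel symbols. -/
theorem contraChristoffel_eq (h : LeviCivitaAt g Γ p) (hdet : (contraMatrix g p).det ≠ 0)
    (i j k : Fin 2) : contraChristoffel g i j k p = Γ i j k := by
  have h0 := sum_mul_covMetric hdet i 0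
  have h1 := sum_mul_covMetric hdet i 1
  have hi : Γ i j k = (if i = 0 then 1 else 0) * Γ 0 j k + (if i = 1 then 1 else 0) * Γ 1 j k := by
    fin_cases i <;> simp
  rw [hi, contraChristoffel]
  simp only [h.christoffel_eq hdet, mixed]
  rw [Fin.sum_univ_two] at h0 h1
  simp only [Fin.sum_univ_two]
  linear_combination Γ 0 j k * h0 + Γ 1 j k * h1

end LeviCivitaAt

/-- The curvature tensor in terms of `Γ^{ij}_k`, if these coefficients are gradients in the index
`k`. The derivatives of the connection then cancel, and the derivatives of the covariant metric are
expressed through the connection, so that the curvature is algebraic in `g` and `Γ`. -/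
theorem riemann_eq {Ω : Set Pt} (hΩ : IsOpen Ω) {Γ : Fin 2 → Fin 2 → Fin 2 → Pt → ℝ}
    (h : ∀ q ∈ Ω, LeviCivitaAt g (fun i j k => Γ i j k q) q)
    (hdet : ∀ q ∈ Ω, (contraMatrix g q).det ≠ 0) (hp : p ∈ Ω)
    {dΓ : Fin 2 → Fin 2 → Fin 2 → Fin 2 → ℝ}
    (hΓ : ∀ i j k, HasPartials (Γ i j k) (dΓ i j k) p)
    (hclosed : ∀ i j k l, dΓ i j k l = dΓ i j l k) (i j k l : Fin 2) :
    riemann g i j k l p = ∑ c, covMetric g j c p * ∑ a, ∑ b, covMetric g a b p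
      * (Γ b c k p * Γ a i l p - Γ b c l p * Γ a i k p) := by
  have hH := (h p hp).pderiv_covMetric (hdet p hp)
  have hsymm := covMetric_symm (h p hp).symm
  have hd := hasPartials_covMetric (h p hp).partials (hdet p hp)
  have hchr : ∀ l i j, ∀ q ∈ Ω, christoffel g i l j q
      = -(covMetric g j 0 q * Γ 0 i l q + covMetric g j 1 q * Γ 1 i l q) := fun l i j q hq => by
    rw [(h q hq).christoffel_eq (hdet q hq), (h q hq).mixed_symm, mixed, Fin.sum_univ_two]
  have hdchr : ∀ l i j k, pderiv k (christoffel g i l j) p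
      = -((covMetric g j 0 p * dΓ 0 i l k + Γ 0 i l p * pderiv k (covMetric g j 0) p)
        + (covMetric g j 1 p * dΓ 1 i l k + Γ 1 i l p * pderiv k (covMetric g j 1) p)) :=
    fun l i j k => by
      rw [(((((hd j 0).mul (hΓ 0 i l)).add ((hd j 1).mul (hΓ 1 i l))).neg).congr hΩ hp
        (hchr l i j)).pderiv_eq, (hd j 0).pderiv_eq, (hd j 1).pderiv_eq]
  rw [riemann, hdchr, hdchr, hclosed 0 i k l, hclosed 1 i k l]
  have hc1 : ∀ l i j, christoffel g i l j p = -mixed g (fun i j k => Γ i j k p) p l i j :=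
    fun l i j => (h p hp).christoffel_eq (hdet p hp) i l j
  have hm := (h p hp).mixed_symm
  simp only [hc1, hH, Fin.sum_univ_two]
  rw [hm k i 0, hm k i 1, hm l i 0, hm l i 1, hm l 0 j, hm l 1 j, hm k 0 j, hm k 1 j]
  simp only [mixed, Fin.sum_univ_two]
  rw [hsymm 1 0]
  ring

end

end CompatibleTrio

namespace CompatibleTrio

/-! ### The quadratic system and flat pencils -/

theorem Params.system_iff_cases (c : Params) : c.System ↔ (c.Case1 ∨ c.Case2 ∨ c.Case3) := by
  constructor
  · rintro ⟨h1, h2, h3⟩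
    by_cases k1 : c.p1 = 0
    · by_cases k2 : c.p2 = 0
      · exact Or.inr (Or.inr ⟨k1, k2⟩)
      · rw [k1, mul_zero, zero_mul, add_zero] at h1
        exact Or.inr (Or.inl ⟨k1, k2, (mul_eq_zero.mp h2).resolve_left k2,
          (mul_eq_zero.mp h1).resolve_left k2⟩)
    · refine Or.inl ⟨k1, (mul_eq_zero.mp h3).resolve_left k1, ?_⟩
      rw [eq_div_iff (mul_ne_zero two_ne_zero k1)]
      linear_combination h1
  · rintro (⟨k1, h5, h3⟩ | ⟨h1, -, h5, h6⟩ | ⟨h1, h2⟩)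
    · rw [eq_div_iff (mul_ne_zero two_ne_zero k1)] at h3
      exact ⟨by linear_combination h3, by rw [h5, mul_zero], by rw [h5, mul_zero]⟩
    · exact ⟨by rw [h1, h6]; ring, by rw [h5, mul_zero], by rw [h5, mul_zero]⟩
    · exact ⟨by rw [h1, h2]; ring, by rw [h2, zero_mul], by rw [h1, zero_mul]⟩

/-- The parameters `c - t d`. -/
def Params.pencil (c d : Params) (t : ℝ) : Params :=
  ⟨c.p1 - t * d.p1, c.p2 - t * d.p2, c.p3 - t * d.p3, c.p4 - t * d.p4, c.p5 - t * d.p5,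
    c.p6 - t * d.p6⟩

/-- The polarization of the quadratic system: the vanishing of the three associated symmetric
bilinear forms on `(c, d)`. -/
def Params.Polar (c d : Params) : Prop :=
  c.p2 * d.p6 + d.p2 * c.p6 + 2 * (c.p1 * d.p3 + d.p1 * c.p3) = 0 ∧
    c.p2 * d.p5 + d.p2 * c.p5 = 0 ∧ c.p1 * d.p5 + d.p1 * c.p5 = 0

/-- A quadratic form that vanishes at `c` and `d` takes the value `-t B(c, d)` at `c - t d`, where
`B` is its polarization. -/
theorem Params.system_pencil_iff {c d : Params} (hc : c.System) (hd : d.System) {t : ℝ}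
    (ht : t ≠ 0) : (c.pencil d t).System ↔ c.Polar d := by
  obtain ⟨h1, h2, h3⟩ := hc
  obtain ⟨k1, k2, k3⟩ := hd
  constructor
  · rintro ⟨e1, e2, e3⟩
    simp only [Params.pencil] at e1 e2 e3
    exact ⟨mul_left_cancel₀ ht (by linear_combination h1 + t ^ 2 * k1 - e1),
      mul_left_cancel₀ ht (by linear_combination h2 + t ^ 2 * k2 - e2),
      mul_left_cancel₀ ht (by linear_combination h3 + t ^ 2 * k3 - e3)⟩
  · rintro ⟨e1, e2, e3⟩
    refine ⟨?_, ?_, ?_⟩ <;> simp only [Params.pencil]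
    · linear_combination h1 + t ^ 2 * k1 - t * e1
    · linear_combination h2 + t ^ 2 * k2 - t * e2
    · linear_combination h3 + t ^ 2 * k3 - t * e3

/-- The operator `R` coincides on `Ω` with the member `c` of the family. -/
structure IsMember (Ω : Set Pt) (R : HydroOp) (c : Params) : Prop where
  metric : HasMetric Ω R c
  connection : ∀ p ∈ Ω, ∀ i j k, R.Γ i j k p = (familyData c p (p 0)⁻¹).G i j k

section

variable {Ω : Set Pt} {P Q R : HydroOp} {c d : Params}

theorem IsMember.pencil (hP : IsMember Ω P c) (hQ : IsMember Ω Q d) (t : ℝ) :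
    IsMember Ω (P.pencil Q t) (c.pencil d t) := by
  constructor
  · intro p hp i j
    have h : (P.pencil Q t).g i j p = CompatibleTrio.metric c i j p
        - t * CompatibleTrio.metric d i j p := by
      rw [← hP.metric p hp, ← hQ.metric p hp]; rfl
    rw [h]
    fin_cases i <;> fin_cases j <;> simp [CompatibleTrio.metric, Params.pencil] <;> ring
  · intro p hp i j k
    have h : (P.pencil Q t).Γ i j k p
        = (familyData c p (p 0)⁻¹).G i j k - t * (familyData d p (p 0)⁻¹).G i j k := by
      rw [← hP.connection p hp, ← hQ.connection p hp]; rfl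
    rw [h]
    fin_cases i <;> fin_cases j <;> fin_cases k <;> simp [familyData, Params.pencil] <;> ring

/-- The defect of the torsion condition for the family, in the first of its two components. -/
theorem torsion_zero (c : Params) {u : Fin 2 → ℝ} {a : ℝ} (ha : a * u 0 = 1) :
    ∑ s, (familyData c u a).g 0 s * (familyData c u a).G 1 0 s
      - ∑ s, (familyData c u a).g 1 s * (familyData c u a).G 0 0 s
      = -(1 / 2) * (a * (c.p2 * c.p6 + 2 * c.p1 * c.p3) + c.p2 * c.p5) := by
  simp [familyData, Fin.sum_univ_two]
  linear_combination (-c.p1 * c.p3 * a - c.p1 * c.p2 / 2 * a * u 1 ^ 2 + c.p2 * c.p4 * u 1) * ha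

/-- The defect of the torsion condition for the family, in the second component. -/
theorem torsion_one (c : Params) {u : Fin 2 → ℝ} {a : ℝ} (ha : a * u 0 = 1) :
    ∑ s, (familyData c u a).g 0 s * (familyData c u a).G 1 1 s
      - ∑ s, (familyData c u a).g 1 s * (familyData c u a).G 0 1 s
      = -(1 / 2) * (a ^ 2 * u 1 * (c.p2 * c.p6 + 2 * c.p1 * c.p3) - c.p1 * c.p5) := by
  simp [familyData, Fin.sum_univ_two]
  linear_combination (-c.p1 * c.p6 / 2 * a + c.p1 ^ 2 / 2 * a * u 1 ^ 2 - c.p1 * c.p4 * u 1) * ha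

theorem IsMember.leviCivitaAt (h : IsMember Ω R c) (hΩ : IsOpen Ω) (hne : ∀ u ∈ Ω, u 0 ≠ 0)
    (hc : c.System) {p : Pt} (hp : p ∈ Ω) : LeviCivitaAt R.g (fun i j k => R.Γ i j k p) p := by
  have ha : (p 0)⁻¹ * p 0 = 1 := inv_mul_cancel₀ (hne p hp)
  have hg : ∀ i j, R.g i j p = (familyData c p (p 0)⁻¹).g i j := fun i j =>
    (h.metric p hp i j).trans (metric_eq_familyData c i j p)
  refine ⟨?_, fun i j => ?_, ?_⟩
  · rw [hg, hg]
    rfl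
  · refine (h.metric.hasPartials hΩ hne hp i j).congr_partials ?_ ?_ <;>
      simp only [h.connection p hp, familyData_connection_add]
  · have t0 := torsion_zero c ha
    have t1 := torsion_one c ha
    rw [hc.1, hc.2.1, mul_zero, add_zero, mul_zero] at t0
    rw [hc.1, hc.2.2, mul_zero, sub_zero, mul_zero] at t1
    have key : ∀ k, ∑ s, R.g 0 s p * R.Γ 1 k s p = ∑ s, R.g 1 s p * R.Γ 0 k s p := fun k => by
      simp only [h.connection p hp, hg]
      fin_cases k
      exacts [sub_eq_zero.mp t0, sub_eq_zero.mp t1]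
    intro i j k
    fin_cases i <;> fin_cases j
    exacts [rfl, key k, (key k).symm, rfl]

/-- The functions `1` and `1 / u¹` are linearly independent on a non-empty open set. -/
theorem eq_zero_of_inv_mul_add (hΩ : IsOpen Ω) (hΩ' : Ω.Nonempty) (hne : ∀ u ∈ Ω, u 0 ≠ 0)
    {K L : ℝ} (h : ∀ p ∈ Ω, (p 0)⁻¹ * K + L = 0) : K = 0 ∧ L = 0 := by
  obtain ⟨p, hp⟩ := hΩ'
  have h0 := (((HasPartials.const 0 p).congr hΩ hp h).pderiv_eq 0).symm.trans
    ((((hasPartials_inv (hne p hp)).mul (HasPartials.const K p)).add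
      (HasPartials.const L p)).pderiv_eq 0)
  have hK : K = 0 := by
    have h0 : 0 = (p 0)⁻¹ * 0 + K * -((p 0)⁻¹ ^ 2 * 1) + 0 := h0
    have h1 : (p 0)⁻¹ ^ 2 * K = 0 := by linear_combination h0
    exact (mul_eq_zero.mp h1).resolve_left (pow_ne_zero 2 (inv_ne_zero (hne p hp)))
  have h1 := h p hp
  rw [hK, mul_zero, zero_add] at h1
  exact ⟨hK, h1⟩

/-- For a member of the family the condition on `∂_k g^{ij}` always holds, so the Levi-Civita
conditions amount to the vanishing of the torsion defects, hence to the quadratic system. -/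
theorem IsMember.leviCivitaConditions_iff (h : IsMember Ω R c) (hΩ : IsOpen Ω)
    (hΩ' : Ω.Nonempty) (hne : ∀ u ∈ Ω, u 0 ≠ 0) : LeviCivitaConditions Ω R ↔ c.System := by
  constructor
  · intro hLC
    have hg : ∀ p ∈ Ω, ∀ i j, R.g i j p = (familyData c p (p 0)⁻¹).g i j := fun p hp i j =>
      (h.metric p hp i j).trans (metric_eq_familyData c i j p)
    have ht : ∀ p ∈ Ω, ∀ k,
        ∑ s, (familyData c p (p 0)⁻¹).g 0 s * (familyData c p (p 0)⁻¹).G 1 k s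
        - ∑ s, (familyData c p (p 0)⁻¹).g 1 s * (familyData c p (p 0)⁻¹).G 0 k s = 0 :=
      fun p hp k => by
        have e := (hLC p hp).1 0 1 k
        simp only [h.connection p hp, hg p hp] at e
        exact sub_eq_zero.mpr e
    obtain ⟨h1, h2⟩ := eq_zero_of_inv_mul_add (K := c.p2 * c.p6 + 2 * c.p1 * c.p3)
      (L := c.p2 * c.p5) hΩ hΩ' hne fun p hp => by
        have e := (torsion_zero c (inv_mul_cancel₀ (hne p hp))).symm.trans (ht p hp 0)
        linear_combination -2 * e
    obtain ⟨p, hp⟩ := hΩ'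
    have e := (torsion_one c (inv_mul_cancel₀ (hne p hp))).symm.trans (ht p hp 1)
    rw [h1] at e
    exact ⟨h1, h2, by linear_combination 2 * e⟩
  · intro hc p hp
    have hL := h.leviCivitaAt hΩ hne hc hp
    exact ⟨hL.torsion, fun i j k => ((hL.partials i j).pderiv_eq k).symm⟩

theorem familyData_dG_symm (c : Params) (u : Fin 2 → ℝ) (a : ℝ) (i j k l : Fin 2) :
    (familyData c u a).dG i j k l = (familyData c u a).dG i j l k := by
  fin_cases i <;> fin_cases j <;> fin_cases k <;> fin_cases l <;> rfl

/-- The polynomial identity behind flatness: the essential component of the sum in `riemann_eq`,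
multiplied by the determinant, is a combination of the two torsion defects and of the first
equation of the system. -/
theorem curvature_familyData (hc : c.System) {u : Fin 2 → ℝ} {a : ℝ} (ha : a * u 0 = 1) :
    (familyData c u a).g 1 1 * ((familyData c u a).G 0 0 0 * (familyData c u a).G 0 1 1
        - (familyData c u a).G 0 0 1 * (familyData c u a).G 0 1 0)
      - (familyData c u a).g 0 1 * ((familyData c u a).G 1 0 0 * (familyData c u a).G 0 1 1
        - (familyData c u a).G 1 0 1 * (familyData c u a).G 0 1 0
        + (familyData c u a).G 0 0 0 * (familyData c u a).G 1 1 1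
        - (familyData c u a).G 0 0 1 * (familyData c u a).G 1 1 0)
      + (familyData c u a).g 0 0 * ((familyData c u a).G 1 0 0 * (familyData c u a).G 1 1 1
        - (familyData c u a).G 1 0 1 * (familyData c u a).G 1 1 0) = 0 := by
  have t0 := torsion_zero c ha
  have t1 := torsion_one c ha
  rw [hc.1, hc.2.1, mul_zero, add_zero, mul_zero] at t0
  rw [hc.1, hc.2.2, mul_zero, sub_zero, mul_zero] at t1
  have h1 := hc.1
  simp [familyData] at t0 t1 ⊢
  linear_combination (c.p4 - c.p1 * (a * u 1)) * t0 - (c.p2 * (a * u 1) + c.p1 / 2) * t1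
    - (c.p4 * u 0 + c.p3 * a + c.p2 / 2 * (a * (u 1 * u 1))) * a ^ 2 / 4 * h1

/-- The system implies flatness. Curvature is computed on the open set where the metric is
non-degenerate. -/
theorem IsMember.isFlat (h : IsMember Ω R c) (hΩ : IsOpen Ω) (hne : ∀ u ∈ Ω, u 0 ≠ 0)
    (hc : c.System) : IsFlat Ω R.g := by
  intro p hp hdet i j k l
  have hcont : ContinuousOn (fun q => (contraMatrix R.g q).det) Ω := by
    have hg : ∀ i j, ContinuousOn (R.g i j) Ω := fun i j q hq =>
      (HasFDerivAt.continuousAt (h.metric.hasPartials hΩ hne hq i j)).continuousWithinAt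
    simp only [det_contraMatrix]
    exact ((hg 0 0).mul (hg 1 1)).sub ((hg 0 1).mul (hg 1 0))
  have hΩ' : IsOpen (Ω ∩ (fun q => (contraMatrix R.g q).det) ⁻¹' {0}ᶜ) :=
    hcont.isOpen_inter_preimage hΩ isOpen_compl_singleton
  have hL := h.leviCivitaAt hΩ hne hc hp
  rw [riemann_eq hΩ' (fun q hq => h.leviCivitaAt hΩ hne hc hq.1) (fun q hq => hq.2) ⟨hp, hdet⟩
    (fun i j k => (hasPartials_connection c i j k (hne p hp)).congr hΩ hp
      fun q hq => h.connection q hq i j k) (familyData_dG_symm c p _)]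
  have hcurv := curvature_familyData hc (inv_mul_cancel₀ (hne p hp))
  have hg : ∀ i j, (familyData c p (p 0)⁻¹).g i j = R.g i j p := fun i j =>
    ((h.metric p hp i j).trans (metric_eq_familyData c i j p)).symm
  simp only [← h.connection p hp, hg] at hcurv
  have e01 := covMetric_symm hL.symm 1 0
  -- the inner sum is antisymmetric in the indices `c`, `i` and in `k`, `l`, so that only one of its
  -- components has to vanish
  have key : ∑ a, ∑ b, covMetric R.g a b p
      * (R.Γ b 0 0 p * R.Γ a 1 1 p - R.Γ b 0 1 p * R.Γ a 1 0 p) = 0 := by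
    simp only [Fin.sum_univ_two, covMetric_eq]
    simp
    rw [← hL.symm]
    linear_combination (R.g 0 0 p * R.g 1 1 p - R.g 0 1 p * R.g 0 1 p)⁻¹ * hcurv
  simp only [Fin.sum_univ_two, e01] at key ⊢
  refine (congrArg₂ (· + ·) (mul_eq_zero_of_right _ ?_) (mul_eq_zero_of_right _ ?_)).trans
    (add_zero 0)
  · fin_cases i <;> fin_cases k <;> fin_cases l <;> simp only [Fin.zero_eta, Fin.mk_one] <;>
      first | ring1 | linear_combination key | linear_combination -key
  · fin_cases i <;> fin_cases k <;> fin_cases l <;> simp only [Fin.zero_eta, Fin.mk_one] <;>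
      first | ring1 | linear_combination key | linear_combination -key

/-- Flatness of a pencil is a condition on its connections only: each `g - t h` is a member of the
family, which is flat as soon as it satisfies the Levi-Civita conditions. -/
theorem isFlatPencil_iff (hP : IsMember Ω P c) (hQ : IsMember Ω Q d) (hΩ : IsOpen Ω)
    (hΩ' : Ω.Nonempty) (hne : ∀ u ∈ Ω, u 0 ≠ 0) (hc : c.System) (hd : d.System) :
    IsFlatPencil Ω P Q ↔ c.Polar d := by
  constructor
  · intro h
    exact (Params.system_pencil_iff hc hd one_ne_zero).mp
      (((hP.pencil hQ 1).leviCivitaConditions_iff hΩ hΩ' hne).mp (h 1).1)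
  · intro h t
    have ht : (c.pencil d t).System := by
      by_cases t0 : t = 0
      · simpa [t0, Params.pencil] using hc
      · exact (Params.system_pencil_iff hc hd t0).mpr h
    exact ⟨((hP.pencil hQ t).leviCivitaConditions_iff hΩ hΩ' hne).mpr ht,
      (hP.pencil hQ t).isFlat hΩ hne ht⟩

theorem christoffel_symm {g : Fin 2 → Fin 2 → Pt → ℝ} (hΩ : IsOpen Ω)
    (hg : ∀ q ∈ Ω, g 0 1 q = g 1 0 q) {p : Pt} (hp : p ∈ Ω) (i j k : Fin 2) :
    christoffel g i j k p = christoffel g i k j p := by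
  have h : ∀ s, pderiv s (covMetric g j k) p = pderiv s (covMetric g k j) p := fun s => by
    have : covMetric g j k =ᶠ[nhds p] covMetric g k j :=
      Filter.eventually_of_mem (hΩ.mem_nhds hp) fun q hq => covMetric_symm (hg q hq) j k
    rw [pderiv, this.fderiv_eq]
    rfl
  simp only [christoffel, h]
  congr 1
  exact Finset.sum_congr rfl fun s _ => by ring

/-- The contravariant Christoffel symbols of a metric are torsion-free. -/
theorem contraChristoffel_torsion {g : Fin 2 → Fin 2 → Pt → ℝ} (hΩ : IsOpen Ω)
    (hg : ∀ q ∈ Ω, g 0 1 q = g 1 0 q) {p : Pt} (hp : p ∈ Ω) (i j k : Fin 2) :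
    ∑ s, g i s p * contraChristoffel g j k s p = ∑ s, g j s p * contraChristoffel g i k s p := by
  have h := christoffel_symm hΩ hg hp k 0 1
  simp only [contraChristoffel, Fin.sum_univ_two]
  rw [h]
  ring

/-- For non-degenerate metrics the two notions of flat pencil agree. At each point some `t ≠ 0`
makes `g - t h` non-degenerate; there its contravariant Christoffel symbols are torsion-free, and
the vanishing of the torsion defects for one such `t` gives the polarized equations at the point. -/
theorem isFlatPencilOfMetrics_iff (hP : IsMember Ω P c) (hQ : IsMember Ω Q d) (hΩ : IsOpen Ω)
    (hΩ' : Ω.Nonempty) (hne : ∀ u ∈ Ω, u 0 ≠ 0) (hc : c.System) (hd : d.System)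
    (hPn : IsNondegenerate Ω P.g) (hQn : IsNondegenerate Ω Q.g) :
    IsFlatPencil Ω P Q ↔ IsFlatPencilOfMetrics Ω P.g Q.g := by
  have eP : ∀ p ∈ Ω, ∀ i j k, contraChristoffel P.g i j k p = P.Γ i j k p := fun p hp =>
    (hP.leviCivitaAt hΩ hne hc hp).contraChristoffel_eq (hPn p hp)
  have eQ : ∀ p ∈ Ω, ∀ i j k, contraChristoffel Q.g i j k p = Q.Γ i j k p := fun p hp =>
    (hQ.leviCivitaAt hΩ hne hd hp).contraChristoffel_eq (hQn p hp)
  constructor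
  · intro h
    refine ⟨hPn, hQn, fun t => ⟨(h t).2, fun p hp hdet i j k => ?_⟩⟩
    have hM := hP.pencil hQ t
    have hL := hM.leviCivitaAt hΩ hne ((hM.leviCivitaConditions_iff hΩ hΩ' hne).mp (h t).1) hp
    rw [eP p hp, eQ p hp]
    exact hL.contraChristoffel_eq hdet i j k
  · rintro ⟨-, -, h⟩
    rw [isFlatPencil_iff hP hQ hΩ hΩ' hne hc hd]
    have key : ∀ p ∈ Ω, ∃ t : ℝ, t ≠ 0 ∧ ∀ k,
        ∑ s, (P.pencil Q t).g 0 s p * (P.pencil Q t).Γ 1 k s p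
          = ∑ s, (P.pencil Q t).g 1 s p * (P.pencil Q t).Γ 0 k s p := by
      intro p hp
      -- the determinant is quadratic in `t` with leading coefficient `det h ≠ 0`, which is
      -- recovered from its values at `1`, `2` and `3`
      obtain ⟨t, t0, hdet⟩ : ∃ t : ℝ, t ≠ 0 ∧ (contraMatrix (P.pencil Q t).g p).det ≠ 0 := by
        by_contra! hcon
        have h1 := hcon 1 one_ne_zero
        have h2 := hcon 2 two_ne_zero
        have h3 := hcon 3 three_ne_zero
        have hq := hQn p hp
        simp only [det_contraMatrix, HydroOp.pencil] at h1 h2 h3 hq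
        exact hq (by linear_combination (1 / 2) * h1 - h2 + (1 / 2) * h3)
      refine ⟨t, t0, fun k => ?_⟩
      have hM := hP.pencil hQ t
      have hs : ∀ q ∈ Ω, (P.pencil Q t).g 0 1 q = (P.pencil Q t).g 1 0 q := fun q hq =>
        (hM.metric q hq 0 1).trans (hM.metric q hq 1 0).symm
      have hΓ : ∀ i j k, contraChristoffel (P.pencil Q t).g i j k p = (P.pencil Q t).Γ i j k p :=
        fun i j k => by
          have e := (h t).2 p hp hdet i j k
          rw [eP p hp, eQ p hp] at e
          exact e
      simpa only [hΓ] using contraChristoffel_torsion hΩ hs hp 0 1 k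
    obtain ⟨h1, h2, h3⟩ := hc
    obtain ⟨k1, k2, k3⟩ := hd
    have hB : ∀ p ∈ Ω,
        (p 0)⁻¹ * (c.p2 * d.p6 + d.p2 * c.p6 + 2 * (c.p1 * d.p3 + d.p1 * c.p3))
          + (c.p2 * d.p5 + d.p2 * c.p5) = 0 ∧
        (p 0)⁻¹ ^ 2 * p 1 * (c.p2 * d.p6 + d.p2 * c.p6 + 2 * (c.p1 * d.p3 + d.p1 * c.p3))
          = c.p1 * d.p5 + d.p1 * c.p5 := by
      intro p hp
      obtain ⟨t, t0, ht⟩ := key p hp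
      have hM := hP.pencil hQ t
      have hg : ∀ i j, (P.pencil Q t).g i j p = (familyData (c.pencil d t) p (p 0)⁻¹).g i j :=
        fun i j => (hM.metric p hp i j).trans (metric_eq_familyData _ i j p)
      simp only [hM.connection p hp, hg] at ht
      have ha := inv_mul_cancel₀ (hne p hp)
      have e0 := (torsion_zero (c.pencil d t) ha).symm.trans (sub_eq_zero.mpr (ht 0))
      have e1 := (torsion_one (c.pencil d t) ha).symm.trans (sub_eq_zero.mpr (ht 1))
      simp only [Params.pencil] at e0 e1
      constructor
      · refine mul_left_cancel₀ t0 ?_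
        linear_combination 2 * e0 + (p 0)⁻¹ * (h1 + t ^ 2 * k1) + h2 + t ^ 2 * k2
      · refine mul_left_cancel₀ t0 ?_
        linear_combination 2 * e1 + (p 0)⁻¹ ^ 2 * p 1 * (h1 + t ^ 2 * k1) - h3 - t ^ 2 * k3
    obtain ⟨b1, b2⟩ := eq_zero_of_inv_mul_add hΩ hΩ' hne fun p hp => (hB p hp).1
    obtain ⟨p, hp⟩ := hΩ'
    have b3 := (hB p hp).2
    rw [b1, mul_zero] at b3
    exact ⟨b1, b2, b3.symm⟩

end

end CompatibleTrio

theorem mainTheorem6 (Ω : Set CompatibleTrio.Pt) (hopen : IsOpen Ω) (hconn : IsConnected Ω)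
    (hne : ∀ u ∈ Ω, u 0 ≠ 0) :
    -- every operator compatible with the third-order one has a metric of the family
    (∀ P : CompatibleTrio.HydroOp, CompatibleTrio.CompatibleWithR3 Ω P →
      ∃! c : CompatibleTrio.Params, CompatibleTrio.HasMetric Ω P c) ∧
    -- every member of the family occurs
    (∀ c : CompatibleTrio.Params, ∃ P : CompatibleTrio.HydroOp,
      CompatibleTrio.CompatibleWithR3 Ω P ∧ CompatibleTrio.HasMetric Ω P c) ∧
    -- the Levi-Civita conditions, and flatness
    (∀ (P : CompatibleTrio.HydroOp) (c : CompatibleTrio.Params),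
      CompatibleTrio.CompatibleWithR3 Ω P → CompatibleTrio.HasMetric Ω P c →
        (CompatibleTrio.LeviCivitaConditions Ω P ↔
          (c.p2 * c.p6 + 2 * c.p1 * c.p3 = 0 ∧ c.p2 * c.p5 = 0 ∧ c.p1 * c.p5 = 0)) ∧
        (c.System → CompatibleTrio.IsFlat Ω P.g)) ∧
    -- solution of the system
    (∀ c : CompatibleTrio.Params, c.System ↔ (c.Case1 ∨ c.Case2 ∨ c.Case3)) ∧
    -- the flat pencils
    (∀ (P Q : CompatibleTrio.HydroOp) (c d : CompatibleTrio.Params),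
      CompatibleTrio.CompatibleWithR3 Ω P → CompatibleTrio.HasMetric Ω P c →
      CompatibleTrio.CompatibleWithR3 Ω Q → CompatibleTrio.HasMetric Ω Q d →
        (c.Case1 → d.Case1 → (CompatibleTrio.IsFlatPencil Ω P Q ↔
          (d.p6 = d.p1 * c.p6 / c.p1 ∨ d.p2 = d.p1 * c.p2 / c.p1))) ∧
        (c.Case1 → d.Case2 → (CompatibleTrio.IsFlatPencil Ω P Q ↔
          d.p3 = -(d.p2 * c.p6) / (2 * c.p1))) ∧
        (c.Case1 → d.Case3 → (CompatibleTrio.IsFlatPencil Ω P Q ↔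
          (d.p3 = -(d.p6 * c.p2) / (2 * c.p1) ∧ d.p5 = 0))) ∧
        (c.Case2 → d.Case2 → CompatibleTrio.IsFlatPencil Ω P Q) ∧
        (c.Case2 → d.Case3 → (CompatibleTrio.IsFlatPencil Ω P Q ↔
          (d.p5 = 0 ∧ d.p6 = 0))) ∧
        (c.Case3 → d.Case3 → CompatibleTrio.IsFlatPencil Ω P Q) ∧
        (c.System → d.System →
          CompatibleTrio.IsNondegenerate Ω P.g → CompatibleTrio.IsNondegenerate Ω Q.g →
          (CompatibleTrio.IsFlatPencil Ω P Q ↔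
            CompatibleTrio.IsFlatPencilOfMetrics Ω P.g Q.g))) := by
  open CompatibleTrio in
  have hΩ := hconn.nonempty
  have hmem : ∀ {P c}, CompatibleWithR3 Ω P → HasMetric Ω P c → IsMember Ω P c := fun hP hc =>
    ⟨hc, fun p hp => hc.connection_eq hopen hne hP hp⟩
  refine ⟨fun P hP => ?_, fun c => ⟨familyOp c, compatibleWithR3_familyOp hopen hne c,
    fun _ _ _ _ => rfl⟩, fun P c hP hc => ⟨(hmem hP hc).leviCivitaConditions_iff hopen hΩ hne,
    (hmem hP hc).isFlat hopen hne⟩, Params.system_iff_cases, ?_⟩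
  · obtain ⟨c, hc⟩ := exists_hasMetric hopen hconn hne hP
    exact ⟨c, hc, fun d hd => hd.unique hopen hconn hne hc⟩
  intro P Q c d hP hc hQ hd
  have hiff := fun sc sd => isFlatPencil_iff (hmem hP hc) (hmem hQ hd) hopen hΩ hne sc sd
  have s1 : ∀ {e : Params}, e.Case1 → e.System := fun h => (Params.system_iff_cases _).mpr (.inl h)
  have s2 : ∀ {e : Params}, e.Case2 → e.System :=
    fun h => (Params.system_iff_cases _).mpr (.inr (.inl h))
  have s3 : ∀ {e : Params}, e.Case3 → e.System :=
    fun h => (Params.system_iff_cases _).mpr (.inr (.inr h))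
  refine ⟨fun h k => ?_, fun h k => ?_, fun h k => ?_, fun h k => ?_, fun h k => ?_,
    fun h k => ?_, isFlatPencilOfMetrics_iff (hmem hP hc) (hmem hQ hd) hopen hΩ hne⟩
  · rw [hiff (s1 h) (s1 k), Params.Polar]
    obtain ⟨h1, h5, h3⟩ := h
    obtain ⟨k1, k5, k3⟩ := k
    rw [eq_div_iff (mul_ne_zero two_ne_zero h1)] at h3
    rw [eq_div_iff (mul_ne_zero two_ne_zero k1)] at k3
    rw [eq_div_iff h1, eq_div_iff h1, ← sub_eq_zero (b := d.p1 * c.p6),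
      ← sub_eq_zero (b := d.p1 * c.p2), ← mul_eq_zero, h5, k5]
    constructor
    · rintro ⟨e, -, -⟩
      linear_combination -(c.p1 * d.p1) * e + c.p1 ^ 2 * k3 + d.p1 ^ 2 * h3
    · intro e
      refine ⟨mul_left_cancel₀ (mul_ne_zero h1 k1) ?_, by ring, by ring⟩
      linear_combination -e + c.p1 ^ 2 * k3 + d.p1 ^ 2 * h3
  · rw [hiff (s1 h) (s2 k), Params.Polar]
    obtain ⟨h1, h5, h3⟩ := h
    obtain ⟨k1, k2, k5, k6⟩ := k
    rw [eq_div_iff (mul_ne_zero two_ne_zero h1), h5, k5, k6, k1]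
    exact ⟨fun e => by linear_combination e.1, fun e => ⟨by linear_combination e, by ring, by ring⟩⟩
  · rw [hiff (s1 h) (s3 k), Params.Polar]
    obtain ⟨h1, h5, h3⟩ := h
    obtain ⟨k1, k2⟩ := k
    rw [eq_div_iff (mul_ne_zero two_ne_zero h1), h5, k1, k2]
    refine ⟨fun e => ⟨by linear_combination e.1, mul_left_cancel₀ h1 ?_⟩,
      fun e => ⟨by linear_combination e.1, by rw [e.2]; ring, by rw [e.2]; ring⟩⟩
    linear_combination e.2.2
  · rw [hiff (s2 h) (s2 k), Params.Polar]
    obtain ⟨h1, h2, h5, h6⟩ := h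
    obtain ⟨k1, k2, k5, k6⟩ := k
    rw [h1, h5, h6, k1, k5, k6]
    exact ⟨by ring, by ring, by ring⟩
  · rw [hiff (s2 h) (s3 k), Params.Polar]
    obtain ⟨h1, h2, h5, h6⟩ := h
    obtain ⟨k1, k2⟩ := k
    rw [h1, h5, h6, k1, k2]
    refine ⟨fun e => ⟨mul_left_cancel₀ h2 ?_, mul_left_cancel₀ h2 ?_⟩,
      fun e => ⟨by rw [e.2]; ring, by rw [e.1]; ring, by ring⟩⟩
    · linear_combination e.2.1
    · linear_combination e.1
  · rw [hiff (s3 h) (s3 k), Params.Polar]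
    obtain ⟨h1, h2⟩ := h
    obtain ⟨k1, k2⟩ := k
    rw [h1, h2, k1, k2]
    exact ⟨by ring, by ring, by ring⟩
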